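/- \textbf{Setting.} Let $d\ge 1$ and let $\Omega$ be the set of simple, locally finite point configurations $\eta\subset\mathbb{R}^d$, with the $\sigma$-algebra generated by the counts $N_\Lambda(\eta)=|\eta\cap\Lambda|$, $\Lambda\subset\mathbb{R}^d$ bounded Borel. Write $\eta_\Lambda=\eta\cap\Lambda$, $\theta_x\eta=\{y-x: y\in\eta\}$, $\gamma_0\eta=\eta\setminus\{0\}$, $\Lambda_n=[-n/2,n/2)^d$; $\mu_\Lambda$ is the law of $\eta_\Lambda$ under $\mu$, and $\pi_\Lambda$ is the law of the Poisson point process of intensity $1$ in $\Lambda$. Let $H$ be a measurable, translation-invariant real function on finite configurations such that, for bounded Borel $\Lambda$, $H_\Lambda(\eta)=\lim_n\big(H(\eta_{\Lambda_n})-H(\eta_{\Lambda_n\setminus\Lambda})\big)$ exists for every $\eta\in\Omega$; that has finite range, i.e. for some $R>0$, $H_\Lambda(\eta)=H_\Lambda(\eta_{\{x:\,\mathrm{dist}(x,\Lambda)\le R\}})$ for all such $\Lambda$ and all $\eta$; and for which $h(x,\eta)=\lim_n\big(H(\eta_{\Lambda_n}\cup\{x\})-H(\eta_{\Lambda_n})\big)$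 is bounded in $(x,\eta)$. Put $b(x,\eta)=e^{-h(x,\eta)}$ and $$(\mathscr{L}f)(\eta)=\int_{\mathbb{R}^d} b(x,\eta)\big(f(\eta\cup\{x\})-f(\eta)\big)\,dx+\sum_{x\in\eta}\big(f(\eta\setminus\{x\})-f(\eta)\big).$$ Let $\nu$ be a translation-invariant Gibbs point process for $H$, i.e. a translation-invariant probability measure on $\Omega$ such that for all bounded Borel $\Lambda$ and measurable $f\ge0$, $$\int f\,d\nu=\int\nu(d\omega)\,\frac{1}{Z_\Lambda(\omega)}\int\pi_\Lambda(d\eta)\,e^{-H_\Lambda(\eta_\Lambda\omega_{\Lambda^c})}f(\eta_\Lambda\omega_{\Lambda^c}),\qquad Z_\Lambda(\omega)=\int\pi_\Lambda(d\eta)\,e^{-H_\Lambda(\eta_\Lambda\omega_{\Lambda^c})}.$$ For a translation-invariant probability measure $\mu$ on $\Omega$ with $\mu[N_{[0,1]^d}]<\infty$, let $\mu_0$ be its (unnormalized) Palm measure, i.e. the unique measure on $\Omega$ with $$\int\mu(d\eta)\sum_{x\in\eta}f(x,\theta_x\eta)=\int dx\int\mu_0(d\zeta)\,f(x,\zeta)\qquad\text{for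 all measurable } f\ge0,$$ and let $\mu_0^!=\mu_0\circ\gamma_0^{-1}$ be the reduced Palm measure. For finite measures let $I(P\,|\,Q)=\int\log\frac{dP}{dQ}\,dP\in(-\infty,\infty]$ if $P\ll Q$, and $I(P\,|\,Q)=\infty$ otherwise. Let $\mathscr{S}$ be the $\sigma$-algebra of translation-invariant measurable sets. For $f\in L^1(\mu_0)$, $\mathbb{E}^{\mu_0}[f\,|\,\mathscr{S}]$ denotes the $\mu$-a.s. unique $\mathscr{S}$-measurable $Y\in L^1(\mu)$ with $\int_A Y\,d\mu=\int_A f\,d\mu_0$ for all $A\in\mathscr{S}$. \textbf{Statement.} Let $\mu$ be a translation-invariant probability measure on $\Omega$ with $\mu[N_{[0,1]^d}]<\infty$ such that $\mu_\Lambda$ and $\pi_\Lambda$ are equivalent for every bounded Borel $\Lambda\subset\mathbb{R}^d$. Set $$\sigma_\Lambda(\mu)=\mu\Big[(-\mathscr{L})\log\frac{d\mu_\Lambda}{d\nu_\Lambda}\Big]$$ if the expectation exists (the integral over $x$ in $\mathscr{L}\log\frac{d\mu_\Lambda}{d\nu_\Lambda}(\eta)$ converges absolutely for $\mu$-a.e.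 $\eta$, and the resulting function is $\mu$-integrable), and $\sigma_\Lambda(\mu)=+\infty$ otherwise. Then the limit $$\sigma(\mu)=\lim_{n\to\infty}\frac{1}{|\Lambda_n|}\,\sigma_{\Lambda_n}(\mu)$$ exists in $(-\infty,\infty]$ and $$\sigma(\mu)=I\big(b(0,\cdot)\mu\,\big|\,\mu_0^!\big)+I\big(\mu_0^!\,\big|\,b(0,\cdot)\mu\big).$$ If moreover $\sigma(\mu)<\infty$, then $(-\mathscr{L})\log\frac{d\mu_{\Lambda_n}}{d\nu_{\Lambda_n}}$ is $\mu$-a.e. well-defined and in $L^1(\mu)$ for all $n\ge1$, and as $n\to\infty$, $$\frac{1}{|\Lambda_n|}(-\mathscr{L})\log\frac{d\mu_{\Lambda_n}}{d\nu_{\Lambda_n}}\;\longrightarrow\;\mathbb{E}^{\mu}\Big[b(0,\cdot)\log\frac{d(b(0,\cdot)\mu)}{d\mu_0^!}\,\Big|\,\mathscr{S}\Big]+\mathbb{E}^{\mu_0}\Big[\log\frac{d\mu_0^!}{d(b(0,\cdot)\mu)}\circ\gamma_0\,\Big|\,\mathscr{S}\Big]\quad\text{in }L^1(\mu),$$ where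 the functions inside both conditional expectations are integrable (with respect to $\mu$ and $\mu_0$, respectively). -/

import Mathlib

open MeasureTheory Filter Topology

namespace BirthDeath

/-- Euclidean space `ℝ^d`. -/
abbrev Space (d : ℕ) : Type := EuclideanSpace ℝ (Fin d)

/-- Simple, locally finite point configurations in `ℝ^d`, identified with their supports. -/
@[ext]
structure Config (d : ℕ) where
  /-- The set of points of the configuration. -/
  pts : Set (Space d)
  locallyFinite : ∀ B : Set (Space d), Bornology.IsBounded B → (pts ∩ B).Finite

namespace Config

variable {d : ℕ}

/-- The number of points in `Λ` (used for bounded `Λ`, where the set is finite). -/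
noncomputable def count (Λ : Set (Space d)) (η : Config d) : ℕ := (η.pts ∩ Λ).ncard

/-- The `σ`-algebra generated by the counting variables of bounded Borel sets. -/
noncomputable instance instMeasurableSpace : MeasurableSpace (Config d) :=
  ⨆ (Λ : Set (Space d)) (_ : Bornology.IsBounded Λ) (_ : MeasurableSet Λ),
    MeasurableSpace.comap (count Λ) ⊤

/-- The restriction `η_Λ = η ∩ Λ`. -/
def restrict (Λ : Set (Space d)) (η : Config d) : Config d where
  pts := η.pts ∩ Λ
  locallyFinite B hB := (η.locallyFinite B hB).subset fun _ hx => ⟨hx.1.1, hx.2⟩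

/-- The configuration `η + δ_x`. -/
def add (η : Config d) (x : Space d) : Config d where
  pts := insert x η.pts
  locallyFinite B hB := ((η.locallyFinite B hB).insert x).subset fun y hy => by
    rcases hy with ⟨rfl | hy, hyB⟩
    · exact Set.mem_insert _ _
    · exact Set.mem_insert_of_mem _ ⟨hy, hyB⟩

/-- The configuration `η - δ_x`. -/
def del (η : Config d) (x : Space d) : Config d where
  pts := η.pts \ {x}
  locallyFinite B hB := (η.locallyFinite B hB).subset fun _ hy => ⟨hy.1.1, hy.2⟩

/-- The configuration `η_Λ ω_{Λᶜ}`. -/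
def glue (Λ : Set (Space d)) (η ω : Config d) : Config d where
  pts := (η.pts ∩ Λ) ∪ (ω.pts ∩ Λᶜ)
  locallyFinite B hB := ((η.locallyFinite B hB).union (ω.locallyFinite B hB)).subset fun y hy => by
    rcases hy with ⟨hy | hy, hyB⟩
    · exact Or.inl ⟨hy.1, hyB⟩
    · exact Or.inr ⟨hy.1, hyB⟩

/-- The translation `θ_x`, moving each point `y` to `y - x`. -/
def shift (x : Space d) (η : Config d) : Config d where
  pts := (fun y => y - x) '' η.pts
  locallyFinite B hB := by
    have h : Bornology.IsBounded ((fun y => y + x) '' B) := by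
      have := (LipschitzWith.id.add (LipschitzWith.const (α := Space d) x)).isBounded_image hB
      simpa using this
    refine ((η.locallyFinite _ h).image (fun y => y - x)).subset ?_
    rintro _ ⟨⟨y, hy, rfl⟩, hB'⟩
    exact ⟨y, ⟨hy, _, hB', by simp⟩, rfl⟩

/-- The configuration `{x_1, …, x_k}`. -/
def ofFin {k : ℕ} (x : Fin k → Space d) : Config d where
  pts := Set.range x
  locallyFinite _ _ := (Set.finite_range x).subset Set.inter_subset_left

theorem measurable_count {Λ : Set (Space d)} (hb : Bornology.IsBounded Λ)
    (hm : MeasurableSet Λ) : Measurable (count Λ) := by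
  refine Measurable.of_comap_le ?_
  exact le_iSup_of_le Λ (le_iSup_of_le hb (le_iSup_of_le hm le_rfl))

theorem measurable_of_count {α : Type*} [MeasurableSpace α] {f : α → Config d}
    (h : ∀ Λ : Set (Space d), Bornology.IsBounded Λ → MeasurableSet Λ →
      Measurable fun a => count Λ (f a)) : Measurable f := by
  refine Measurable.of_le_map ?_
  refine iSup_le fun Λ => iSup_le fun hb => iSup_le fun hm => ?_
  rintro _ ⟨t, ht, rfl⟩
  exact h Λ hb hm ht

theorem measurable_restrict {Λ : Set (Space d)} (hm : MeasurableSet Λ) :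
    Measurable (restrict Λ) := by
  refine measurable_of_count fun B hB hBm => ?_
  have : (fun η : Config d => count B (restrict Λ η)) = count (Λ ∩ B) := by
    funext η
    simp only [count, restrict, Set.inter_assoc]
  rw [this]
  exact measurable_count (hB.subset Set.inter_subset_right) (hm.inter hBm)

theorem measurable_del (x : Space d) : Measurable fun η : Config d => η.del x := by
  refine measurable_of_count fun B hB hBm => ?_
  have : (fun η : Config d => count B (η.del x)) = count (B \ {x}) := by
    funext η
    have h : (η.pts \ {x}) ∩ B = η.pts ∩ (B \ {x}) := by
      ext y; simp only [Set.mem_inter_iff, Set.mem_sdiff]; tauto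
    simp only [count, del, h]
  rw [this]
  exact measurable_count (hB.subset Set.sdiff_subset) (hBm.diff (measurableSet_singleton x))

theorem measurable_shift (x : Space d) : Measurable (shift x) := by
  refine measurable_of_count fun B hB hBm => ?_
  have hb : Bornology.IsBounded ((fun y : Space d => y - x) ⁻¹' B) := by
    have h := (LipschitzWith.id.add (LipschitzWith.const (α := Space d) x)).isBounded_image hB
    refine h.subset fun y hy => ⟨y - x, hy, by simp⟩
  have : (fun η : Config d => count B (shift x η)) = count ((fun y => y - x) ⁻¹' B) := by
    funext η
    simp only [count, shift, ← Set.image_inter_preimage]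
    exact Set.ncard_image_of_injective _ (sub_left_injective (b := x))
  rw [this]
  exact measurable_count hb (measurable_id.sub_const x hBm)

theorem measurable_ofFin (k : ℕ) : Measurable (ofFin : (Fin k → Space d) → Config d) := by
  classical
  refine measurable_of_count fun B _ hBm => ?_
  have : (fun x : Fin k → Space d => count B (ofFin x)) = fun x =>
      ∑ i : Fin k, if x i ∈ B ∧ ∀ j : Fin k, j < i → x j ≠ x i then 1 else 0 := by
    funext x
    rw [← Finset.card_filter, ← Set.ncard_coe_finset]
    refine (Set.ncard_congr (fun i _ => x i) ?_ ?_ ?_).symm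
    · intro i hi
      simp only [Finset.coe_filter, Set.mem_ofPred_eq] at hi
      exact ⟨⟨i, rfl⟩, hi.2.1⟩
    · intro i j hi hj hij
      simp only [Finset.coe_filter, Set.mem_ofPred_eq] at hi hj
      rcases lt_trichotomy i j with h | h | h
      · exact absurd hij (hj.2.2 i h)
      · exact h
      · exact absurd hij.symm (hi.2.2 j h)
    · rintro _ ⟨⟨i, rfl⟩, hB⟩
      have hne : (Finset.univ.filter fun j => x j = x i).Nonempty := ⟨i, by simp⟩
      refine ⟨(Finset.univ.filter fun j => x j = x i).min' hne, ?_, ?_⟩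
      · have hmem := Finset.min'_mem _ hne
        simp only [Finset.mem_filter, Finset.mem_univ, true_and] at hmem
        simp only [Finset.coe_filter, Set.mem_ofPred_eq, Finset.mem_univ, true_and]
        refine ⟨by rw [hmem]; exact hB, fun j hj hji => ?_⟩
        have := Finset.min'_le (Finset.univ.filter fun j => x j = x i) j
          (by simp [hji, hmem])
        exact absurd hj (not_lt.mpr this)
      · have hmem := Finset.min'_mem _ hne
        simpa using hmem
  rw [this]
  refine Finset.measurable_sum _ fun i _ => Measurable.ite ?_ measurable_const measurable_const
  refine MeasurableSet.inter (measurable_pi_apply i hBm) ?_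
  have : {x : Fin k → Space d | ∀ j : Fin k, j < i → x j ≠ x i}
      = ⋂ (j : Fin k) (_ : j < i), {x | x j = x i}ᶜ := by
    ext x; simp
  change MeasurableSet {x : Fin k → Space d | ∀ j : Fin k, j < i → x j ≠ x i}
  rw [this]
  exact MeasurableSet.iInter fun j => MeasurableSet.iInter fun _ =>
    (measurableSet_eq_fun (measurable_pi_apply j) (measurable_pi_apply i)).compl

end Config

/-- Finite configurations. -/
abbrev FinConfig (d : ℕ) : Type := {η : Config d // η.pts.Finite}

variable {d : ℕ}

/-- The box `Λ_n = [-n/2, n/2)^d`. -/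
def box (d n : ℕ) : Set (Space d) := {x | ∀ i, x i ∈ Set.Ico (-(n : ℝ) / 2) ((n : ℝ) / 2)}

/-- The closed unit cube `[0,1]^d`. -/
def unitCube (d : ℕ) : Set (Space d) := {x | ∀ i, x i ∈ Set.Icc (0 : ℝ) 1}

theorem isBounded_box (d n : ℕ) : Bornology.IsBounded (box d n) := by
  refine (Metric.isBounded_closedBall (x := (0 : Space d))
    (r := √(∑ _i : Fin d, (n : ℝ) ^ 2))).subset fun x hx => ?_
  rw [mem_closedBall_zero_iff, EuclideanSpace.norm_eq]
  refine Real.sqrt_le_sqrt (Finset.sum_le_sum fun i _ => ?_)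
  have h := hx i
  rw [Real.norm_eq_abs, sq_abs]
  nlinarith [h.1, h.2, (Nat.cast_nonneg n : (0 : ℝ) ≤ n)]

namespace Config

theorem finite_restrict_box (η : Config d) (n : ℕ) : (η.restrict (box d n)).pts.Finite :=
  η.locallyFinite _ (isBounded_box d n)

/-- `η_{Λ_n}`, as a finite configuration. -/
def boxPart (η : Config d) (n : ℕ) : FinConfig d := ⟨η.restrict (box d n), η.finite_restrict_box n⟩

/-- `η_{Λ_n} + δ_x`, as a finite configuration. -/
def boxPartAdd (η : Config d) (n : ℕ) (x : Space d) : FinConfig d :=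
  ⟨(η.restrict (box d n)).add x, (η.finite_restrict_box n).insert x⟩

end Config

/-- Translation of finite configurations. -/
def FinConfig.shift (x : Space d) (η : FinConfig d) : FinConfig d :=
  ⟨Config.shift x η.1, η.2.image _⟩

/-! ### Interactions -/

/-- The conditional energy `H_Λ(η) = lim_n (H(η_{Λ_n}) - H(η_{Λ_n \ Λ}))`. -/
noncomputable def condEnergy (H : FinConfig d → ℝ) (Λ : Set (Space d)) (η : Config d) : ℝ :=
  limUnder atTop fun n : ℕ => H (η.boxPart n) - H ((η.restrict Λᶜ).boxPart n)

/-- The energy `h(x, η) = lim_n (H(η_{Λ_n} + δ_x) - H(η_{Λ_n}))` of a point `x` in `η`. -/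
noncomputable def pointEnergy (H : FinConfig d → ℝ) (x : Space d) (η : Config d) : ℝ :=
  limUnder atTop fun n : ℕ => H (η.boxPartAdd n x) - H (η.boxPart n)

/-- The birth rate `b(x, η) = exp (-h(x, η))`. -/
noncomputable def birthRate (H : FinConfig d → ℝ) (x : Space d) (η : Config d) : ℝ :=
  Real.exp (-pointEnergy H x η)

/-- Translation-invariant measurable energy functionals with well-defined conditional energies,
finite range, and one-point energies bounded from above and below. The `R`-neighbourhood
`{x | dist (x, Λ) ≤ R}` is `Metric.cthickening R Λ`. -/
structure IsInteraction (H : FinConfig d → ℝ) : Prop where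
  measurable : Measurable H
  shift_invariant : ∀ (x : Space d) (η : FinConfig d), H (η.shift x) = H η
  converges : ∀ Λ : Set (Space d), Bornology.IsBounded Λ → MeasurableSet Λ → ∀ η : Config d,
    ∃ l : ℝ, Tendsto (fun n : ℕ => H (η.boxPart n) - H ((η.restrict Λᶜ).boxPart n)) atTop (𝓝 l)
  finite_range : ∃ R : ℝ, 0 < R ∧ ∀ Λ : Set (Space d), Bornology.IsBounded Λ → MeasurableSet Λ →
    ∀ η : Config d, condEnergy H Λ η = condEnergy H Λ (η.restrict (Metric.cthickening R Λ))
  bounded : ∃ C : ℝ, ∀ (x : Space d) (η : Config d), |pointEnergy H x η| ≤ C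

/-! ### Point processes -/

/-- The marginal `μ_Λ`, the law of `η_Λ` under `μ`. -/
noncomputable def marginal (Λ : Set (Space d)) (μ : Measure (Config d)) : Measure (Config d) :=
  μ.map (Config.restrict Λ)

/-- The law `π_Λ` of the Poisson point process of intensity one in a bounded Borel set `Λ`: with
probability `exp (-|Λ|) |Λ|^k / k!` there are `k` points, independent and uniform in `Λ`. -/
noncomputable def poissonOn (Λ : Set (Space d)) : Measure (Config d) :=
  Measure.sum fun k : ℕ =>
    ENNReal.ofReal (Real.exp (-(volume Λ).toReal) / (k.factorial : ℝ)) •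
      (Measure.pi fun _ : Fin k => (volume.restrict Λ : Measure (Space d))).map Config.ofFin

/-- Invariance under all translations. -/
def IsShiftInvariant (μ : Measure (Config d)) : Prop :=
  ∀ x : Space d, μ.map (Config.shift x) = μ

/-- The partition function `Z_Λ(ω)`. -/
noncomputable def partitionFn (H : FinConfig d → ℝ) (Λ : Set (Space d)) (ω : Config d) : ENNReal :=
  ∫⁻ η, ENNReal.ofReal (Real.exp (-condEnergy H Λ (Config.glue Λ η ω))) ∂(poissonOn Λ)

/-- The finite-volume Gibbs point process in `Λ` with boundary condition `ω`. -/
noncomputable def finiteGibbs (H : FinConfig d → ℝ) (Λ : Set (Space d)) (ω : Config d) :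
    Measure (Config d) :=
  (partitionFn H Λ ω)⁻¹ • (poissonOn Λ).withDensity
    fun η => ENNReal.ofReal (Real.exp (-condEnergy H Λ (Config.glue Λ η ω)))

/-- Infinite-volume Gibbs point processes: probability measures solving the DLR equations. -/
structure IsGibbs (H : FinConfig d → ℝ) (ν : Measure (Config d)) : Prop where
  isProbabilityMeasure : IsProbabilityMeasure ν
  dlr : ∀ Λ : Set (Space d), Bornology.IsBounded Λ → MeasurableSet Λ →
    ∀ f : Config d → ENNReal, Measurable f →
      ∫⁻ ω, f ω ∂ν = ∫⁻ ω, ∫⁻ η, f (Config.glue Λ η ω) ∂(finiteGibbs H Λ ω) ∂ν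

/-- The defining (Campbell) formula of the Palm measure. -/
def IsPalm (μ μ₀ : Measure (Config d)) : Prop :=
  ∀ f : Space d × Config d → ENNReal, Measurable f →
    ∫⁻ η, ∑' x : η.pts, f (x, Config.shift x η) ∂μ = ∫⁻ x : Space d, ∫⁻ ζ, f (x, ζ) ∂μ₀

open Classical in
/-- The Palm measure `μ_0` of `μ`, i.e. the unique measure satisfying the Campbell formula (it
exists for every translation-invariant `μ` of finite intensity). It is not normalized. -/
noncomputable def palm (μ : Measure (Config d)) : Measure (Config d) :=
  if h : ∃ μ₀, IsPalm μ μ₀ then h.choose else 0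

/-- The map `γ_0`, removing the origin. -/
def removeOrigin (η : Config d) : Config d := η.del 0

/-- The reduced Palm measure. -/
noncomputable def reducedPalm (μ : Measure (Config d)) : Measure (Config d) :=
  (palm μ).map removeOrigin

/-- The measure `b(0, ·) μ`. -/
noncomputable def birthMeasure (H : FinConfig d → ℝ) (μ : Measure (Config d)) :
    Measure (Config d) :=
  μ.withDensity fun η => ENNReal.ofReal (birthRate H 0 η)

/-- The `σ`-algebra of measurable sets invariant under all translations. -/
@[reducible]
noncomputable def invariantSets (d : ℕ) : MeasurableSpace (Config d) :=
  ⨅ x : Space d, MeasurableSpace.invariants (Config.shift x)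

/-! ### Entropies and the generator -/

open Classical in
/-- Relative entropy `I(P | Q) = ∫ log (dP/dQ) dP` of finite measures, `+∞` if `P` has no density.
The negative part of `log (dP/dQ)` is always `P`-integrable, so that the integral is `+∞` if
`log (dP/dQ)` is not `P`-integrable. -/
noncomputable def relEntropy {Ω : Type*} [MeasurableSpace Ω] (P Q : Measure Ω) : EReal :=
  if P ≪ Q ∧ Integrable (llr P Q) P then ((∫ ω, llr P Q ω ∂P : ℝ) : EReal) else ⊤

/-- `log (dμ_Λ / dν_Λ)`, as a `Λ`-local function of the configuration. -/
noncomputable def logDensity (μ ν : Measure (Config d)) (Λ : Set (Space d)) (η : Config d) : ℝ :=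
  llr (marginal Λ μ) (marginal Λ ν) (η.restrict Λ)

/-- The birth-and-death generator. -/
noncomputable def generator (H : FinConfig d → ℝ) (f : Config d → ℝ) (η : Config d) : ℝ :=
  (∫ x : Space d, birthRate H x η * (f (η.add x) - f η)) + ∑' x : η.pts, (f (η.del x) - f η)

/-- The integral and the sum in the definition of the generator converge absolutely. -/
def GeneratorDefinedAt (H : FinConfig d → ℝ) (f : Config d → ℝ) (η : Config d) : Prop :=
  Integrable (fun x : Space d => birthRate H x η * (f (η.add x) - f η)) ∧
    Summable fun x : η.pts => f (η.del x) - f η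

/-- `(-𝓛) log (dμ_Λ / dν_Λ)`. -/
noncomputable def dissipation (H : FinConfig d → ℝ) (μ ν : Measure (Config d))
    (Λ : Set (Space d)) (η : Config d) : ℝ :=
  -generator H (logDensity μ ν Λ) η

/-- `(-𝓛) log (dμ_Λ / dν_Λ)` is well-defined almost everywhere and has a finite expectation. -/
def HasDissipation (H : FinConfig d → ℝ) (μ ν : Measure (Config d)) (Λ : Set (Space d)) : Prop :=
  (∀ᵐ η ∂μ, GeneratorDefinedAt H (logDensity μ ν Λ) η) ∧ Integrable (dissipation H μ ν Λ) μ

open Classical in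
/-- `σ_Λ(μ) = μ[(-𝓛) log (dμ_Λ / dν_Λ)]` if the expectation exists, and `+∞` otherwise. -/
noncomputable def entropyProduction (H : FinConfig d → ℝ) (μ ν : Measure (Config d))
    (Λ : Set (Space d)) : EReal :=
  if HasDissipation H μ ν Λ then ((∫ η, dissipation H μ ν Λ η ∂μ : ℝ) : EReal) else ⊤

/-- `Y` is a version of the conditional expectation `𝔼^{μ_0}[f | 𝒮]` of `f` under the Palm measure
given the invariant `σ`-algebra, as a random variable on the space carrying `μ`: an
invariant `μ`-integrable function with `∫_A Y dμ = ∫_A f dμ_0` for all invariant sets `A`.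
The integral of `Y` is against `μ` since the Palm measure is the unnormalized one, taken
conditionally on the invariant `σ`-algebra. -/
structure IsPalmCondExp (μ : Measure (Config d)) (f Y : Config d → ℝ) : Prop where
  integrable_palm : Integrable f (palm μ)
  integrable : Integrable Y μ
  measurable : Measurable[invariantSets d] Y
  setIntegral_eq : ∀ A : Set (Config d), MeasurableSet[invariantSets d] A →
    ∫ η in A, Y η ∂μ = ∫ η in A, f η ∂(palm μ)

end BirthDeath

open BirthDeath

/-! Write D for the reduced Campbell measure of μ over Λ (a point x of η in Λ, paired with the rest
of η) and B for the measure b(x,η) dx μ(dη) over Λ. Deaths and births exchange η + δ_x and η, so the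
mean of (-𝓛)f for a Λ-local f is the D-integral minus the B-integral of the increment f(η + δ_x) -
f(η). For f = log(dμ_Λ/dν_Λ) this increment is itself a log-density. The Georgii-Nguyen-Zessin
equation says that the analogues of D and B for ν coincide; weighting that identity with dμ_Λ/dν_Λ
shows that the increment is log(dD_Λ/dB_Λ), where D_Λ and B_Λ are the images of D and B under η ↦
η_Λ. This is exact for points x whose birth rate depends on η_Λ only, and elsewhere it is off by at
most 2C, because birth rates lie between e^{-C} and e^C (`IsInteraction.increment_sub_llr`). Hence
σ_Λ(μ) is the symmetrized Kullback-Leibler divergence of D_Λ and B_Λ up to a boundary term.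

Before localization, stationarity turns both measures into products: in coordinates centred at x, D
is dx ⊗ μ_0^! and B is dx ⊗ b(0,·)μ. Their symmetrized divergence is therefore |Λ| times the
asserted limit, and data processing yields the upper bound. For the lower bound, keep only the inner
points x and only the part of the configuration in a fixed window around x. This leaves the
divergence of μ_0^! and b(0,·)μ seen through the window, and growing windows recover the full
divergence by martingale convergence and Fatou (`tendsto_symDiv_map`,
`IsInteraction.tendsto_localDiv`). The convention σ_Λ = +∞ matches an infinite divergence
(`IsInteraction.hasDissipation_iff`): since log t ≤ t, the positive part of the increment is
B-integrable and its negative part is D-integrable, so infinite birth and death terms cannot cancel.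

If the limit is finite, the divergence lost by localization is o(|Λ_n|). A quantitative form of the
data processing inequality (`integral_abs_llr_sub_le`) turns this into L¹-closeness of the
log-densities before and after localization. Thus (-𝓛) log(dμ_Λ/dν_Λ) may be replaced by the sum
over points minus the birth-weighted integral of one fixed function, log(dμ_0^!/d(b(0,·)μ)),
evaluated at the configuration seen from x. These are spatial averages, and the mean ergodic theorem
(`tendsto_ergodicError`) and its Palm version (`exists_isPalmCondExp`) identify their limits. -/

namespace BirthDeath

open scoped ENNReal
open InformationTheory
open ProbabilityTheory

section

/-! ### Symmetrized Kullback-Leibler divergence of finite measures -/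

section Divergence

variable {X Y : Type*} [MeasurableSpace X] [MeasurableSpace Y] {P Q : Measure X}

/-- The symmetrized Kullback-Leibler divergence. -/
noncomputable def symDiv (P Q : Measure X) : ℝ≥0∞ := klDiv P Q + klDiv Q P

/-- The two log-likelihood ratios are negatives of each other almost everywhere, so a single
function can carry both integrability conditions. -/
theorem symDiv_ne_top_iff [IsFiniteMeasure P] [IsFiniteMeasure Q] :
    symDiv P Q ≠ ∞ ↔ P ≪ Q ∧ Q ≪ P ∧ Integrable (llr P Q) P ∧ Integrable (llr P Q) Q := by
  rw [symDiv, ne_eq, ENNReal.add_eq_top, not_or, ← ne_eq, ← ne_eq, klDiv_ne_top_iff,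
    klDiv_ne_top_iff]
  constructor
  · rintro ⟨⟨h1, h2⟩, h3, h4⟩
    exact ⟨h1, h3, h2, (integrable_congr (neg_llr h3)).1 h4.neg⟩
  · rintro ⟨h1, h3, h2, h4⟩
    refine ⟨⟨h1, h2⟩, h3, ?_⟩
    have := (integrable_congr (neg_llr h3)).2 h4
    simpa using this.neg

/-- The mass correction that `klDiv` carries for measures of unequal mass is antisymmetric, so it
cancels in the symmetrized sum. -/
theorem toReal_symDiv [IsFiniteMeasure P] [IsFiniteMeasure Q] (h : symDiv P Q ≠ ∞) :
    (symDiv P Q).toReal = ∫ x, llr P Q x ∂P - ∫ x, llr P Q x ∂Q := by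
  obtain ⟨h1, h2, h3, h4⟩ := symDiv_ne_top_iff.1 h
  have h5 : Integrable (llr Q P) Q := by
    simpa using ((integrable_congr (neg_llr h2)).2 h4).neg
  rw [symDiv, ENNReal.toReal_add (klDiv_ne_top h1 h3) (klDiv_ne_top h2 h5), toReal_klDiv h1 h3,
    toReal_klDiv h2 h5, ← integral_congr_ae (neg_llr h2)]
  simp only [Pi.neg_apply, integral_neg]
  ring

theorem relEntropy_ne_bot (P Q : Measure X) : relEntropy P Q ≠ ⊥ := by
  unfold relEntropy
  split_ifs <;> simp

/-- Links the uncorrected entropies of the main theorem to `klDiv`; they differ one by one by the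
difference of the masses, but not in the sum. -/
theorem relEntropy_add_relEntropy [IsFiniteMeasure P] [IsFiniteMeasure Q] :
    relEntropy P Q + relEntropy Q P = (symDiv P Q : EReal) := by
  by_cases h : symDiv P Q = ∞
  · rw [h, EReal.coe_ennreal_top]
    rw [symDiv, ENNReal.add_eq_top] at h
    rcases h with h | h
    · have : relEntropy P Q = ⊤ := by
        rw [relEntropy, if_neg]
        rw [← klDiv_ne_top_iff]; simp [h]
      rw [this, EReal.top_add_of_ne_bot (relEntropy_ne_bot _ _)]
    · have : relEntropy Q P = ⊤ := by
        rw [relEntropy, if_neg]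
        rw [← klDiv_ne_top_iff]; simp [h]
      rw [this, EReal.add_top_of_ne_bot (relEntropy_ne_bot _ _)]
  · obtain ⟨h1, h2, h3, h4⟩ := symDiv_ne_top_iff.1 h
    have h5 : Integrable (llr Q P) Q := by
      simpa using ((integrable_congr (neg_llr h2)).2 h4).neg
    rw [← ENNReal.ofReal_toReal h, toReal_symDiv h, relEntropy, if_pos ⟨h1, h3⟩, relEntropy,
      if_pos ⟨h2, h5⟩, EReal.coe_ennreal_ofReal, max_eq_left, ← EReal.coe_add,
      ← integral_congr_ae (neg_llr h2)]
    · simp only [Pi.neg_apply, integral_neg, sub_neg_eq_add]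
    · rw [← toReal_symDiv h]; exact ENNReal.toReal_nonneg

theorem symDiv_map_le [IsFiniteMeasure P] [IsFiniteMeasure Q] {f : X → Y} (hf : Measurable f) :
    symDiv (P.map f) (Q.map f) ≤ symDiv P Q :=
  add_le_add (klDiv_map_le P Q hf) (klDiv_map_le Q P hf)

/-- Data processing applied to `f` and then to its left inverse `g`: no information is lost. -/
theorem symDiv_map_of_leftInverse [IsFiniteMeasure P] [IsFiniteMeasure Q] {f : X → Y} {g : Y → X}
    (hf : Measurable f) (hg : Measurable g) (h : Function.LeftInverse g f) :
    symDiv (P.map f) (Q.map f) = symDiv P Q := by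
  refine le_antisymm (symDiv_map_le hf) ?_
  have := symDiv_map_le (P := P.map f) (Q := Q.map f) hg
  rwa [Measure.map_map hg hf, Measure.map_map hg hf, h.comp_eq_id, Measure.map_id,
    Measure.map_id] at this

/-- The restrictions have the same density, and the integrand `klFun` is nonnegative. -/
theorem klDiv_restrict_le [IsFiniteMeasure P] [IsFiniteMeasure Q] {A : Set X}
    (hA : MeasurableSet A) : klDiv (P.restrict A) (Q.restrict A) ≤ klDiv P Q := by
  by_cases h : P ≪ Q
  swap; · simp [h]
  rw [klDiv_eq_lintegral_klFun_of_ac h, klDiv_eq_lintegral_klFun_of_ac (h.restrict A)]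
  have h1 : P.restrict A = (Q.restrict A).withDensity (P.rnDeriv Q) := by
    rw [← restrict_withDensity hA, Measure.withDensity_rnDeriv_eq _ _ h]
  have h2 := Measure.rnDeriv_withDensity (Q.restrict A) (Measure.measurable_rnDeriv P Q)
  rw [← h1] at h2
  calc _ = ∫⁻ x in A, ENNReal.ofReal (klFun (P.rnDeriv Q x).toReal) ∂Q := by
        refine lintegral_congr_ae ?_
        filter_upwards [h2] with x hx
        rw [hx]
    _ ≤ _ := setLIntegral_le_lintegral _ _

theorem symDiv_restrict_le [IsFiniteMeasure P] [IsFiniteMeasure Q] {A : Set X}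
    (hA : MeasurableSet A) : symDiv (P.restrict A) (Q.restrict A) ≤ symDiv P Q :=
  add_le_add (klDiv_restrict_le hA) (klDiv_restrict_le hA)

theorem rnDeriv_prod_left [IsFiniteMeasure P] [IsFiniteMeasure Q] (κ : Measure Y)
    [IsFiniteMeasure κ] (h : P ≪ Q) :
    (κ.prod P).rnDeriv (κ.prod Q) =ᵐ[κ.prod Q] fun z => P.rnDeriv Q z.2 := by
  have h1 : κ.prod P = (κ.prod Q).withDensity fun z => P.rnDeriv Q z.2 := by
    rw [← prod_withDensity_right (Measure.measurable_rnDeriv P Q),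
      Measure.withDensity_rnDeriv_eq _ _ h]
  conv_lhs => rw [h1]
  exact Measure.rnDeriv_withDensity _ ((Measure.measurable_rnDeriv P Q).comp measurable_snd)

theorem klDiv_prod_left [IsFiniteMeasure P] [IsFiniteMeasure Q] (κ : Measure Y)
    [IsFiniteMeasure κ] : klDiv (κ.prod P) (κ.prod Q) = κ Set.univ * klDiv P Q := by
  rcases eq_or_ne κ 0 with rfl | hκ
  · simp
  have hκ' : κ Set.univ ≠ 0 := by simpa using hκ
  by_cases h : P ≪ Q
  · rw [klDiv_eq_lintegral_klFun_of_ac h,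
      klDiv_eq_lintegral_klFun_of_ac (Measure.AbsolutelyContinuous.rfl.prod h)]
    calc _ = ∫⁻ z, ENNReal.ofReal (klFun (P.rnDeriv Q z.2).toReal) ∂(κ.prod Q) := by
          refine lintegral_congr_ae ?_
          filter_upwards [rnDeriv_prod_left κ h] with x hx
          rw [hx]
      _ = _ := by
          rw [lintegral_prod _ (Measurable.aemeasurable (by fun_prop))]
          simp [mul_comm]
  · rw [klDiv_of_not_ac h, klDiv_of_not_ac, ENNReal.mul_top hκ']
    intro h'
    refine h fun A hA => ?_
    have := h' (s := Set.univ ×ˢ A) (by simp [Measure.prod_prod, hA])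
    simpa [Measure.prod_prod, hκ] using this

theorem symDiv_prod_left [IsFiniteMeasure P] [IsFiniteMeasure Q] (κ : Measure Y)
    [IsFiniteMeasure κ] : symDiv (κ.prod P) (κ.prod Q) = κ Set.univ * symDiv P Q := by
  rw [symDiv, klDiv_prod_left, klDiv_prod_left, symDiv, mul_add]

/-- For u ≥ -2, squaring e^{u/2} ≥ 1 + u/2 ≥ 0 gives e^u - 1 - u ≥ u²/4, and |u| ≤ ε + u²/(4ε) by
the arithmetic-geometric inequality. For u < -2, e^u - 1 - u exceeds |u| - 1 ≥ |u|/2, which is the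
source of the constant 2. -/
theorem abs_le_add_mul_exp_sub {ε : ℝ} (hε : 0 < ε) (u : ℝ) :
    |u| ≤ ε + (1 / ε + 2) * (Real.exp u - 1 - u) := by
  have h0 : 0 ≤ Real.exp u - 1 - u := by linarith [Real.add_one_le_exp u]
  have hε' : 0 < 1 / ε := by positivity
  by_cases hu : -2 ≤ u
  · have h1 : u ^ 2 / 4 ≤ Real.exp u - 1 - u := by
      have h2 := Real.add_one_le_exp (u / 2)
      have h3 : Real.exp u = Real.exp (u / 2) ^ 2 := by
        rw [← Real.exp_nat_mul]; congr 1; push_cast; ring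
      nlinarith
    have h4 : |u| ≤ ε + 1 / ε * (u ^ 2 / 4) := by
      have h5 : 0 ≤ (|u| / 2 - ε) ^ 2 / ε := by positivity
      have h6 : (|u| / 2 - ε) ^ 2 / ε = 1 / ε * (u ^ 2 / 4) - |u| + ε := by
        rw [← sq_abs u]; field_simp; ring
      linarith
    nlinarith
  · push Not at hu
    rw [abs_of_neg (by linarith)]
    have := Real.exp_pos u
    nlinarith

/-- Absorb dP/dQ into P, push forward by `T`, and expand over the image of Q: the integrand becomes
r · r⁻¹ ≤ 1. It is only an inequality because r may vanish or be infinite. -/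
theorem lintegral_rnDeriv_mul_inv_le [IsFiniteMeasure P] [IsFiniteMeasure Q] (h : P ≪ Q)
    {T : X → Y} (hT : Measurable T) :
    ∫⁻ x, P.rnDeriv Q x * ((P.map T).rnDeriv (Q.map T) (T x))⁻¹ ∂Q ≤ Q Set.univ := by
  have hm : Measurable ((P.map T).rnDeriv (Q.map T)) := Measure.measurable_rnDeriv _ _
  calc _ = ∫⁻ x, ((P.map T).rnDeriv (Q.map T) (T x))⁻¹ ∂P :=
        lintegral_rnDeriv_mul h (hm.comp hT).inv.aemeasurable
    _ = ∫⁻ y, ((P.map T).rnDeriv (Q.map T) y)⁻¹ ∂(P.map T) := (lintegral_map hm.inv hT).symm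
    _ = ∫⁻ y, (P.map T).rnDeriv (Q.map T) y * ((P.map T).rnDeriv (Q.map T) y)⁻¹ ∂(Q.map T) :=
        (lintegral_rnDeriv_mul (h.map hT) hm.inv.aemeasurable).symm
    _ ≤ ∫⁻ y, 1 ∂(Q.map T) := lintegral_mono fun y => ENNReal.mul_inv_le_one _
    _ = Q Set.univ := by simp [Measure.map_apply hT]

/-- The exponential moment that replaces a conditional-expectation argument: writing u for the
exponent, ∫(e^u - 1 - u) dQ is now at most -∫ u dQ. -/
theorem integrable_exp_llr_sub [IsFiniteMeasure P] [IsFiniteMeasure Q] (h : P ≪ Q) (h' : Q ≪ P)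
    {T : X → Y} (hT : Measurable T) :
    Integrable (fun x => Real.exp (llr P Q x - llr (P.map T) (Q.map T) (T x))) Q ∧
      ∫ x, Real.exp (llr P Q x - llr (P.map T) (Q.map T) (T x)) ∂Q ≤ Q.real Set.univ := by
  have e1 := exp_llr_of_ac' P Q h'
  have e2 := ae_of_ae_map hT.aemeasurable (exp_llr_of_ac' (P.map T) (Q.map T) (h'.map hT))
  have e3 := ae_of_ae_map hT.aemeasurable (Measure.rnDeriv_pos' (h'.map hT))
  have key : (fun x => ENNReal.ofReal
      (Real.exp (llr P Q x - llr (P.map T) (Q.map T) (T x)))) =ᵐ[Q]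
      fun x => P.rnDeriv Q x * ((P.map T).rnDeriv (Q.map T) (T x))⁻¹ := by
    filter_upwards [e1, e2, e3, Measure.rnDeriv_ne_top P Q] with x h1 h2 h3 h4
    rw [Real.exp_sub, h1, h2, ← ENNReal.toReal_div, ENNReal.ofReal_toReal, div_eq_mul_inv]
    exact ENNReal.div_ne_top h4 h3.ne'
  have hle := lintegral_rnDeriv_mul_inv_le h hT
  rw [← lintegral_congr_ae key] at hle
  have hm : Measurable fun x => Real.exp (llr P Q x - llr (P.map T) (Q.map T) (T x)) :=
    ((measurable_llr P Q).sub ((measurable_llr _ _).comp hT)).exp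
  constructor
  · refine (lintegral_ofReal_ne_top_iff_integrable hm.aestronglyMeasurable
      (ae_of_all _ fun x => (Real.exp_pos _).le)).1 ?_
    exact (hle.trans_lt (measure_lt_top _ _)).ne
  · rw [integral_eq_lintegral_of_nonneg_ae (ae_of_all _ fun x => (Real.exp_pos _).le)
      hm.aestronglyMeasurable]
    exact ENNReal.toReal_mono (measure_ne_top _ _) hle

/-- Quantitative stability of the data processing inequality: the log-likelihood ratio of the
images is close to the log-likelihood ratio if the loss of divergence is small. -/
theorem integral_abs_llr_sub_le [IsFiniteMeasure P] [IsFiniteMeasure Q] (h : symDiv P Q ≠ ∞)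
    {T : X → Y} (hT : Measurable T) {ε : ℝ} (hε : 0 < ε) :
    Integrable (fun x => llr P Q x - llr (P.map T) (Q.map T) (T x)) P ∧
    Integrable (fun x => llr P Q x - llr (P.map T) (Q.map T) (T x)) Q ∧
    ∫ x, |llr P Q x - llr (P.map T) (Q.map T) (T x)| ∂P +
      ∫ x, |llr P Q x - llr (P.map T) (Q.map T) (T x)| ∂Q ≤
    ε * (P.real Set.univ + Q.real Set.univ) +
      (1 / ε + 2) * ((symDiv P Q).toReal - (symDiv (P.map T) (Q.map T)).toReal) := by
  have hT' : symDiv (P.map T) (Q.map T) ≠ ∞ := ((symDiv_map_le hT).trans_lt h.lt_top).ne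
  obtain ⟨a1, a2, a3, a4⟩ := symDiv_ne_top_iff.1 h
  obtain ⟨b1, b2, b3, b4⟩ := symDiv_ne_top_iff.1 hT'
  have hl : Measurable (llr (P.map T) (Q.map T)) := measurable_llr _ _
  have c3 : Integrable (fun x => llr (P.map T) (Q.map T) (T x)) P := b3.comp_measurable hT
  have c4 : Integrable (fun x => llr (P.map T) (Q.map T) (T x)) Q := b4.comp_measurable hT
  have u3 : Integrable (fun x => llr P Q x - llr (P.map T) (Q.map T) (T x)) P := a3.sub c3
  have u4 : Integrable (fun x => llr P Q x - llr (P.map T) (Q.map T) (T x)) Q := a4.sub c4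
  refine ⟨u3, u4, ?_⟩
  obtain ⟨e1, e2⟩ := integrable_exp_llr_sub a1 a2 hT
  obtain ⟨f1, f2⟩ := integrable_exp_llr_sub a2 a1 hT
  -- Exchanging P and Q changes the sign of the difference of log-likelihood ratios, so the second
  -- exponential moment is that of its negative under P.
  have hne : (fun x => Real.exp (llr Q P x - llr (Q.map T) (P.map T) (T x))) =ᵐ[P]
      fun x => Real.exp (-(llr P Q x - llr (P.map T) (Q.map T) (T x))) := by
    filter_upwards [neg_llr a1, ae_of_ae_map hT.aemeasurable (neg_llr b1)] with x h1 h2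
    rw [← h1, ← h2]
    simp only [Pi.neg_apply]
    congr 1; ring
  rw [integral_congr_ae hne] at f2
  rw [integrable_congr hne] at f1
  -- The loss of divergence is ∫ u dP - ∫ u dQ, exactly the combination left over by the two
  -- estimates below.
  have hsub : (symDiv P Q).toReal - (symDiv (P.map T) (Q.map T)).toReal =
      ∫ x, (llr P Q x - llr (P.map T) (Q.map T) (T x)) ∂P -
        ∫ x, (llr P Q x - llr (P.map T) (Q.map T) (T x)) ∂Q := by
    rw [toReal_symDiv h, toReal_symDiv hT', integral_sub a3 c3, integral_sub a4 c4,
      integral_map hT.aemeasurable hl.aestronglyMeasurable,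
      integral_map hT.aemeasurable hl.aestronglyMeasurable]
    ring
  rw [hsub]
  set u : X → ℝ := fun x => llr P Q x - llr (P.map T) (Q.map T) (T x) with hu
  set K := 1 / ε + 2 with hK
  have hKpos : 0 ≤ K := by positivity
  have g1 : ∫ x, |u x| ∂Q ≤ ε * Q.real Set.univ +
      K * (∫ x, Real.exp (u x) ∂Q - Q.real Set.univ - ∫ x, u x ∂Q) := by
    have w1 : Integrable (fun x => Real.exp (u x) - 1) Q := e1.sub (integrable_const _)
    have w2 : Integrable (fun x => K * (Real.exp (u x) - 1 - u x)) Q := (w1.sub u4).const_mul _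
    calc ∫ x, |u x| ∂Q ≤ ∫ x, (ε + K * (Real.exp (u x) - 1 - u x)) ∂Q :=
          integral_mono u4.abs ((integrable_const _).add w2) fun x => abs_le_add_mul_exp_sub hε (u x)
      _ = _ := by
          rw [integral_add (integrable_const _) w2, integral_const_mul, integral_sub w1 u4,
            integral_sub e1 (integrable_const _)]
          simp [mul_comm, hu]
  have g2 : ∫ x, |u x| ∂P ≤ ε * P.real Set.univ +
      K * (∫ x, Real.exp (-u x) ∂P - P.real Set.univ + ∫ x, u x ∂P) := by
    have w1 : Integrable (fun x => Real.exp (-u x) - 1) P := f1.sub (integrable_const _)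
    have w2 : Integrable (fun x => K * (Real.exp (-u x) - 1 + u x)) P := (w1.add u3).const_mul _
    calc ∫ x, |u x| ∂P ≤ ∫ x, (ε + K * (Real.exp (-u x) - 1 + u x)) ∂P :=
          integral_mono u3.abs ((integrable_const _).add w2) fun x => by
              have := abs_le_add_mul_exp_sub hε (-u x)
              rwa [abs_neg, sub_neg_eq_add] at this
      _ = _ := by
          rw [integral_add (integrable_const _) w2, integral_const_mul, integral_add w1 u3,
            integral_sub f1 (integrable_const _)]
          simp [mul_comm, hu]
  -- The exponential moments do not exceed the masses, so these terms can be dropped from both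
  -- bounds.
  have g3 := mul_le_mul_of_nonneg_left e2 hKpos
  have g4 := mul_le_mul_of_nonneg_left f2 hKpos
  linarith

/-- The density `(p - q) log (p / q)`, `q = 1 - p`, of the symmetrized divergence. -/
noncomputable def symDivFun (p : ℝ) : ℝ := (2 * p - 1) * (Real.log p - Real.log (1 - p))

theorem measurable_symDivFun : Measurable symDivFun := by unfold symDivFun; fun_prop

/-- Take P + Q as reference, with densities p and q = 1 - p. Then q·klFun(p/q) + p·klFun(q/p) = (p -
q) log(p/q), the linear terms of `klFun` cancelling. Being a function of p alone, the integrand is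
suited to martingale convergence. -/
theorem symDiv_eq_lintegral [IsFiniteMeasure P] [IsFiniteMeasure Q] (h : P ≪ Q) (h' : Q ≪ P) :
    symDiv P Q = ∫⁻ x, ENNReal.ofReal (symDivFun (P.rnDeriv (P + Q) x).toReal) ∂(P + Q) := by
  set R := P + Q with hR
  have hPR : P ≪ R := Measure.AbsolutelyContinuous.rfl.add_right Q
  have hQR : Q ≪ R := Measure.AbsolutelyContinuous.rfl.add_right' P
  have hRP : R ≪ P := Measure.AbsolutelyContinuous.add_left Measure.AbsolutelyContinuous.rfl h'
  have hRQ : R ≪ Q := Measure.AbsolutelyContinuous.add_left h Measure.AbsolutelyContinuous.rfl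
  have m1 : Measurable fun x => ENNReal.ofReal (klFun (P.rnDeriv Q x).toReal) := by fun_prop
  have m2 : Measurable fun x => ENNReal.ofReal (klFun (Q.rnDeriv P x).toReal) := by fun_prop
  rw [symDiv, klDiv_eq_lintegral_klFun_of_ac h, klDiv_eq_lintegral_klFun_of_ac h',
    ← lintegral_rnDeriv_mul hQR m1.aemeasurable, ← lintegral_rnDeriv_mul hPR m2.aemeasurable,
    ← lintegral_add_left (show Measurable fun x => Q.rnDeriv R x *
      ENNReal.ofReal (klFun (P.rnDeriv Q x).toReal) by fun_prop)]
  refine lintegral_congr_ae ?_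
  filter_upwards [hRQ (Measure.rnDeriv_eq_div (ξ := R) hPR hQR),
    hRP (Measure.rnDeriv_eq_div (ξ := R) hQR hPR), Measure.rnDeriv_add' P Q R,
    Measure.rnDeriv_self R, Measure.rnDeriv_pos' hRP, Measure.rnDeriv_pos' hRQ,
    Measure.rnDeriv_ne_top P R, Measure.rnDeriv_ne_top Q R] with x h1 h2 h3 h4 h5 h6 h7 h8
  rw [h1, h2]
  rw [← hR, h4, Pi.add_apply] at h3
  set p := P.rnDeriv R x
  set q := Q.rnDeriv R x
  have hp : 0 < p.toReal := ENNReal.toReal_pos h5.ne' h7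
  have hq : 0 < q.toReal := ENNReal.toReal_pos h6.ne' h8
  have hpq : p.toReal + q.toReal = 1 := by
    rw [← ENNReal.toReal_add h7 h8, ← h3, ENNReal.toReal_one]
  rw [← ENNReal.ofReal_toReal h7, ← ENNReal.ofReal_toReal h8, ← ENNReal.ofReal_div_of_pos hq,
    ← ENNReal.ofReal_div_of_pos hp, ENNReal.toReal_ofReal (by positivity),
    ENNReal.toReal_ofReal (by positivity), ← ENNReal.ofReal_mul hq.le, ← ENNReal.ofReal_mul hp.le,
    ← ENNReal.ofReal_add (mul_nonneg hq.le (klFun_nonneg (by positivity)))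
      (mul_nonneg hp.le (klFun_nonneg (by positivity))), ENNReal.toReal_ofReal hp.le]
  congr 1
  rw [symDivFun, klFun_apply, klFun_apply, Real.log_div hp.ne' hq.ne', Real.log_div hq.ne' hp.ne',
    show 1 - p.toReal = q.toReal by linarith, show 2 * p.toReal - 1 = p.toReal - q.toReal by linarith]
  field_simp
  ring

open Classical in
/-- The extended-valued, lower semicontinuous version of `symDivFun` on the unit interval. -/
noncomputable def symDivFunTop (p : ℝ) : ℝ≥0∞ :=
  if p ∈ Set.Ioo (0 : ℝ) 1 then ENNReal.ofReal (symDivFun p) else ∞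

theorem measurable_symDivFunTop : Measurable symDivFunTop :=
  Measurable.ite measurableSet_Ioo measurable_symDivFun.ennreal_ofReal measurable_const

theorem symDivFun_one_sub (p : ℝ) : symDivFun (1 - p) = symDivFun p := by
  rw [symDivFun, symDivFun, sub_sub_cancel]; ring

theorem symDivFunTop_one_sub (p : ℝ) : symDivFunTop (1 - p) = symDivFunTop p := by
  have : 1 - p ∈ Set.Ioo (0 : ℝ) 1 ↔ p ∈ Set.Ioo (0 : ℝ) 1 := by
    simp only [Set.mem_Ioo]; constructor <;> rintro ⟨_, _⟩ <;> constructor <;> linarith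
  simp only [symDivFunTop, this, symDivFun_one_sub]

theorem tendsto_symDivFunTop_zero : Tendsto symDivFunTop (𝓝 0) (𝓝 ∞) := by
  have h1 : Tendsto symDivFun (𝓝[>] 0) atTop := by
    have a1 : Tendsto (fun p : ℝ => 1 - 2 * p) (𝓝[>] 0) (𝓝 (1 - 2 * 0)) :=
      ((continuous_const.sub (continuous_const.mul continuous_id)).tendsto 0).mono_left
        nhdsWithin_le_nhds
    have a2 : Tendsto (fun p : ℝ => Real.log (1 - p)) (𝓝[>] 0) (𝓝 (Real.log (1 - 0))) :=
      ((Real.continuousAt_log (by norm_num)).tendsto.comp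
        ((continuous_const.sub continuous_id).tendsto 0)).mono_left nhdsWithin_le_nhds
    have a3 : Tendsto (fun p : ℝ => -Real.log p) (𝓝[>] 0) atTop :=
      tendsto_neg_atBot_atTop.comp Real.tendsto_log_nhdsGT_zero
    have a4 := a1.pos_mul_atTop (by norm_num) (a3.atTop_add a2)
    refine a4.congr fun p => ?_
    rw [symDivFun]; ring
  have h2 : Tendsto (fun p => ENNReal.ofReal (symDivFun p)) (𝓝[>] 0) (𝓝 ∞) :=
    ENNReal.tendsto_ofReal_nhds_top.2 h1
  rw [ENNReal.tendsto_nhds_top_iff_nnreal] at h2 ⊢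
  intro c
  have h3 := h2 c
  rw [eventually_nhdsWithin_iff] at h3
  filter_upwards [h3] with p hp
  rw [symDivFunTop]
  split_ifs with h
  · exact hp h.1
  · exact ENNReal.coe_lt_top

/-- Continuity up to the endpoints, where the value is ∞, allows Fatou's lemma even where the
limiting density is 0 or 1. -/
theorem continuousAt_symDivFunTop {p : ℝ} (hp : p ∈ Set.Icc (0 : ℝ) 1) :
    ContinuousAt symDivFunTop p := by
  rcases eq_or_lt_of_le hp.1 with rfl | h0
  · have : symDivFunTop 0 = ∞ := by simp [symDivFunTop]
    rw [ContinuousAt, this]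
    exact tendsto_symDivFunTop_zero
  rcases eq_or_lt_of_le hp.2 with rfl | h1
  · have : symDivFunTop 1 = ∞ := by simp [symDivFunTop]
    rw [ContinuousAt, this]
    have h2 : Tendsto (fun q : ℝ => 1 - q) (𝓝 1) (𝓝 0) := by
      have h3 : Continuous fun q : ℝ => 1 - q := by fun_prop
      simpa only [sub_self] using h3.tendsto 1
    exact (tendsto_symDivFunTop_zero.comp h2).congr fun q => symDivFunTop_one_sub q
  · have h2 : symDivFunTop =ᶠ[𝓝 p] fun q => ENNReal.ofReal (symDivFun q) := by
      filter_upwards [isOpen_Ioo.mem_nhds (⟨h0, h1⟩ : p ∈ Set.Ioo (0 : ℝ) 1)] with q hq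
      rw [symDivFunTop, if_pos hq]
    refine ContinuousAt.congr ?_ h2.symm
    refine ENNReal.continuous_ofReal.continuousAt.comp ?_
    unfold symDivFun
    refine ContinuousAt.mul (by fun_prop) (ContinuousAt.sub (Real.continuousAt_log h0.ne') ?_)
    exact ContinuousAt.log (by fun_prop) (by linarith)

theorem rnDeriv_add_toReal_mem [IsFiniteMeasure P] [IsFiniteMeasure Q] :
    ∀ᵐ x ∂(P + Q), (P.rnDeriv (P + Q) x).toReal ∈ Set.Icc (0 : ℝ) 1 ∧
      (Q.rnDeriv (P + Q) x).toReal = 1 - (P.rnDeriv (P + Q) x).toReal := by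
  filter_upwards [Measure.rnDeriv_add' P Q (P + Q), Measure.rnDeriv_self (P + Q),
    Measure.rnDeriv_ne_top P (P + Q), Measure.rnDeriv_ne_top Q (P + Q)] with x h3 h4 h7 h8
  rw [h4, Pi.add_apply] at h3
  have hpq : (P.rnDeriv (P + Q) x).toReal + (Q.rnDeriv (P + Q) x).toReal = 1 := by
    rw [← ENNReal.toReal_add h7 h8, ← h3, ENNReal.toReal_one]
  have h1 : 0 ≤ (P.rnDeriv (P + Q) x).toReal := ENNReal.toReal_nonneg
  have h2 : 0 ≤ (Q.rnDeriv (P + Q) x).toReal := ENNReal.toReal_nonneg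
  exact ⟨⟨h1, by linarith⟩, by linarith⟩

/-- Covers the case without mutual absolute continuity: a finite right-hand side would force the
density into (0,1) almost everywhere, hence P + Q ≪ P and P + Q ≪ Q. -/
theorem symDiv_eq_lintegral_symDivFunTop [IsFiniteMeasure P] [IsFiniteMeasure Q] :
    symDiv P Q = ∫⁻ x, symDivFunTop (P.rnDeriv (P + Q) x).toReal ∂(P + Q) := by
  have hPR : P ≪ P + Q := Measure.AbsolutelyContinuous.rfl.add_right Q
  have hQR : Q ≪ P + Q := Measure.AbsolutelyContinuous.rfl.add_right' P
  have hm : Measurable fun x => symDivFunTop (P.rnDeriv (P + Q) x).toReal :=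
    measurable_symDivFunTop.comp (Measure.measurable_rnDeriv _ _).ennreal_toReal
  by_cases hac : P ≪ Q ∧ Q ≪ P
  · have hRP : P + Q ≪ P :=
      Measure.AbsolutelyContinuous.add_left Measure.AbsolutelyContinuous.rfl hac.2
    have hRQ : P + Q ≪ Q :=
      Measure.AbsolutelyContinuous.add_left hac.1 Measure.AbsolutelyContinuous.rfl
    rw [symDiv_eq_lintegral hac.1 hac.2]
    refine lintegral_congr_ae ?_
    filter_upwards [rnDeriv_add_toReal_mem (P := P) (Q := Q), Measure.rnDeriv_pos' hRP,
      Measure.rnDeriv_pos' hRQ, Measure.rnDeriv_ne_top P (P + Q),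
      Measure.rnDeriv_ne_top Q (P + Q)] with x h1 h2 h3 h4 h5
    have h6 := ENNReal.toReal_pos h2.ne' h4
    have h7 := ENNReal.toReal_pos h3.ne' h5
    rw [symDivFunTop, if_pos ⟨h6, by linarith [h1.2]⟩]
  · have htop : symDiv P Q = ∞ := by
      by_contra h
      obtain ⟨h1, h2, -⟩ := symDiv_ne_top_iff.1 h
      exact hac ⟨h1, h2⟩
    rw [htop]
    symm
    by_contra hne
    have hfin := ae_lt_top hm hne
    have hmem : ∀ᵐ x ∂(P + Q), (P.rnDeriv (P + Q) x).toReal ∈ Set.Ioo (0 : ℝ) 1 := by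
      filter_upwards [hfin] with x hx
      by_contra hx'
      rw [symDivFunTop, if_neg hx'] at hx
      exact lt_irrefl _ hx
    have hRP : P + Q ≪ P := by
      conv_rhs => rw [← Measure.withDensity_rnDeriv_eq _ _ hPR]
      refine withDensity_absolutelyContinuous' (Measure.measurable_rnDeriv _ _).aemeasurable ?_
      filter_upwards [hmem] with x hx h0
      rw [h0] at hx
      simp at hx
    have hRQ : P + Q ≪ Q := by
      conv_rhs => rw [← Measure.withDensity_rnDeriv_eq _ _ hQR]
      refine withDensity_absolutelyContinuous' (Measure.measurable_rnDeriv _ _).aemeasurable ?_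
      filter_upwards [hmem, rnDeriv_add_toReal_mem (P := P) (Q := Q)] with x hx h1 h0
      rw [h0, ENNReal.toReal_zero] at h1
      linarith [hx.2, h1.2]
    exact hac ⟨hPR.trans hRQ, hQR.trans hRP⟩

/-- The divergence is the limit of the divergences of images that generate the `σ`-algebra. -/
theorem tendsto_symDiv_map [IsFiniteMeasure P] [IsFiniteMeasure Q] {T : ℕ → X → Y}
    (hT : ∀ m, Measurable (T m))
    (hmono : Monotone fun m => MeasurableSpace.comap (T m) ‹MeasurableSpace Y›)
    (hgen : ‹MeasurableSpace X› ≤ ⨆ m, MeasurableSpace.comap (T m) ‹MeasurableSpace Y›) :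
    Tendsto (fun m => symDiv (P.map (T m)) (Q.map (T m))) atTop (𝓝 (symDiv P Q)) := by
  set R := P + Q with hR
  have hPR : P ≪ R := Measure.AbsolutelyContinuous.rfl.add_right Q
  set p : X → ℝ := fun x => (P.rnDeriv R x).toReal with hp
  let ℱ : Filtration ℕ ‹MeasurableSpace X› :=
    ⟨fun m => MeasurableSpace.comap (T m) ‹MeasurableSpace Y›, hmono, fun m => (hT m).comap_le⟩
  have hpm : Measurable p := (Measure.measurable_rnDeriv _ _).ennreal_toReal
  have hpi : Integrable p R := Measure.integrable_toReal_rnDeriv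
  -- Lévy's upward theorem; `hgen` makes the limit the density itself.
  have hconv : ∀ᵐ x ∂ R, Tendsto (fun m => (R[p | ℱ m]) x) atTop (𝓝 (p x)) :=
    hpi.tendsto_ae_condExp (hpm.mono hgen le_rfl).stronglyMeasurable
  -- The density of the image measures, read through `T m`, is the conditional expectation of `p`.
  have hJ : ∀ m, symDiv (P.map (T m)) (Q.map (T m)) = ∫⁻ x, symDivFunTop ((R[p | ℱ m]) x) ∂ R := by
    intro m
    have h1 := toReal_rnDeriv_map hPR (hT m)
    have h2 : R.map (T m) = P.map (T m) + Q.map (T m) := Measure.map_add _ _ (hT m)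
    have h3 : Measurable fun y =>
        symDivFunTop ((P.map (T m)).rnDeriv (R.map (T m)) y).toReal :=
      measurable_symDivFunTop.comp (Measure.measurable_rnDeriv _ _).ennreal_toReal
    rw [symDiv_eq_lintegral_symDivFunTop, ← h2, lintegral_map h3 (hT m)]
    refine lintegral_congr_ae ?_
    filter_upwards [h1] with x hx
    rw [hx]
  -- Fatou's lemma bounds the lower limit, data processing the upper one.
  refine tendsto_of_le_liminf_of_limsup_le ?_ ?_
  · simp_rw [hJ]
    refine le_trans ?_ (lintegral_liminf_le fun m =>
      measurable_symDivFunTop.comp (stronglyMeasurable_condExp.mono (ℱ.le m)).measurable)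
    rw [symDiv_eq_lintegral_symDivFunTop]
    refine lintegral_mono_ae ?_
    filter_upwards [hconv, rnDeriv_add_toReal_mem (P := P) (Q := Q)] with x h1 h2
    exact (((continuousAt_symDivFunTop h2.1).tendsto.comp h1).liminf_eq).ge
  · refine limsup_le_of_le (by isBoundedDefault) (Eventually.of_forall fun m => symDiv_map_le (hT m))

end Divergence

end

/-! ### Configurations: operations, counting measures and joint measurability -/

section

variable {d : ℕ}

namespace Config

theorem restrict_restrict (Λ Δ : Set (Space d)) (η : Config d) :
    (η.restrict Δ).restrict Λ = η.restrict (Δ ∩ Λ) := by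
  ext y; simp [restrict, and_assoc]

theorem restrict_restrict_of_subset {Λ Δ : Set (Space d)} (h : Λ ⊆ Δ) (η : Config d) :
    (η.restrict Δ).restrict Λ = η.restrict Λ := by
  rw [restrict_restrict, Set.inter_eq_right.2 h]

theorem restrict_add_of_mem {Λ : Set (Space d)} {x : Space d} (hx : x ∈ Λ) (η : Config d) :
    (η.add x).restrict Λ = (η.restrict Λ).add x := by
  ext y; simp only [restrict, add, Set.mem_inter_iff, Set.mem_insert_iff]
  constructor
  · rintro ⟨h | h, h'⟩ <;> tauto
  · rintro (rfl | h) <;> tauto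

theorem restrict_add_of_notMem {Λ : Set (Space d)} {x : Space d} (hx : x ∉ Λ) (η : Config d) :
    (η.add x).restrict Λ = η.restrict Λ := by
  ext y; simp only [restrict, add, Set.mem_inter_iff, Set.mem_insert_iff]
  constructor
  · rintro ⟨rfl | h, h'⟩ <;> tauto
  · tauto

theorem restrict_del (Λ : Set (Space d)) (x : Space d) (η : Config d) :
    (η.del x).restrict Λ = (η.restrict Λ).del x := by
  ext y; simp only [restrict, del, Set.mem_inter_iff, Set.mem_sdiff]; tauto

theorem add_del_of_mem {x : Space d} {η : Config d} (hx : x ∈ η.pts) : (η.del x).add x = η := by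
  ext y; simp only [add, del, Set.insert_sdiff_singleton, Set.insert_eq_of_mem hx]

theorem mem_shift {x y : Space d} {η : Config d} : y ∈ (η.shift x).pts ↔ y + x ∈ η.pts := by
  simp only [shift, Set.mem_image]
  constructor
  · rintro ⟨z, hz, rfl⟩; simpa using hz
  · intro h; exact ⟨y + x, h, by simp⟩

theorem shift_shift (x y : Space d) (η : Config d) : (η.shift y).shift x = η.shift (x + y) := by
  ext z; rw [mem_shift, mem_shift, mem_shift, add_assoc]

theorem shift_zero (η : Config d) : η.shift 0 = η := by
  ext z; rw [mem_shift, add_zero]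

theorem shift_neg_shift (x : Space d) (η : Config d) : (η.shift x).shift (-x) = η := by
  rw [shift_shift, neg_add_cancel, shift_zero]

theorem shift_shift_neg (x : Space d) (η : Config d) : (η.shift (-x)).shift x = η := by
  rw [shift_shift, add_neg_cancel, shift_zero]

theorem shift_add (x y : Space d) (η : Config d) : (η.add y).shift x = (η.shift x).add (y - x) := by
  ext z
  simp only [mem_shift, add, Set.mem_insert_iff]
  rw [eq_sub_iff_add_eq]

theorem shift_del (x y : Space d) (η : Config d) : (η.del y).shift x = (η.shift x).del (y - x) := by
  ext z
  rw [mem_shift]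
  simp only [del, Set.mem_sdiff, Set.mem_singleton_iff, mem_shift]
  rw [eq_sub_iff_add_eq]

theorem shift_restrict (x : Space d) (Λ : Set (Space d)) (η : Config d) :
    (η.restrict Λ).shift x = (η.shift x).restrict {y | y + x ∈ Λ} := by
  ext z
  rw [mem_shift]
  simp only [restrict, Set.mem_inter_iff, mem_shift, Set.mem_ofPred_eq]

/-- The counting measure of a configuration. -/
noncomputable def ptsMeasure (η : Config d) : Measure (Space d) :=
  Measure.sum fun x : η.pts => Measure.dirac (x : Space d)

theorem lintegral_ptsMeasure (η : Config d) (f : Space d → ℝ≥0∞) :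
    ∫⁻ x, f x ∂η.ptsMeasure = ∑' x : η.pts, f x := by
  simp only [ptsMeasure, lintegral_sum_measure, lintegral_dirac]

theorem lintegral_ptsMeasure_eq_tsum_indicator (η : Config d) (f : Space d → ℝ≥0∞) :
    ∫⁻ x, f x ∂η.ptsMeasure = ∑' x, η.pts.indicator f x := by
  rw [lintegral_ptsMeasure, tsum_subtype]

theorem ptsMeasure_apply_of_isBounded (η : Config d) {B : Set (Space d)}
    (hB : Bornology.IsBounded B) (hBm : MeasurableSet B) : η.ptsMeasure B = count B η := by
  rw [← lintegral_indicator_one hBm, lintegral_ptsMeasure_eq_tsum_indicator,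
    Set.indicator_indicator, ← tsum_subtype]
  simp only [Pi.one_apply]
  rw [ENNReal.tsum_set_one, count, ← (η.locallyFinite B hB).cast_ncard_eq]
  simp

/-- The spherical shells of integer radii. -/
def shell (d n : ℕ) : Set (Space d) := {x | ⌊‖x‖⌋₊ = n}

theorem measurableSet_shell (n : ℕ) : MeasurableSet (shell d n) :=
  (Nat.measurable_floor.comp measurable_norm) (measurableSet_singleton n)

theorem isBounded_shell (n : ℕ) : Bornology.IsBounded (shell d n) := by
  refine (Metric.isBounded_closedBall (x := (0 : Space d)) (r := n + 1)).subset fun x hx => ?_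
  rw [mem_closedBall_zero_iff]
  have h : ⌊‖x‖⌋₊ = n := hx
  have := Nat.lt_floor_add_one ‖x‖
  rw [h] at this
  exact this.le

theorem measure_eq_tsum_shell (κ : Measure (Space d)) {B : Set (Space d)} (hB : MeasurableSet B) :
    κ B = ∑' n, κ (B ∩ shell d n) := by
  rw [← measure_iUnion]
  · congr 1
    ext x; simp [shell]
  · intro i j hij
    refine Set.disjoint_left.2 fun x hx hx' => hij ?_
    exact hx.2.symm.trans hx'.2
  · exact fun n => hB.inter (measurableSet_shell n)

/-- The `σ`-algebra only controls counts of bounded sets, so an arbitrary Borel set is cut along the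
shells. -/
theorem measurable_ptsMeasure : Measurable (ptsMeasure : Config d → Measure (Space d)) := by
  refine Measure.measurable_of_measurable_coe _ fun B hB => ?_
  simp_rw [fun η : Config d => measure_eq_tsum_shell η.ptsMeasure hB]
  refine Measurable.tsum fun n => ?_
  have hb : Bornology.IsBounded (B ∩ shell d n) := (isBounded_shell n).subset Set.inter_subset_right
  have hm := hB.inter (measurableSet_shell n)
  simp_rw [fun η : Config d => ptsMeasure_apply_of_isBounded η hb hm]
  exact measurable_from_top.comp (measurable_count hb hm)

/-- The counting measures of configurations, as a kernel. -/
noncomputable def ptsKernel (d : ℕ) : Kernel (Config d) (Space d) :=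
  ⟨ptsMeasure, measurable_ptsMeasure⟩

@[simp] theorem ptsKernel_apply (η : Config d) : ptsKernel d η = η.ptsMeasure := rfl

instance : IsSFiniteKernel (ptsKernel d) := by
  classical
  have h1 : ptsKernel d = Kernel.sum fun n => (ptsKernel d).restrict (measurableSet_shell n) := by
    ext η B hB
    rw [Kernel.sum_apply' _ _ hB, ptsKernel_apply, measure_eq_tsum_shell _ hB]
    refine tsum_congr fun n => ?_
    rw [Kernel.restrict_apply' _ _ _ hB, ptsKernel_apply]
  rw [h1]
  suffices ∀ n, IsSFiniteKernel ((ptsKernel d).restrict (measurableSet_shell n)) from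
    Kernel.isSFiniteKernel_sum
  intro n
  have hs : ∀ k, MeasurableSet {η : Config d | count (shell d n) η = k} := fun k =>
    measurable_count (isBounded_shell n) (measurableSet_shell n) (measurableSet_singleton k)
  -- Each shell holds finitely many points, but not boundedly many over all configurations;
  -- splitting by their number makes every piece a finite kernel.
  have h2 : (ptsKernel d).restrict (measurableSet_shell n) = Kernel.sum fun k =>
      Kernel.piecewise (hs k) ((ptsKernel d).restrict (measurableSet_shell n)) 0 := by
    ext η B hB
    rw [Kernel.sum_apply' _ _ hB, tsum_eq_single (count (shell d n) η)]
    · rw [Kernel.piecewise_apply', if_pos (by simp)]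
    · intro k hk
      rw [Kernel.piecewise_apply', if_neg (by simpa using hk.symm)]
      rfl
  rw [h2]
  have : ∀ k, IsFiniteKernel
      (Kernel.piecewise (hs k) ((ptsKernel d).restrict (measurableSet_shell n)) 0) := by
    intro k
    refine ⟨k, ENNReal.natCast_lt_top k, fun η => ?_⟩
    rw [Kernel.piecewise_apply']
    split_ifs with h
    · rw [Kernel.restrict_apply' _ _ _ MeasurableSet.univ, Set.univ_inter, ptsKernel_apply,
        ptsMeasure_apply_of_isBounded _ (isBounded_shell n) (measurableSet_shell n)]
      exact_mod_cast (show count (shell d n) η = k from h).le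
    · simp
  exact Kernel.isSFiniteKernel_sum

theorem measurable_lintegral_ptsMeasure {α : Type*} [MeasurableSpace α] {f : α × Space d → ℝ≥0∞}
    (hf : Measurable f) {g : α → Config d} (hg : Measurable g) :
    Measurable fun a => ∫⁻ x, f (a, x) ∂(g a).ptsMeasure := by
  have := hf.lintegral_kernel_prod_right' (κ := (ptsKernel d).comap g hg)
  simpa using this

/-- Counts as values of `ptsMeasure` can be written as kernel integrals, which is how shifting,
adding and deleting are shown to be jointly measurable in the point and the configuration. -/
theorem measurable_of_coe_count {α : Type*} [MeasurableSpace α] {f : α → Config d}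
    (h : ∀ Λ : Set (Space d), Bornology.IsBounded Λ → MeasurableSet Λ →
      Measurable fun a => (f a).ptsMeasure Λ) : Measurable f := by
  refine measurable_of_count fun Λ hb hm => ?_
  refine measurable_to_countable' fun k => ?_
  have := h Λ hb hm (measurableSet_singleton (k : ℝ≥0∞))
  simpa [Set.preimage, ptsMeasure_apply_of_isBounded _ hb hm] using this

theorem lintegral_ptsMeasure_shift (x : Space d) (η : Config d) (f : Space d → ℝ≥0∞) :
    ∫⁻ y, f y ∂(η.shift x).ptsMeasure = ∫⁻ y, f (y - x) ∂η.ptsMeasure := by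
  rw [lintegral_ptsMeasure_eq_tsum_indicator,
    lintegral_ptsMeasure_eq_tsum_indicator, ← (Equiv.subRight x).tsum_eq]
  refine tsum_congr fun y => ?_
  have h : y - x ∈ (η.shift x).pts ↔ y ∈ η.pts := by rw [mem_shift, sub_add_cancel]
  by_cases hy : y ∈ η.pts
  · rw [Set.indicator_of_mem hy, Equiv.subRight_apply, Set.indicator_of_mem (h.2 hy)]
  · rw [Set.indicator_of_notMem hy, Equiv.subRight_apply,
      Set.indicator_of_notMem (fun hy' => hy (h.1 hy'))]

theorem ptsMeasure_shift (x : Space d) (η : Config d) {B : Set (Space d)} (hB : MeasurableSet B) :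
    (η.shift x).ptsMeasure B = ∫⁻ y, B.indicator 1 (y - x) ∂η.ptsMeasure := by
  rw [← lintegral_indicator_one hB, lintegral_ptsMeasure_shift]

theorem ptsMeasure_del (x : Space d) (η : Config d) {B : Set (Space d)} (hB : MeasurableSet B) :
    (η.del x).ptsMeasure B = ∫⁻ y, (B ∩ {x}ᶜ).indicator 1 y ∂η.ptsMeasure := by
  classical
  rw [← lintegral_indicator_one hB, lintegral_ptsMeasure_eq_tsum_indicator,
    lintegral_ptsMeasure_eq_tsum_indicator]
  refine tsum_congr fun y => ?_
  simp only [Set.indicator, del, Set.mem_sdiff, Set.mem_singleton_iff, Set.mem_inter_iff,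
    Set.mem_compl_iff]
  split_ifs <;> first | rfl | tauto

theorem ptsMeasure_add (x : Space d) (η : Config d) {B : Set (Space d)} (hB : MeasurableSet B) :
    (η.add x).ptsMeasure B =
      ∫⁻ y, (B ∩ {x}ᶜ).indicator 1 y ∂η.ptsMeasure + B.indicator 1 x := by
  classical
  have h1 : B.indicator (1 : Space d → ℝ≥0∞) x =
      ∑' y, ({x} : Set (Space d)).indicator (B.indicator 1) y := by
    rw [tsum_eq_single x]
    · simp
    · intro y hy; simp [hy]
  rw [h1, ← lintegral_indicator_one hB, lintegral_ptsMeasure_eq_tsum_indicator,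
    lintegral_ptsMeasure_eq_tsum_indicator, ← ENNReal.tsum_add]
  refine tsum_congr fun y => ?_
  simp only [Set.indicator, add, Set.mem_insert_iff, Set.mem_singleton_iff, Set.mem_inter_iff,
    Set.mem_compl_iff]
  split_ifs <;> first | tauto | simp

theorem measurable_shift_prod : Measurable fun z : Space d × Config d => z.2.shift z.1 := by
  refine measurable_of_coe_count fun B _ hB => ?_
  simp_rw [fun z : Space d × Config d => ptsMeasure_shift z.1 z.2 hB]
  refine measurable_lintegral_ptsMeasure
    (f := fun w : (Space d × Config d) × Space d => B.indicator 1 (w.2 - w.1.1)) ?_ measurable_snd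
  exact (measurable_one.indicator hB).comp (by fun_prop)

theorem measurable_indicator_ne {α : Type*} [MeasurableSpace α] {B : Set (Space d)}
    (hB : MeasurableSet B) {f g : α → Space d} (hf : Measurable f) (hg : Measurable g) :
    Measurable fun a => (B ∩ {f a}ᶜ).indicator (1 : Space d → ℝ≥0∞) (g a) := by
  have : (fun a => (B ∩ {f a}ᶜ).indicator (1 : Space d → ℝ≥0∞) (g a)) =
      (g ⁻¹' B ∩ {a | g a = f a}ᶜ).indicator 1 := by
    funext a; simp only [Set.indicator]; rfl
  rw [this]
  exact measurable_one.indicator ((hg hB).inter (measurableSet_eq_fun hg hf).compl)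

theorem measurable_del_prod : Measurable fun z : Space d × Config d => z.2.del z.1 := by
  refine measurable_of_coe_count fun B _ hB => ?_
  simp_rw [fun z : Space d × Config d => ptsMeasure_del z.1 z.2 hB]
  exact measurable_lintegral_ptsMeasure
    (f := fun w : (Space d × Config d) × Space d => (B ∩ {w.1.1}ᶜ).indicator 1 w.2)
    (measurable_indicator_ne hB (by fun_prop) (by fun_prop)) measurable_snd

theorem measurable_add_prod : Measurable fun z : Space d × Config d => z.2.add z.1 := by
  refine measurable_of_coe_count fun B _ hB => ?_
  simp_rw [fun z : Space d × Config d => ptsMeasure_add z.1 z.2 hB]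
  refine Measurable.add ?_ ((measurable_one.indicator hB).comp measurable_fst)
  exact measurable_lintegral_ptsMeasure
    (f := fun w : (Space d × Config d) × Space d => (B ∩ {w.1.1}ᶜ).indicator 1 w.2)
    (measurable_indicator_ne hB (by fun_prop) (by fun_prop)) measurable_snd

theorem ptsMeasure_glue (Λ : Set (Space d)) (η ω : Config d) {B : Set (Space d)}
    (hΛ : MeasurableSet Λ) (hB : MeasurableSet B) :
    (glue Λ η ω).ptsMeasure B = η.ptsMeasure (Λ ∩ B) + ω.ptsMeasure (Λᶜ ∩ B) := by
  classical
  rw [← lintegral_indicator_one hB, ← lintegral_indicator_one (hΛ.inter hB),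
    ← lintegral_indicator_one (hΛ.compl.inter hB), lintegral_ptsMeasure_eq_tsum_indicator,
    lintegral_ptsMeasure_eq_tsum_indicator, lintegral_ptsMeasure_eq_tsum_indicator,
    ← ENNReal.tsum_add]
  refine tsum_congr fun y => ?_
  simp only [Set.indicator, glue, Set.mem_union, Set.mem_inter_iff, Set.mem_compl_iff]
  split_ifs <;> first | tauto | simp

theorem measurable_glue {Λ : Set (Space d)} (hΛ : MeasurableSet Λ) :
    Measurable fun z : Config d × Config d => glue Λ z.1 z.2 := by
  refine measurable_of_coe_count fun B _ hB => ?_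
  simp_rw [fun z : Config d × Config d => ptsMeasure_glue Λ z.1 z.2 hΛ hB]
  exact (((Measure.measurable_coe (hΛ.inter hB)).comp measurable_ptsMeasure).comp
    measurable_fst).add (((Measure.measurable_coe (hΛ.compl.inter hB)).comp
      measurable_ptsMeasure).comp measurable_snd)

end Config

end

/-! ### Boxes: measurability, volume and exhaustion of space -/

section

variable {d : ℕ}

theorem measurableSet_box (d n : ℕ) : MeasurableSet (box d n) := by
  have : box d n = ⋂ i, (fun x : Space d => x i) ⁻¹' Set.Ico (-(n : ℝ) / 2) ((n : ℝ) / 2) := by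
    ext x; simp [box]
  rw [this]
  exact MeasurableSet.iInter fun i => (by fun_prop : Measurable fun x : Space d => x i)
    measurableSet_Ico

theorem volume_box (d n : ℕ) : volume (box d n) = (n : ℝ≥0∞) ^ d := by
  have h1 : box d n = (MeasurableEquiv.toLp 2 (Fin d → ℝ)).symm ⁻¹'
      (Set.univ.pi fun _ => Set.Ico (-(n : ℝ) / 2) ((n : ℝ) / 2)) := by
    ext x; simp [box]
  rw [h1, (EuclideanSpace.volume_preserving_symm_measurableEquiv_toLp (Fin d)).measure_preimage
    (MeasurableSet.univ_pi fun _ => measurableSet_Ico).nullMeasurableSet, volume_pi_pi]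
  simp only [Real.volume_Ico, Finset.prod_const, Finset.card_univ, Fintype.card_fin]
  congr 1
  rw [show (n : ℝ) / 2 - -(n : ℝ) / 2 = n by ring, ENNReal.ofReal_natCast]

theorem box_mono (d : ℕ) : Monotone (box d) := by
  intro m n h x hx i
  have := hx i
  have h' : (m : ℝ) ≤ n := by exact_mod_cast h
  constructor
  · linarith [this.1]
  · linarith [this.2]

theorem exists_subset_box {B : Set (Space d)} (hB : Bornology.IsBounded B) :
    ∃ n₀ : ℕ, ∀ n, n₀ ≤ n → B ⊆ box d n := by
  obtain ⟨r, hr⟩ := hB.subset_closedBall 0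
  obtain ⟨n₀, hn₀⟩ := exists_nat_gt (2 * r)
  refine ⟨n₀, fun n hn x hx i => ?_⟩
  have h1 : ‖x‖ ≤ r := by simpa using hr hx
  have h2 : |x i| ≤ ‖x‖ := by simpa using EuclideanSpace.norm_eq x ▸ PiLp.norm_apply_le x i
  have h3 : (n₀ : ℝ) ≤ n := by exact_mod_cast hn
  have h4 := abs_le.1 (h2.trans h1)
  constructor
  · linarith [h4.1]
  · linarith [h4.2]

theorem eventually_mem_box (x : Space d) : ∀ᶠ n : ℕ in atTop, x ∈ box d n := by
  obtain ⟨n₀, h⟩ := exists_subset_box (Bornology.isBounded_singleton (x := x))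
  exact eventually_atTop.2 ⟨n₀, fun n hn => h n hn rfl⟩

/-! ### One-point energies and birth rates: measurability, range, bounds, covariance -/

section Energy

variable {H : FinConfig d → ℝ}

namespace Config

theorem measurable_boxPart (n : ℕ) : Measurable fun η : Config d => η.boxPart n :=
  (measurable_restrict (measurableSet_box d n)).subtype_mk

theorem measurable_boxPartAdd (n : ℕ) :
    Measurable fun z : Space d × Config d => z.2.boxPartAdd n z.1 :=
  (measurable_add_prod.comp (measurable_fst.prodMk
    ((measurable_restrict (measurableSet_box d n)).comp measurable_snd))).subtype_mk

theorem boxPart_add {n : ℕ} {x : Space d} (hx : x ∈ box d n) (η : Config d) :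
    (η.add x).boxPart n = η.boxPartAdd n x :=
  Subtype.ext (restrict_add_of_mem hx η)

end Config

theorem IsInteraction.tendsto_condEnergy (hH : IsInteraction H) {Λ : Set (Space d)}
    (hb : Bornology.IsBounded Λ) (hm : MeasurableSet Λ) (η : Config d) :
    Tendsto (fun n : ℕ => H (η.boxPart n) - H ((η.restrict Λᶜ).boxPart n)) atTop
      (𝓝 (condEnergy H Λ η)) :=
  tendsto_nhds_limUnder (hH.converges Λ hb hm η)

/-- A point added inside Λ is invisible outside Λ, so the two outer energies cancel. -/
theorem IsInteraction.tendsto_boxPartAdd_sub (hH : IsInteraction H) {Λ : Set (Space d)}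
    (hb : Bornology.IsBounded Λ) (hm : MeasurableSet Λ) {x : Space d} (hx : x ∈ Λ) (η : Config d) :
    Tendsto (fun n : ℕ => H (η.boxPartAdd n x) - H (η.boxPart n)) atTop
      (𝓝 (condEnergy H Λ (η.add x) - condEnergy H Λ η)) := by
  refine ((hH.tendsto_condEnergy hb hm (η.add x)).sub
    (hH.tendsto_condEnergy hb hm η)).congr' ?_
  filter_upwards [eventually_mem_box x] with n hn
  rw [Config.boxPart_add hn, Config.restrict_add_of_notMem (by simpa using hx)]
  ring

theorem IsInteraction.pointEnergy_eq (hH : IsInteraction H) {Λ : Set (Space d)}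
    (hb : Bornology.IsBounded Λ) (hm : MeasurableSet Λ) {x : Space d} (hx : x ∈ Λ) (η : Config d) :
    pointEnergy H x η = condEnergy H Λ (η.add x) - condEnergy H Λ η :=
  (hH.tendsto_boxPartAdd_sub hb hm hx η).limUnder_eq

theorem IsInteraction.tendsto_pointEnergy (hH : IsInteraction H) (x : Space d) (η : Config d) :
    Tendsto (fun n : ℕ => H (η.boxPartAdd n x) - H (η.boxPart n)) atTop
      (𝓝 (pointEnergy H x η)) := by
  have hb : Bornology.IsBounded ({x} : Set (Space d)) := Bornology.isBounded_singleton
  rw [hH.pointEnergy_eq hb (measurableSet_singleton x) rfl]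
  exact hH.tendsto_boxPartAdd_sub hb (measurableSet_singleton x) rfl η

theorem IsInteraction.measurable_condEnergy (hH : IsInteraction H) {Λ : Set (Space d)}
    (hb : Bornology.IsBounded Λ) (hm : MeasurableSet Λ) : Measurable (condEnergy H Λ) := by
  refine measurable_of_tendsto_metrizable (fun n => ?_)
    (tendsto_pi_nhds.2 fun η => hH.tendsto_condEnergy hb hm η)
  exact (hH.measurable.comp (Config.measurable_boxPart n)).sub
    (hH.measurable.comp ((Config.measurable_boxPart n).comp
      (Config.measurable_restrict hm.compl)))

theorem IsInteraction.measurable_pointEnergy (hH : IsInteraction H) :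
    Measurable fun z : Space d × Config d => pointEnergy H z.1 z.2 := by
  refine measurable_of_tendsto_metrizable (fun n => ?_)
    (tendsto_pi_nhds.2 fun z => hH.tendsto_pointEnergy z.1 z.2)
  exact (hH.measurable.comp (Config.measurable_boxPartAdd n)).sub
    (hH.measurable.comp ((Config.measurable_boxPart n).comp measurable_snd))

theorem IsInteraction.measurable_birthRate (hH : IsInteraction H) :
    Measurable fun z : Space d × Config d => birthRate H z.1 z.2 :=
  hH.measurable_pointEnergy.neg.exp

theorem birthRate_pos (x : Space d) (η : Config d) : 0 < birthRate H x η := Real.exp_pos _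

/-- The finite-range condition for the window {x}, whose thickening is the closed ball around x. -/
theorem IsInteraction.exists_range (hH : IsInteraction H) : ∃ R : ℝ, 0 < R ∧
    ∀ (x : Space d) (Δ : Set (Space d)), Metric.closedBall x R ⊆ Δ → ∀ η : Config d,
      pointEnergy H x η = pointEnergy H x (η.restrict Δ) := by
  obtain ⟨R, hR, h⟩ := hH.finite_range
  have key : ∀ (x : Space d) (η : Config d),
      pointEnergy H x η = pointEnergy H x (η.restrict (Metric.closedBall x R)) := by
    intro x η
    have hb : Bornology.IsBounded ({x} : Set (Space d)) := Bornology.isBounded_singleton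
    have hm := measurableSet_singleton x
    have h1 : ∀ ζ : Config d, condEnergy H {x} ζ =
        condEnergy H {x} (ζ.restrict (Metric.closedBall x R)) := by
      intro ζ
      rw [← Metric.cthickening_singleton x hR.le]
      exact h _ hb hm ζ
    rw [hH.pointEnergy_eq hb hm rfl, hH.pointEnergy_eq hb hm rfl, h1 (η.add x), h1 η,
      Config.restrict_add_of_mem (Metric.mem_closedBall_self hR.le)]
  refine ⟨R, hR, fun x Δ hΔ η => ?_⟩
  rw [key x η, key x (η.restrict Δ), Config.restrict_restrict_of_subset hΔ]

theorem IsInteraction.exists_bound (hH : IsInteraction H) : ∃ C : ℝ, 0 ≤ C ∧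
    ∀ (x : Space d) (η : Config d),
      Real.exp (-C) ≤ birthRate H x η ∧ birthRate H x η ≤ Real.exp C := by
  obtain ⟨C, hC⟩ := hH.bounded
  refine ⟨C, (abs_nonneg _).trans (hC 0 ⟨∅, by simp⟩), fun x η => ?_⟩
  have := abs_le.1 (hC x η)
  exact ⟨Real.exp_le_exp.2 (by linarith [this.2]), Real.exp_le_exp.2 (by linarith [this.1])⟩

theorem pointEnergy_of_finite (x : Space d) {η : Config d} (hη : η.pts.Finite) :
    pointEnergy H x η = H ⟨η.add x, hη.insert x⟩ - H ⟨η, hη⟩ := by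
  refine Tendsto.limUnder_eq (tendsto_const_nhds.congr' ?_)
  obtain ⟨n₀, h⟩ := exists_subset_box hη.isBounded
  filter_upwards [eventually_ge_atTop n₀] with n hn
  have h1 : η.restrict (box d n) = η := by
    ext y; simp only [Config.restrict, Set.inter_eq_left.2 (h n hn)]
  simp only [Config.boxPartAdd, Config.boxPart, h1]

/-- Invariance is assumed only for finite configurations, and the boxes in the limit are not moved
by the translation. The finite range first replaces η by its part in a ball, where the limit is an
eventually constant sequence. -/
theorem IsInteraction.pointEnergy_shift (hH : IsInteraction H) (x y : Space d) (η : Config d) :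
    pointEnergy H (x - y) (η.shift y) = pointEnergy H x η := by
  obtain ⟨R, hR, h⟩ := hH.exists_range
  have hf : (η.restrict (Metric.closedBall x R)).pts.Finite :=
    η.locallyFinite _ Metric.isBounded_closedBall
  have h1 : (η.shift y).restrict (Metric.closedBall (x - y) R) =
      (η.restrict (Metric.closedBall x R)).shift y := by
    rw [Config.shift_restrict]
    congr 1
    ext z
    simp only [Metric.mem_closedBall, Set.mem_ofPred_eq, dist_eq_norm]
    rw [show z - (x - y) = z + y - x by abel]
  rw [h x _ subset_rfl η, h (x - y) _ subset_rfl (η.shift y), pointEnergy_of_finite x hf, h1,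
    pointEnergy_of_finite (x - y) (hf.image _)]
  have h2 := hH.shift_invariant y ⟨_, hf⟩
  have h3 := hH.shift_invariant y ⟨(η.restrict (Metric.closedBall x R)).add x, hf.insert x⟩
  rw [← h2, ← h3]
  congr 2
  refine Subtype.ext ?_
  exact (Config.shift_add y x _).symm

theorem IsInteraction.birthRate_shift (hH : IsInteraction H) (x : Space d) (η : Config d) :
    birthRate H 0 (η.shift x) = birthRate H x η := by
  rw [birthRate, birthRate, ← hH.pointEnergy_shift x x, sub_self]

end Energy

/-! ### Palm measure and reduced Campbell measure -/

section Palm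

variable {μ : Measure (Config d)}

/-- Translating η by a relabels its point x as x - a and leaves the configuration seen from that
point unchanged; stationarity does the rest. -/
theorem lintegral_lintegral_ptsMeasure_shift (hμθ : IsShiftInvariant μ)
    {k : Space d × Config d → ℝ≥0∞} (hk : Measurable k) (a : Space d) :
    ∫⁻ η, ∫⁻ x, k (x, η.shift x) ∂η.ptsMeasure ∂μ =
      ∫⁻ η, ∫⁻ x, k (x - a, η.shift x) ∂η.ptsMeasure ∂μ := by
  conv_lhs => rw [← hμθ a]
  rw [lintegral_map]
  · refine lintegral_congr fun η => ?_
    rw [Config.lintegral_ptsMeasure_shift]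
    simp only [Config.shift_shift, sub_add_cancel]
  · exact Config.measurable_lintegral_ptsMeasure
      (f := fun w : Config d × Space d => k (w.2, w.1.shift w.2))
      (hk.comp (measurable_snd.prodMk
        (Config.measurable_shift_prod.comp (measurable_snd.prodMk measurable_fst)))) measurable_id
  · exact Config.measurable_shift a

/-- The law of the configuration seen from a point in the unit box. -/
noncomputable def palmOfBox (μ : Measure (Config d)) : Measure (Config d) :=
  ((μ ⊗ₘ Config.ptsKernel d).restrict {z | z.2 ∈ box d 1}).map fun z => z.1.shift z.2

theorem lintegral_palmOfBox [SFinite μ] {f : Config d → ℝ≥0∞} (hf : Measurable f) :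
    ∫⁻ ζ, f ζ ∂palmOfBox μ =
      ∫⁻ η, ∫⁻ x, (box d 1).indicator 1 x * f (η.shift x) ∂η.ptsMeasure ∂μ := by
  have hs : Measurable fun z : Config d × Space d => z.1.shift z.2 :=
    Config.measurable_shift_prod.comp (measurable_snd.prodMk measurable_fst)
  have hB : MeasurableSet {z : Config d × Space d | z.2 ∈ box d 1} :=
    measurable_snd (measurableSet_box d 1)
  rw [palmOfBox, lintegral_map hf hs, ← lintegral_indicator hB, Measure.lintegral_compProd]
  · refine lintegral_congr fun η => lintegral_congr fun x => ?_
    by_cases hx : x ∈ box d 1 <;> simp [Set.indicator, hx]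
  · exact (hf.comp hs).indicator hB

/-- An extra Lebesgue integration spreads the restriction to the unit box over all of space: after
using stationarity for each translate, every point is weighted by the volume of a unit box, which is
one. -/
theorem isPalm_palmOfBox [SFinite μ] (hμθ : IsShiftInvariant μ) [IsFiniteMeasure (palmOfBox μ)] :
    IsPalm μ (palmOfBox μ) := by
  intro f hf
  have hs : Measurable fun z : Config d × Space d => z.1.shift z.2 :=
    Config.measurable_shift_prod.comp (measurable_snd.prodMk measurable_fst)
  have hi : Measurable ((box d 1).indicator (1 : Space d → ℝ≥0∞)) :=
    measurable_one.indicator (measurableSet_box d 1)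
  simp_rw [fun η : Config d =>
    (Config.lintegral_ptsMeasure η fun x => f (x, η.shift x)).symm]
  symm
  have hF : Measurable fun w : Space d × Config d × Space d =>
      (box d 1).indicator 1 (w.2.2 - w.1) * f (w.2.2, w.2.1.shift w.2.2) :=
    (hi.comp (by fun_prop)).mul (hf.comp (measurable_snd.snd.prodMk (hs.comp measurable_snd)))
  calc ∫⁻ x, ∫⁻ ζ, f (x, ζ) ∂palmOfBox μ
      = ∫⁻ ζ, (∫⁻ x, f (x, ζ)) ∂palmOfBox μ := lintegral_lintegral_swap hf.aemeasurable
    _ = ∫⁻ η, ∫⁻ y, (box d 1).indicator 1 y * (∫⁻ x, f (x, η.shift y)) ∂η.ptsMeasure ∂μ := by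
        rw [lintegral_palmOfBox]
        exact hf.lintegral_prod_left'
    -- Lebesgue measure is recentred at the selected point y, preparing the use of stationarity.
    _ = ∫⁻ η, ∫⁻ y, (box d 1).indicator 1 y * (∫⁻ x, f (x + y, η.shift y)) ∂η.ptsMeasure ∂μ := by
        refine lintegral_congr fun η => lintegral_congr fun y => ?_
        rw [lintegral_add_right_eq_self (fun x => f (x, η.shift y))]
    _ = ∫⁻ z, (∫⁻ x, (box d 1).indicator 1 z.2 * f (x + z.2, z.1.shift z.2))
          ∂(μ ⊗ₘ Config.ptsKernel d) := by
        rw [Measure.lintegral_compProd]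
        · refine lintegral_congr fun η => lintegral_congr fun y => ?_
          rw [lintegral_const_mul]
          exact hf.comp (by fun_prop)
        · refine Measurable.lintegral_prod_right' (f := fun w : (Config d × Space d) × Space d =>
            (box d 1).indicator 1 w.1.2 * f (w.2 + w.1.2, w.1.1.shift w.1.2)) ?_
          exact (hi.comp (by fun_prop)).mul (hf.comp
            (Measurable.prodMk (by fun_prop) (hs.comp measurable_fst)))
    _ = ∫⁻ x, ∫⁻ z, (box d 1).indicator 1 z.2 * f (x + z.2, z.1.shift z.2)
          ∂(μ ⊗ₘ Config.ptsKernel d) := by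
        refine lintegral_lintegral_swap ?_
        refine Measurable.aemeasurable ?_
        exact (hi.comp (by fun_prop)).mul (hf.comp
            (Measurable.prodMk (by fun_prop) (hs.comp measurable_fst)))
    -- For fixed x, stationarity moves the box instead of the argument of `f`.
    _ = ∫⁻ x, ∫⁻ η, ∫⁻ y, (box d 1).indicator 1 (y - x) * f (y, η.shift y) ∂η.ptsMeasure ∂μ := by
        refine lintegral_congr fun x => ?_
        rw [Measure.lintegral_compProd]
        · have := lintegral_lintegral_ptsMeasure_shift hμθ
            (k := fun w => (box d 1).indicator 1 w.1 * f (x + w.1, w.2)) ?_ x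
          · simpa using this
          · exact (hi.comp (by fun_prop)).mul (hf.comp (by fun_prop))
        · exact (hi.comp (by fun_prop)).mul (hf.comp
            (Measurable.prodMk (by fun_prop) hs))
    _ = ∫⁻ x, ∫⁻ z, (box d 1).indicator 1 (z.2 - x) * f (z.2, z.1.shift z.2)
          ∂(μ ⊗ₘ Config.ptsKernel d) := by
        refine lintegral_congr fun x => ?_
        rw [Measure.lintegral_compProd]
        · rfl
        · exact hF.comp (by fun_prop : Measurable fun z : Config d × Space d => (x, z))
    _ = ∫⁻ z, (∫⁻ x, (box d 1).indicator 1 (z.2 - x) * f (z.2, z.1.shift z.2))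
          ∂(μ ⊗ₘ Config.ptsKernel d) := lintegral_lintegral_swap hF.aemeasurable
    _ = ∫⁻ z, f (z.2, z.1.shift z.2) ∂(μ ⊗ₘ Config.ptsKernel d) := by
        refine lintegral_congr fun z => ?_
        have hz : Measurable fun x => (box d 1).indicator (1 : Space d → ℝ≥0∞) (z.2 - x) :=
          hi.comp (by fun_prop)
        rw [lintegral_mul_const _ hz,
          lintegral_sub_left_eq_self (fun x => (box d 1).indicator (1 : Space d → ℝ≥0∞) x),
          lintegral_indicator_one (measurableSet_box d 1), volume_box]
        simp
    _ = _ := by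
        rw [Measure.lintegral_compProd]
        · rfl
        · exact hf.comp (measurable_snd.prodMk hs)

/-- The centred half-open unit box, moved by 1/2 in every coordinate, lies in the closed cube of the
intensity hypothesis. -/
theorem lintegral_ptsMeasure_box_lt_top (hμθ : IsShiftInvariant μ)
    (hμ1 : ∫⁻ η, (Config.count (unitCube d) η : ℝ≥0∞) ∂μ < ⊤) :
    ∫⁻ η, η.ptsMeasure (box d 1) ∂μ < ⊤ := by
  refine lt_of_le_of_lt ?_ hμ1
  let a : Space d := WithLp.toLp 2 fun _ => -(1 / 2 : ℝ)
  have hcube : MeasurableSet (unitCube d) := by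
    have : unitCube d = ⋂ i, (fun x : Space d => x i) ⁻¹' Set.Icc (0 : ℝ) 1 := by
      ext x; simp [unitCube]
    rw [this]
    exact MeasurableSet.iInter fun i => (by fun_prop : Measurable fun x : Space d => x i)
      measurableSet_Icc
  have hb : Bornology.IsBounded (unitCube d) := by
    refine (isBounded_box d 4).subset fun x hx i => ?_
    have := hx i
    constructor
    · push_cast; linarith [this.1]
    · push_cast; linarith [this.2]
  conv_rhs => rw [← hμθ a]
  have hc : Measurable fun η : Config d => (Config.count (unitCube d) η : ℝ≥0∞) :=
    measurable_from_top.comp (Config.measurable_count hb hcube)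
  rw [lintegral_map hc (Config.measurable_shift a)]
  refine lintegral_mono fun η => ?_
  rw [← Config.ptsMeasure_apply_of_isBounded _ hb hcube, Config.ptsMeasure_shift _ _ hcube,
    ← lintegral_indicator_one (measurableSet_box d 1)]
  refine lintegral_mono fun y => ?_
  by_cases hy : y ∈ box d 1
  · have hy' : y - a ∈ unitCube d := by
      intro i
      have h1 := hy i
      have h2 : (y - a) i = y i + 1 / 2 := by simp [a]
      push_cast at h1
      rw [h2]
      constructor
      · linarith [h1.1]
      · linarith [h1.2]
    simp [hy, hy']
  · simp [hy]

theorem exists_isPalm [SFinite μ] (hμθ : IsShiftInvariant μ)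
    (hμ1 : ∫⁻ η, (Config.count (unitCube d) η : ℝ≥0∞) ∂μ < ⊤) : ∃ μ₀, IsPalm μ μ₀ := by
  have : IsFiniteMeasure (palmOfBox μ) := by
    refine ⟨?_⟩
    rw [← lintegral_one, lintegral_palmOfBox measurable_const]
    simpa [lintegral_indicator_one (measurableSet_box d 1)] using
      lintegral_ptsMeasure_box_lt_top hμθ hμ1
  exact ⟨_, isPalm_palmOfBox hμθ⟩

theorem isPalm_palm [SFinite μ] (hμθ : IsShiftInvariant μ)
    (hμ1 : ∫⁻ η, (Config.count (unitCube d) η : ℝ≥0∞) ∂μ < ⊤) : IsPalm μ (palm μ) := by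
  have h := exists_isPalm hμθ hμ1
  rw [palm, dif_pos h]
  exact h.choose_spec

/-- Since `palm` is obtained by choice, finiteness must come from the Campbell formula: testing it
on the unit box gives the total mass as the mean number of points there. -/
theorem isFiniteMeasure_palm [SFinite μ] (hμθ : IsShiftInvariant μ)
    (hμ1 : ∫⁻ η, (Config.count (unitCube d) η : ℝ≥0∞) ∂μ < ⊤) : IsFiniteMeasure (palm μ) := by
  have h := isPalm_palm hμθ hμ1 (fun z => (box d 1).indicator 1 z.1)
    ((measurable_one.indicator (measurableSet_box d 1)).comp measurable_fst)
  simp_rw [fun η : Config d => (Config.lintegral_ptsMeasure η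
    fun x => (box d 1).indicator 1 x).symm, lintegral_const] at h
  rw [lintegral_mul_const _ (measurable_one.indicator (measurableSet_box d 1)),
    lintegral_indicator_one (measurableSet_box d 1), volume_box] at h
  simp only [Nat.cast_one, one_pow, one_mul, lintegral_indicator_one (measurableSet_box d 1)] at h
  refine ⟨?_⟩
  rw [← h]
  exact lintegral_ptsMeasure_box_lt_top hμθ hμ1

/-- The reduced Campbell measure. -/
noncomputable def campbell (μ : Measure (Config d)) : Measure (Space d × Config d) :=
  (μ ⊗ₘ Config.ptsKernel d).map fun z => (z.2, z.1.del z.2)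

theorem measurable_snd_del :
    Measurable fun z : Config d × Space d => (z.2, z.1.del z.2) :=
  measurable_snd.prodMk (Config.measurable_del_prod.comp (measurable_snd.prodMk measurable_fst))

theorem lintegral_campbell [SFinite μ] {f : Space d × Config d → ℝ≥0∞} (hf : Measurable f) :
    ∫⁻ z, f z ∂campbell μ = ∫⁻ η, ∫⁻ x, f (x, η.del x) ∂η.ptsMeasure ∂μ := by
  rw [campbell, lintegral_map hf measurable_snd_del]
  exact Measure.lintegral_compProd (hf.comp measurable_snd_del)

/-- The map `(x, ζ) ↦ (x, ζ + x)`. -/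
def moveOrigin (z : Space d × Config d) : Space d × Config d := (z.1, z.2.shift (-z.1))

/-- The map `(x, η) ↦ (x, η - x)`. -/
def centerAt (z : Space d × Config d) : Space d × Config d := (z.1, z.2.shift z.1)

theorem measurable_centerAt : Measurable (centerAt : Space d × Config d → _) :=
  measurable_fst.prodMk Config.measurable_shift_prod

theorem measurable_moveOrigin : Measurable (moveOrigin : Space d × Config d → _) :=
  measurable_fst.prodMk
    (Config.measurable_shift_prod.comp (measurable_fst.neg.prodMk measurable_snd))

theorem centerAt_moveOrigin : Function.LeftInverse (centerAt (d := d)) moveOrigin := by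
  rintro ⟨x, η⟩
  simp [centerAt, moveOrigin, Config.shift_shift_neg]

theorem measurable_removeOrigin : Measurable (removeOrigin : Config d → Config d) :=
  Config.measurable_del 0

/-- The Campbell formula is tested on functions that undo the centring at x; deleting x then
corresponds to removing the origin from the centred configuration. -/
theorem IsPalm.campbell_eq [SFinite μ] {μ₀ : Measure (Config d)} [SFinite μ₀] (h : IsPalm μ μ₀) :
    campbell μ = (volume.prod (μ₀.map removeOrigin)).map moveOrigin := by
  refine Measure.ext_of_lintegral _ fun f hf => ?_
  have h1 := h (fun z => f (z.1, (z.2.shift (-z.1)).del z.1)) (hf.comp (measurable_fst.prodMk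
    (Config.measurable_del_prod.comp (measurable_fst.prodMk (Config.measurable_shift_prod.comp
      (measurable_fst.neg.prodMk measurable_snd))))))
  simp_rw [fun η : Config d => (Config.lintegral_ptsMeasure η
    fun x => f (x, ((η.shift x).shift (-x)).del x)).symm, Config.shift_neg_shift] at h1
  have hm : Measurable fun z => f (moveOrigin z) := hf.comp measurable_moveOrigin
  rw [lintegral_campbell hf, h1, lintegral_map hf measurable_moveOrigin,
    lintegral_prod _ hm.aemeasurable]
  refine lintegral_congr fun x => ?_
  have hx : Measurable fun y => f (moveOrigin (x, y)) := hm.comp measurable_prodMk_left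
  rw [lintegral_map hx measurable_removeOrigin]
  refine lintegral_congr fun ζ => ?_
  simp only [moveOrigin, removeOrigin, Config.shift_del]
  simp

end Palm

end

section

variable {d : ℕ}

/-! ### The Poisson process in a bounded window and its Mecke formula -/

section Poisson

instance (Λ : Set (Space d)) : SFinite (poissonOn Λ) := by
  unfold poissonOn
  infer_instance

theorem lintegral_poissonOn (Λ : Set (Space d)) {f : Config d → ℝ≥0∞} (hf : Measurable f) :
    ∫⁻ η, f η ∂poissonOn Λ = ∑' k : ℕ,
      ENNReal.ofReal (Real.exp (-(volume Λ).toReal) / (k.factorial : ℝ)) *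
        ∫⁻ x, f (Config.ofFin x) ∂(Measure.pi fun _ : Fin k => volume.restrict Λ) := by
  rw [poissonOn, lintegral_sum_measure]
  refine tsum_congr fun k => ?_
  rw [lintegral_smul_measure, lintegral_map hf (Config.measurable_ofFin k), smul_eq_mul]

/-- `Config.ofFin` forgets repetitions, so k coordinates give k points only off the diagonals. Each
diagonal is null because, given one coordinate, another one avoids it almost surely. -/
theorem ae_injective_pi {k : ℕ} {κ : Measure (Space d)} [IsFiniteMeasure κ] [NullSingletonClass κ] :
    ∀ᵐ x ∂(Measure.pi fun _ : Fin k => κ), Function.Injective x := by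
  have h : ∀ i j : Fin k, i ≠ j → ∀ᵐ x ∂(Measure.pi fun _ : Fin k => κ), x i ≠ x j := by
    intro i j hij
    cases k with
    | zero => exact i.elim0
    | succ m =>
      obtain ⟨l, rfl⟩ := Fin.exists_succAbove_eq hij.symm
      have hm : MeasurableSet {z : Space d × (Fin m → Space d) | z.2 l = z.1} :=
        measurableSet_eq_fun (by fun_prop) (by fun_prop)
      have h0 : (κ.prod (Measure.pi fun _ : Fin m => κ)) {z | z.2 l = z.1} = 0 := by
        rw [Measure.measure_prod_null hm]
        exact ae_of_all _ fun y => Measure.pi_hyperplane (fun _ : Fin m => κ) l y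
      have h1 := (measurePreserving_piFinSuccAbove (fun _ : Fin (m + 1) => κ) i).measure_preimage
        hm.nullMeasurableSet
      rw [h0] at h1
      refine measure_mono_null (fun x hx => ?_) h1
      simp only [Set.mem_compl_iff, Set.mem_ofPred_eq, not_not] at hx
      exact hx.symm
  have h' := ae_all_iff.2 fun i => ae_all_iff.2 fun j => eventually_imp_distrib_left.2 (h i j)
  filter_upwards [h'] with x hx i j hij
  by_contra hne
  exact hx i j hne hij

theorem lintegral_ptsMeasure_ofFin {k : ℕ} {x : Fin k → Space d} (hx : Function.Injective x)
    (f : Space d → ℝ≥0∞) : ∫⁻ y, f y ∂(Config.ofFin x).ptsMeasure = ∑ i, f (x i) := by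
  rw [Config.lintegral_ptsMeasure, ← tsum_fintype (L := .unconditional _)]
  exact ((Equiv.ofInjective x hx).tsum_eq fun y : Set.range x => f y).symm

theorem ofFin_del {m : ℕ} {x : Fin (m + 1) → Space d} (hx : Function.Injective x)
    (i : Fin (m + 1)) : (Config.ofFin x).del (x i) = Config.ofFin (i.removeNth x) := by
  ext y
  simp only [Config.del, Config.ofFin, Set.mem_sdiff, Set.mem_range, Set.mem_singleton_iff]
  constructor
  · rintro ⟨⟨j, rfl⟩, hj⟩
    have : j ≠ i := fun h => hj (by rw [h])
    obtain ⟨l, rfl⟩ := Fin.exists_succAbove_eq this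
    exact ⟨l, rfl⟩
  · rintro ⟨l, rfl⟩
    exact ⟨⟨_, rfl⟩, fun h => Fin.succAbove_ne i l (hx h)⟩

/-- The Mecke formula for the Poisson point process. -/
theorem lintegral_poissonOn_mecke [NeZero d] {Λ : Set (Space d)} (hb : Bornology.IsBounded Λ)
    {f : Space d × Config d → ℝ≥0∞} (hf : Measurable f) :
    ∫⁻ η, ∫⁻ x, f (x, η.del x) ∂η.ptsMeasure ∂poissonOn Λ =
      ∫⁻ x in Λ, ∫⁻ η, f (x, η) ∂poissonOn Λ := by
  have hfin : IsFiniteMeasure (volume.restrict Λ) := by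
    refine ⟨?_⟩
    rw [Measure.restrict_apply_univ]
    exact hb.measure_lt_top
  have hm : Measurable fun η : Config d => ∫⁻ x, f (x, η.del x) ∂η.ptsMeasure :=
    Config.measurable_lintegral_ptsMeasure
      (f := fun w : Config d × Space d => f (w.2, w.1.del w.2))
      (hf.comp measurable_snd_del) measurable_id
  -- The empty configuration contributes nothing, so the series over the number of points starts at
  -- one and can be reindexed.
  rw [lintegral_poissonOn Λ hm, tsum_eq_zero_add' ENNReal.summable]
  set κ : Measure (Space d) := volume.restrict Λ with hκ
  have hms : ∀ k, Measurable fun z : Space d × (Fin k → Space d) => f (z.1, Config.ofFin z.2) :=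
    fun k => hf.comp (measurable_fst.prodMk ((Config.measurable_ofFin k).comp measurable_snd))
  have h0 : ∫⁻ x, (∫⁻ y, f (y, (Config.ofFin x).del y) ∂(Config.ofFin x).ptsMeasure)
      ∂(Measure.pi fun _ : Fin 0 => κ) = 0 := by
    refine lintegral_eq_zero_of_ae_eq_zero (ae_of_all _ fun x => ?_)
    change ∫⁻ y, f (y, (Config.ofFin x).del y) ∂(Config.ofFin x).ptsMeasure = 0
    rw [lintegral_ptsMeasure_ofFin (Function.injective_of_subsingleton x)]
    simp
  -- By exchangeability the m + 1 points contribute equally, each leaving m independent points.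
  have hsucc : ∀ m : ℕ, ∫⁻ x, (∫⁻ y, f (y, (Config.ofFin x).del y) ∂(Config.ofFin x).ptsMeasure)
      ∂(Measure.pi fun _ : Fin (m + 1) => κ) =
      (m + 1 : ℕ) * ∫⁻ y, ∫⁻ z, f (y, Config.ofFin z) ∂(Measure.pi fun _ : Fin m => κ) ∂κ := by
    intro m
    calc _ = ∫⁻ x, ∑ i, f (x i, Config.ofFin (i.removeNth x))
          ∂(Measure.pi fun _ : Fin (m + 1) => κ) := by
          refine lintegral_congr_ae ?_
          filter_upwards [ae_injective_pi] with x hx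
          rw [lintegral_ptsMeasure_ofFin hx]
          exact Finset.sum_congr rfl fun i _ => by rw [ofFin_del hx]
      _ = ∑ i : Fin (m + 1), ∫⁻ x, f (x i, Config.ofFin (i.removeNth x))
          ∂(Measure.pi fun _ : Fin (m + 1) => κ) := by
          refine lintegral_finsetSum _ fun i _ => ?_
          exact (hms m).comp (MeasurableEquiv.piFinSuccAbove (fun _ => Space d) i).measurable
      _ = ∑ i : Fin (m + 1), ∫⁻ y, ∫⁻ z, f (y, Config.ofFin z)
          ∂(Measure.pi fun _ : Fin m => κ) ∂κ := by
          refine Finset.sum_congr rfl fun i _ => ?_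
          rw [← lintegral_prod _ (hms m).aemeasurable]
          exact (measurePreserving_piFinSuccAbove (fun _ : Fin (m + 1) => κ) i).lintegral_comp
            (hms m)
      _ = _ := by simp
  simp_rw [h0, mul_zero, zero_add, hsucc]
  have hR : ∀ x, ∫⁻ η, f (x, η) ∂poissonOn Λ = ∑' k : ℕ,
      ENNReal.ofReal (Real.exp (-(volume Λ).toReal) / (k.factorial : ℝ)) *
        ∫⁻ z, f (x, Config.ofFin z) ∂(Measure.pi fun _ : Fin k => κ) :=
    fun x => lintegral_poissonOn Λ (hf.comp measurable_prodMk_left)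
  simp_rw [hR]
  rw [lintegral_tsum fun k => ((hms k).lintegral_prod_right'.const_mul _).aemeasurable]
  refine tsum_congr fun m => ?_
  rw [lintegral_const_mul _ (hms m).lintegral_prod_right', ← mul_assoc]
  congr 1
  -- The multiplicity is absorbed by the Poisson weights: (m + 1)/(m + 1)! = 1/m!.
  rw [← ENNReal.ofReal_natCast, ← ENNReal.ofReal_mul (by positivity)]
  congr 1
  rw [Nat.factorial_succ]
  push_cast
  field_simp

/-- Equality of configurations is recast as having no point in the complement, which is a condition
on counts. -/
theorem measurableSet_restrict_eq {Λ : Set (Space d)} (hm : MeasurableSet Λ) :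
    MeasurableSet {η : Config d | η.restrict Λ = η} := by
  have : {η : Config d | η.restrict Λ = η} = {η : Config d | η.ptsMeasure Λᶜ = 0} := by
    ext η
    simp only [Set.mem_ofPred_eq]
    rw [← lintegral_indicator_one hm.compl, Config.lintegral_ptsMeasure, ENNReal.tsum_eq_zero,
      Config.ext_iff]
    change η.pts ∩ Λ = η.pts ↔ _
    rw [Set.inter_eq_left]
    constructor
    · intro h x
      simp [h x.2]
    · intro h x hx
      simpa using h ⟨x, hx⟩
  rw [this]
  exact ((Measure.measurable_coe hm.compl).comp Config.measurable_ptsMeasure)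
    (measurableSet_singleton 0)

theorem ae_restrict_eq_poissonOn {Λ : Set (Space d)} (hb : Bornology.IsBounded Λ)
    (hm : MeasurableSet Λ) : ∀ᵐ η ∂poissonOn Λ, η.restrict Λ = η := by
  have hfin : IsFiniteMeasure (volume.restrict Λ) := by
    refine ⟨?_⟩
    rw [Measure.restrict_apply_univ]
    exact hb.measure_lt_top
  rw [poissonOn, Measure.ae_sum_iff]
  intro k
  refine Measure.ae_smul_measure ?_ _
  have h1 : ∀ᵐ x ∂(Measure.pi fun _ : Fin k => (volume.restrict Λ : Measure (Space d))),
      ∀ i, x i ∈ Λ := by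
    rw [ae_all_iff]
    intro i
    exact Measure.tendsto_eval_ae_ae.eventually (ae_restrict_mem hm)
  refine (ae_map_iff (Config.measurable_ofFin k).aemeasurable ?_).2 ?_
  · exact measurableSet_restrict_eq hm
  · filter_upwards [h1] with x hx
    ext y
    simp only [Config.restrict, Config.ofFin, Set.mem_inter_iff, Set.mem_range]
    exact ⟨fun h => h.1, fun ⟨i, hi⟩ => ⟨⟨i, hi⟩, hi ▸ hx i⟩⟩

end Poisson

/-! ### Gibbs processes: equivalence with Poisson and the Georgii-Nguyen-Zessin equation -/

section Gibbs

variable {H : FinConfig d → ℝ} {ν : Measure (Config d)}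

namespace Config

theorem restrict_glue (Λ : Set (Space d)) (η ω : Config d) :
    (glue Λ η ω).restrict Λ = η.restrict Λ := by
  ext y
  simp only [restrict, glue, Set.mem_inter_iff, Set.mem_union, Set.mem_compl_iff]
  tauto

theorem glue_add {Λ : Set (Space d)} {x : Space d} (hx : x ∈ Λ) (η ω : Config d) :
    glue Λ (η.add x) ω = (glue Λ η ω).add x := by
  ext y
  simp only [glue, add, Set.mem_union, Set.mem_inter_iff, Set.mem_insert_iff, Set.mem_compl_iff]
  by_cases h : y = x
  · subst h; tauto
  · tauto

theorem glue_del {Λ : Set (Space d)} {x : Space d} (hx : x ∈ Λ) (η ω : Config d) :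
    (glue Λ η ω).del x = glue Λ (η.del x) ω := by
  ext y
  simp only [glue, del, Set.mem_union, Set.mem_inter_iff, Set.mem_sdiff, Set.mem_compl_iff,
    Set.mem_singleton_iff]
  by_cases h : y = x
  · subst h; tauto
  · tauto

theorem lintegral_ptsMeasure_glue (Λ : Set (Space d)) (η ω : Config d) (f : Space d → ℝ≥0∞) :
    ∫⁻ x, Λ.indicator f x ∂(glue Λ η ω).ptsMeasure = ∫⁻ x, Λ.indicator f x ∂η.ptsMeasure := by
  rw [lintegral_ptsMeasure_eq_tsum_indicator, lintegral_ptsMeasure_eq_tsum_indicator,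
    Set.indicator_indicator, Set.indicator_indicator,
    show (glue Λ η ω).pts ∩ Λ = η.pts ∩ Λ from congrArg pts (restrict_glue Λ η ω)]

end Config

theorem IsInteraction.measurable_exp_condEnergy_glue (hH : IsInteraction H) {Λ : Set (Space d)}
    (hb : Bornology.IsBounded Λ) (hm : MeasurableSet Λ) :
    Measurable fun z : Config d × Config d =>
      ENNReal.ofReal (Real.exp (-condEnergy H Λ (Config.glue Λ z.1 z.2))) :=
  ((hH.measurable_condEnergy hb hm).comp (Config.measurable_glue hm)).neg.exp.ennreal_ofReal

theorem IsInteraction.lintegral_finiteGibbs (hH : IsInteraction H) {Λ : Set (Space d)}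
    (hb : Bornology.IsBounded Λ) (hm : MeasurableSet Λ) {f : Config d → ℝ≥0∞} (hf : Measurable f)
    (ω : Config d) :
    ∫⁻ η, f η ∂finiteGibbs H Λ ω = (partitionFn H Λ ω)⁻¹ *
      ∫⁻ η, ENNReal.ofReal (Real.exp (-condEnergy H Λ (Config.glue Λ η ω))) * f η
        ∂poissonOn Λ := by
  rw [finiteGibbs, lintegral_smul_measure, smul_eq_mul]
  congr 1
  exact lintegral_withDensity_eq_lintegral_mul _
    ((hH.measurable_exp_condEnergy_glue hb hm).comp measurable_prodMk_right) hf

theorem IsInteraction.measurable_lintegral_finiteGibbs (hH : IsInteraction H) {Λ : Set (Space d)}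
    (hb : Bornology.IsBounded Λ) (hm : MeasurableSet Λ) {f : Config d → ℝ≥0∞} (hf : Measurable f) :
    Measurable fun ω => ∫⁻ η, f (Config.glue Λ η ω) ∂finiteGibbs H Λ ω := by
  have h : (fun ω => ∫⁻ η, f (Config.glue Λ η ω) ∂finiteGibbs H Λ ω) = fun ω =>
      (partitionFn H Λ ω)⁻¹ * ∫⁻ η, ENNReal.ofReal (Real.exp (-condEnergy H Λ
        (Config.glue Λ η ω))) * f (Config.glue Λ η ω) ∂poissonOn Λ := by
    funext ω
    exact hH.lintegral_finiteGibbs hb hm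
      (hf.comp ((Config.measurable_glue hm).comp (measurable_prodMk_right (y := ω)))) ω
  rw [h]
  refine Measurable.mul ?_ ?_
  · exact ((hH.measurable_exp_condEnergy_glue hb hm).lintegral_prod_left').inv
  · exact ((hH.measurable_exp_condEnergy_glue hb hm).mul
      (hf.comp (Config.measurable_glue hm))).lintegral_prod_left'

/-- By the DLR equation the law in Λ is a mixture of laws with a density relative to the Poisson
process. -/
theorem IsInteraction.marginal_ac (hH : IsInteraction H) (hν : IsGibbs H ν) {Λ : Set (Space d)}
    (hb : Bornology.IsBounded Λ) (hm : MeasurableSet Λ) : marginal Λ ν ≪ poissonOn Λ := by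
  refine Measure.AbsolutelyContinuous.mk fun A hA hA0 => ?_
  have hA' : MeasurableSet (Config.restrict Λ ⁻¹' A) := Config.measurable_restrict hm hA
  rw [marginal, Measure.map_apply (Config.measurable_restrict hm) hA,
    ← lintegral_indicator_one hA', hν.dlr Λ hb hm _ (measurable_one.indicator hA')]
  refine lintegral_eq_zero_of_ae_eq_zero (ae_of_all _ fun ω => ?_)
  change ∫⁻ η, (Config.restrict Λ ⁻¹' A).indicator 1 (Config.glue Λ η ω) ∂finiteGibbs H Λ ω = 0
  have h1 : Measurable fun η => (Config.restrict Λ ⁻¹' A).indicator (1 : Config d → ℝ≥0∞)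
      (Config.glue Λ η ω) :=
    (measurable_one.indicator hA').comp ((Config.measurable_glue hm).comp measurable_prodMk_right)
  rw [hH.lintegral_finiteGibbs hb hm h1]
  refine mul_eq_zero_of_right _ (lintegral_eq_zero_of_ae_eq_zero ?_)
  filter_upwards [ae_restrict_eq_poissonOn hb hm, measure_eq_zero_iff_ae_notMem.1 hA0]
    with η h2 h3
  have h4 : Config.glue Λ η ω ∉ Config.restrict Λ ⁻¹' A := by
    rw [Set.mem_preimage, Config.restrict_glue, h2]; exact h3
  simp [Set.indicator_of_notMem h4]

/-- The Boltzmann weight is strictly positive, so one boundary condition with a nonzero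
normalization suffices. Such an ω exists, since otherwise the DLR equation for the constant function
1 would give ν mass zero. -/
theorem IsInteraction.ac_marginal (hH : IsInteraction H) (hν : IsGibbs H ν) {Λ : Set (Space d)}
    (hb : Bornology.IsBounded Λ) (hm : MeasurableSet Λ) : poissonOn Λ ≪ marginal Λ ν := by
  have := hν.isProbabilityMeasure
  refine Measure.AbsolutelyContinuous.mk fun A hA hA0 => ?_
  have hA' : MeasurableSet (Config.restrict Λ ⁻¹' A) := Config.measurable_restrict hm hA
  have hi : Measurable ((Config.restrict Λ ⁻¹' A).indicator (1 : Config d → ℝ≥0∞)) :=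
    measurable_one.indicator hA'
  rw [marginal, Measure.map_apply (Config.measurable_restrict hm) hA,
    ← lintegral_indicator_one hA', hν.dlr Λ hb hm _ hi,
    lintegral_eq_zero_iff (hH.measurable_lintegral_finiteGibbs hb hm hi)] at hA0
  have hone := hν.dlr Λ hb hm 1 measurable_one
  have hex : ∃ ω, (partitionFn H Λ ω)⁻¹ ≠ 0 ∧ ∫⁻ η, (Config.restrict Λ ⁻¹' A).indicator 1
      (Config.glue Λ η ω) ∂finiteGibbs H Λ ω = 0 := by
    by_contra! hcon
    have : ∫⁻ ω, ∫⁻ η, (1 : Config d → ℝ≥0∞) (Config.glue Λ η ω) ∂finiteGibbs H Λ ω ∂ν = 0 := by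
      refine lintegral_eq_zero_of_ae_eq_zero ?_
      filter_upwards [hA0] with ω hω
      have hZ : (partitionFn H Λ ω)⁻¹ = 0 := by
        by_contra hZ
        exact hcon ω hZ hω
      simp [finiteGibbs, hZ]
    rw [this] at hone
    simp at hone
  obtain ⟨ω, hZ, hω⟩ := hex
  have h1 : Measurable fun η => (Config.restrict Λ ⁻¹' A).indicator (1 : Config d → ℝ≥0∞)
      (Config.glue Λ η ω) :=
    hi.comp ((Config.measurable_glue hm).comp measurable_prodMk_right)
  rw [hH.lintegral_finiteGibbs hb hm h1] at hω
  have h2 := (mul_eq_zero.1 hω).resolve_left hZ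
  have h0 : Measurable fun η => ENNReal.ofReal (Real.exp (-condEnergy H Λ (Config.glue Λ η ω))) *
      (Config.restrict Λ ⁻¹' A).indicator (1 : Config d → ℝ≥0∞) (Config.glue Λ η ω) :=
    ((hH.measurable_exp_condEnergy_glue hb hm).comp measurable_prodMk_right).mul h1
  rw [lintegral_eq_zero_iff h0] at h2
  rw [measure_eq_zero_iff_ae_notMem]
  filter_upwards [h2, ae_restrict_eq_poissonOn hb hm] with η h3 h4 h5
  have h6 : Config.glue Λ η ω ∈ Config.restrict Λ ⁻¹' A := by
    rw [Set.mem_preimage, Config.restrict_glue, h4]; exact h5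
  simp [Set.indicator_of_mem h6, (Real.exp_pos _).not_ge] at h3

/-- Detailed balance: the one-point energy is the increment of the conditional energy when the point
is put back. -/
theorem IsInteraction.exp_condEnergy_mul_birthRate (hH : IsInteraction H) {Λ : Set (Space d)}
    (hb : Bornology.IsBounded Λ) (hm : MeasurableSet Λ) {x : Space d} (hx : x ∈ Λ)
    (η : Config d) (hxη : x ∈ η.pts) (ω : Config d) :
    ENNReal.ofReal (Real.exp (-condEnergy H Λ (Config.glue Λ (η.del x) ω))) *
      ENNReal.ofReal (birthRate H x (Config.glue Λ (η.del x) ω)) =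
      ENNReal.ofReal (Real.exp (-condEnergy H Λ (Config.glue Λ η ω))) := by
  rw [← ENNReal.ofReal_mul (Real.exp_pos _).le, birthRate, ← Real.exp_add,
    hH.pointEnergy_eq hb hm hx, ← Config.glue_add hx, Config.add_del_of_mem hxη]
  congr 2; ring

/-- The Georgii-Nguyen-Zessin equation in finite volume, with boundary condition `ω`. -/
theorem IsInteraction.lintegral_poissonOn_gnz [NeZero d] (hH : IsInteraction H)
    {Λ : Set (Space d)} (hb : Bornology.IsBounded Λ) (hm : MeasurableSet Λ)
    {f : Space d × Config d → ℝ≥0∞} (hf : Measurable f) (ω : Config d) :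
    ∫⁻ η, ENNReal.ofReal (Real.exp (-condEnergy H Λ (Config.glue Λ η ω))) *
      ∫⁻ x, Λ.indicator (fun x => f (x, (Config.glue Λ η ω).del x)) x
        ∂(Config.glue Λ η ω).ptsMeasure ∂poissonOn Λ =
    ∫⁻ η, ENNReal.ofReal (Real.exp (-condEnergy H Λ (Config.glue Λ η ω))) *
      (∫⁻ x in Λ, ENNReal.ofReal (birthRate H x (Config.glue Λ η ω)) * f (x, Config.glue Λ η ω))
        ∂poissonOn Λ := by
  have hgl : Measurable fun η : Config d => Config.glue Λ η ω :=
    (Config.measurable_glue hm).comp measurable_prodMk_right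
  have hE : Measurable fun η => ENNReal.ofReal (Real.exp (-condEnergy H Λ (Config.glue Λ η ω))) :=
    ((hH.measurable_condEnergy hb hm).comp hgl).neg.exp.ennreal_ofReal
  have h1 : Measurable fun z : Space d × Config d => (z.1, Config.glue Λ z.2 ω) :=
    measurable_fst.prodMk (hgl.comp measurable_snd)
  obtain ⟨K, hK⟩ : ∃ K : Space d × Config d → ℝ≥0∞, K = fun z =>
      ENNReal.ofReal (Real.exp (-condEnergy H Λ (Config.glue Λ z.2 ω))) *
        (ENNReal.ofReal (birthRate H z.1 (Config.glue Λ z.2 ω)) * f (z.1, Config.glue Λ z.2 ω)) :=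
    ⟨_, rfl⟩
  have hKm : Measurable K := by
    have i1 : Measurable fun z : Space d × Config d =>
        ENNReal.ofReal (Real.exp (-condEnergy H Λ (Config.glue Λ z.2 ω))) := hE.comp measurable_snd
    have i2 : Measurable fun z : Space d × Config d =>
        ENNReal.ofReal (birthRate H z.1 (Config.glue Λ z.2 ω)) * f (z.1, Config.glue Λ z.2 ω) :=
      (hH.measurable_birthRate.comp h1).ennreal_ofReal.mul (hf.comp h1)
    rw [hK]
    exact i1.mul i2
  have hKi : Measurable ((Prod.fst ⁻¹' Λ).indicator K) := hKm.indicator (measurable_fst hm)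
  -- Detailed balance rewrites the weight of η in terms of η without x, the form to which the Mecke
  -- formula applies.
  have e1 : ∀ η : Config d, ENNReal.ofReal (Real.exp (-condEnergy H Λ (Config.glue Λ η ω))) *
      ∫⁻ x, Λ.indicator (fun x => f (x, (Config.glue Λ η ω).del x)) x
        ∂(Config.glue Λ η ω).ptsMeasure =
      ∫⁻ x, (Prod.fst ⁻¹' Λ).indicator K (x, η.del x) ∂η.ptsMeasure := by
    intro η
    rw [Config.lintegral_ptsMeasure_glue, ← lintegral_const_mul' _ _ ENNReal.ofReal_ne_top,
      Config.lintegral_ptsMeasure, Config.lintegral_ptsMeasure]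
    refine tsum_congr fun x => ?_
    by_cases hx : (x : Space d) ∈ Λ
    · rw [Set.indicator_of_mem hx, Set.indicator_of_mem (by exact hx), Config.glue_del hx, hK,
        ← hH.exp_condEnergy_mul_birthRate hb hm hx η x.2 ω, mul_assoc]
    · rw [Set.indicator_of_notMem hx, Set.indicator_of_notMem (by exact hx), mul_zero]
  simp_rw [e1]
  rw [lintegral_poissonOn_mecke hb hKi, lintegral_lintegral_swap
    (f := fun x η => (Prod.fst ⁻¹' Λ).indicator K (x, η)) hKi.aemeasurable]
  refine lintegral_congr fun η => ?_
  have h2 : Measurable fun x =>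
      ENNReal.ofReal (birthRate H x (Config.glue Λ η ω)) * f (x, Config.glue Λ η ω) :=
    (hH.measurable_birthRate.comp measurable_prodMk_right).ennreal_ofReal.mul
      (hf.comp measurable_prodMk_right)
  rw [← lintegral_const_mul _ h2]
  refine setLIntegral_congr_fun hm fun x hx => ?_
  rw [Set.indicator_of_mem (by exact hx), hK]

/-- The Georgii-Nguyen-Zessin equation. -/
theorem IsInteraction.campbell_restrict [NeZero d] (hH : IsInteraction H) (hν : IsGibbs H ν)
    {Λ : Set (Space d)} (hb : Bornology.IsBounded Λ) (hm : MeasurableSet Λ) :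
    (campbell ν).restrict (Λ ×ˢ Set.univ) = ((volume.restrict Λ).prod ν).withDensity
      fun z => ENNReal.ofReal (birthRate H z.1 z.2) := by
  have := hν.isProbabilityMeasure
  have hbm : Measurable fun z : Space d × Config d => ENNReal.ofReal (birthRate H z.1 z.2) :=
    hH.measurable_birthRate.ennreal_ofReal
  refine Measure.ext_of_lintegral _ fun f hf => ?_
  have hbf : Measurable fun z : Space d × Config d =>
      ENNReal.ofReal (birthRate H z.1 z.2) * f z := hbm.mul hf
  have hfi : Measurable ((Λ ×ˢ Set.univ).indicator f) := hf.indicator (hm.prod MeasurableSet.univ)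
  have h1 : ∀ ζ : Config d, ∫⁻ x, (Λ ×ˢ Set.univ).indicator f (x, ζ.del x) ∂ζ.ptsMeasure =
      ∫⁻ x, Λ.indicator (fun x => f (x, ζ.del x)) x ∂ζ.ptsMeasure := by
    intro ζ
    refine lintegral_congr fun x => ?_
    by_cases hx : x ∈ Λ <;> simp [Set.indicator, hx]
  have hF1 : Measurable fun η : Config d =>
      ∫⁻ x, Λ.indicator (fun x => f (x, η.del x)) x ∂η.ptsMeasure := by
    simp_rw [← h1]
    exact Config.measurable_lintegral_ptsMeasure (f := fun w : Config d × Space d =>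
      (Λ ×ˢ Set.univ).indicator f (w.2, w.1.del w.2)) (hfi.comp measurable_snd_del) measurable_id
  have hF2 : Measurable fun η : Config d =>
      ∫⁻ x in Λ, ENNReal.ofReal (birthRate H x η) * f (x, η) := hbf.lintegral_prod_left'
  have h2 : ∫⁻ z, f z ∂((volume.restrict Λ).prod ν).withDensity
      (fun z => ENNReal.ofReal (birthRate H z.1 z.2)) =
      ∫⁻ η, (∫⁻ x in Λ, ENNReal.ofReal (birthRate H x η) * f (x, η)) ∂ν := by
    rw [lintegral_withDensity_eq_lintegral_mul _ hbm hf, ← lintegral_prod_symm' _ hbf]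
    rfl
  rw [← lintegral_indicator (hm.prod MeasurableSet.univ), lintegral_campbell hfi, h2]
  simp_rw [h1]
  -- Resampling inside Λ on both sides reduces the claim to the finite-volume equation for each ω.
  rw [hν.dlr Λ hb hm _ hF1, hν.dlr Λ hb hm _ hF2]
  refine lintegral_congr fun ω => ?_
  have hgl : Measurable fun η : Config d => Config.glue Λ η ω :=
    (Config.measurable_glue hm).comp measurable_prodMk_right
  have g1 := hH.lintegral_finiteGibbs hb hm (hF1.comp hgl) ω
  have g2 := hH.lintegral_finiteGibbs hb hm (hF2.comp hgl) ω
  simp only [Function.comp] at g1 g2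
  rw [g1, g2, hH.lintegral_poissonOn_gnz hb hm hf ω]

end Gibbs

end

section

variable {d : ℕ}

/-! ### Boundary layers of boxes -/

section BoxBoundary

theorem volume_box_lt_top (d n : ℕ) : volume (box d n) < ∞ := (isBounded_box d n).measure_lt_top

instance (n : ℕ) : IsFiniteMeasure (volume.restrict (box d n)) :=
  ⟨by rw [Measure.restrict_apply_univ]; exact volume_box_lt_top d n⟩

theorem toReal_volume_box (d n : ℕ) : (volume (box d n)).toReal = (n : ℝ) ^ d := by
  rw [volume_box]; simp

theorem toReal_volume_box_sdiff {m n : ℕ} (h : m ≤ n) :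
    (volume (box d n \ box d m)).toReal = (n : ℝ) ^ d - (m : ℝ) ^ d := by
  rw [measure_sdiff (box_mono d h) (measurableSet_box d m).nullMeasurableSet
    (volume_box_lt_top d m).ne, ENNReal.toReal_sub_of_le (measure_mono (box_mono d h))
    (volume_box_lt_top d n).ne, toReal_volume_box, toReal_volume_box]

/-- Boundary layers of boxes have asymptotically negligible volume. -/
theorem tendsto_volume_box_boundary (d k m : ℕ) :
    Tendsto (fun n : ℕ => (volume (box d n)).toReal⁻¹ *
      (volume (box d (n + k) \ box d (n - m))).toReal) atTop (𝓝 0) := by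
  have h1 : Tendsto (fun n : ℕ => (((n : ℝ) + k) / n) ^ d) atTop (𝓝 (1 ^ d)) := by
    refine Tendsto.pow ?_ d
    have := (tendsto_const_div_atTop_nhds_zero_nat (k : ℝ)).const_add 1
    rw [add_zero] at this
    refine this.congr' ?_
    filter_upwards [eventually_gt_atTop 0] with n hn
    have : (n : ℝ) ≠ 0 := by positivity
    field_simp
  have h2 : Tendsto (fun n : ℕ => (((n : ℝ) - m) / n) ^ d) atTop (𝓝 (1 ^ d)) := by
    refine Tendsto.pow ?_ d
    have := (tendsto_const_div_atTop_nhds_zero_nat (m : ℝ)).const_sub 1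
    rw [sub_zero] at this
    refine this.congr' ?_
    filter_upwards [eventually_gt_atTop 0] with n hn
    have : (n : ℝ) ≠ 0 := by positivity
    field_simp
  have h3 := h1.sub h2
  rw [sub_self] at h3
  refine h3.congr' ?_
  filter_upwards [eventually_gt_atTop 0, eventually_ge_atTop m] with n hn hm
  rw [toReal_volume_box, toReal_volume_box_sdiff (by omega), Nat.cast_sub hm, div_pow, div_pow]
  push_cast
  ring

theorem tendsto_enorm_volume_box_boundary (d k m : ℕ) :
    Tendsto (fun n : ℕ => ‖(volume (box d n)).toReal⁻¹‖ₑ *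
      volume (box d (n + k) \ box d (n - m))) atTop (𝓝 0) := by
  have h := ENNReal.tendsto_ofReal (tendsto_volume_box_boundary d k m)
  rw [ENNReal.ofReal_zero] at h
  refine h.congr fun n => ?_
  rw [ENNReal.ofReal_mul (by positivity), ENNReal.ofReal_toReal, Real.enorm_of_nonneg (by positivity)]
  exact (((isBounded_box d (n + k)).subset Set.sdiff_subset).measure_lt_top).ne

theorem enorm_volume_box_mul_le (n : ℕ) :
    ‖(volume (box d n)).toReal⁻¹‖ₑ * volume (box d n) ≤ 1 := by
  rw [← ENNReal.ofReal_toReal (volume_box_lt_top d n).ne, ENNReal.toReal_ofReal (by positivity),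
    Real.enorm_of_nonneg (by positivity), ← ENNReal.ofReal_mul (by positivity),
    ENNReal.ofReal_le_one]
  exact inv_mul_le_one

/-- Lowering the side length by m moves each face by only m/2, hence the factor 2. If m > n the
truncated difference is 0 and the inner box is empty; this needs positive dimension. -/
theorem sub_mem_box [NeZero d] {m n : ℕ} {x y : Space d} (hy : 2 * ‖y‖ ≤ m)
    (hx : x ∈ box d (n - m)) : x - y ∈ box d n := by
  have hnm : m ≤ n := by
    by_contra h
    have h0 := hx 0
    rw [Nat.sub_eq_zero_of_le (by omega)] at h0
    simp at h0
  intro i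
  have h1 := hx i
  rw [Nat.cast_sub hnm] at h1
  have h2 : |y i| ≤ ‖y‖ := by simpa using PiLp.norm_apply_le y i
  have h3 := abs_le.1 h2
  have h4 : (x - y) i = x i - y i := by simp
  rw [h4]
  constructor
  · linarith [h1.1]
  · linarith [h1.2]

end BoxBoundary

/-! ### Invariant sets, box averages and coboundaries -/

section Ergodic

variable {μ : Measure (Config d)}

theorem invariantSets_le : invariantSets d ≤ Config.instMeasurableSpace :=
  (iInf_le _ 0).trans (MeasurableSpace.invariants_le _)

theorem measurableSet_invariantSets_iff {A : Set (Config d)} :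
    MeasurableSet[invariantSets d] A ↔ MeasurableSet A ∧ ∀ x, Config.shift x ⁻¹' A = A := by
  rw [invariantSets, MeasurableSpace.measurableSet_iInf]
  exact ⟨fun h => ⟨(h 0).1, fun x => (h x).2⟩, fun h x => ⟨h.1, h.2 x⟩⟩

theorem measurable_invariantSets {g : Config d → ℝ} (hg : Measurable g)
    (h : ∀ x η, g (Config.shift x η) = g η) : Measurable[invariantSets d] g := by
  intro s hs
  rw [measurableSet_invariantSets_iff]
  refine ⟨hg hs, fun x => ?_⟩
  ext η
  simp [h]

theorem measurePreserving_shift (hμθ : IsShiftInvariant μ) (x : Space d) :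
    MeasurePreserving (Config.shift x) μ μ := ⟨Config.measurable_shift x, hμθ x⟩

theorem measurePreserving_centerAt [SFinite μ] (hμθ : IsShiftInvariant μ)
    (κ : Measure (Space d)) [SFinite κ] : MeasurePreserving centerAt (κ.prod μ) (κ.prod μ) :=
  (MeasurePreserving.id κ).skew_product (g := fun x η => Config.shift x η)
    Config.measurable_shift_prod (ae_of_all _ fun x => hμθ x)

theorem lintegral_setLIntegral_shift [SFinite μ] (hμθ : IsShiftInvariant μ) (B : Set (Space d))
    {f : Config d → ℝ≥0∞} (hf : Measurable f) :
    ∫⁻ η, (∫⁻ x in B, f (η.shift x)) ∂μ = volume B * ∫⁻ η, f η ∂μ := by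
  rw [lintegral_lintegral_swap (f := fun η x => f (Config.shift x η))]
  · have : ∀ x, ∫⁻ η, f (Config.shift x η) ∂μ = ∫⁻ η, f η ∂μ := fun x => by
      rw [← lintegral_map hf (Config.measurable_shift x), hμθ x]
    simp_rw [this]
    rw [setLIntegral_const, mul_comm]
  · exact (hf.comp (Config.measurable_shift_prod.comp
      (measurable_snd.prodMk measurable_fst))).aemeasurable

theorem ae_integrableOn_shift [IsFiniteMeasure μ] (hμθ : IsShiftInvariant μ) {f : Config d → ℝ}
    (hf : Integrable f μ) {B : Set (Space d)} (hB : volume B < ∞) :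
    ∀ᵐ η ∂μ, IntegrableOn (fun x => f (η.shift x)) B := by
  have : IsFiniteMeasure (volume.restrict B) := ⟨by rwa [Measure.restrict_apply_univ]⟩
  have h := (measurePreserving_centerAt hμθ (volume.restrict B)).integrable_comp_of_integrable
    (hf.comp_snd (volume.restrict B))
  exact h.prod_left_ae

/-- The spatial average of a function over a box. -/
noncomputable def boxAverage (n : ℕ) (f : Config d → ℝ) (η : Config d) : ℝ :=
  (volume (box d n)).toReal⁻¹ * ∫ x in box d n, f (η.shift x)

theorem measurable_boxAverage (n : ℕ) {f : Config d → ℝ} (hf : Measurable f) :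
    Measurable (boxAverage n f) := by
  refine Measurable.const_mul ?_ _
  have h : StronglyMeasurable fun z : Config d × Space d => f (z.1.shift z.2) :=
    (hf.comp (Config.measurable_shift_prod.comp
      (measurable_snd.prodMk measurable_fst))).stronglyMeasurable
  exact h.integral_prod_right'.measurable

/-- Each translate has the same L¹ norm by stationarity. The inequality also covers an average over
a box of volume zero. -/
theorem eLpNorm_boxAverage_le [SFinite μ] (hμθ : IsShiftInvariant μ) (n : ℕ) {f : Config d → ℝ}
    (hf : Measurable f) : eLpNorm (boxAverage n f) 1 μ ≤ eLpNorm f 1 μ := by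
  rw [eLpNorm_one_eq_lintegral_enorm, eLpNorm_one_eq_lintegral_enorm]
  calc ∫⁻ η, ‖boxAverage n f η‖ₑ ∂μ
      ≤ ∫⁻ η, ‖(volume (box d n)).toReal⁻¹‖ₑ * (∫⁻ x in box d n, ‖f (η.shift x)‖ₑ) ∂μ := by
        refine lintegral_mono fun η => ?_
        rw [boxAverage, enorm_mul]
        gcongr
        exact enorm_integral_le_lintegral_enorm _
    _ = ‖(volume (box d n)).toReal⁻¹‖ₑ * (volume (box d n) * ∫⁻ η, ‖f η‖ₑ ∂μ) := by
        rw [lintegral_const_mul' _ _ enorm_ne_top, lintegral_setLIntegral_shift hμθ _ hf.enorm]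
    _ ≤ 1 * ∫⁻ η, ‖f η‖ₑ ∂μ := by
        rw [← mul_assoc]
        gcongr
        exact enorm_volume_box_mul_le n
    _ = _ := one_mul _

theorem boxAverage_add_mul [IsFiniteMeasure μ] (hμθ : IsShiftInvariant μ) (n : ℕ)
    {f g : Config d → ℝ} (hf : Integrable f μ) (hg : Integrable g μ) (c : ℝ) :
    boxAverage n (fun η => f η + c * g η) =ᵐ[μ]
      fun η => boxAverage n f η + c * boxAverage n g η := by
  filter_upwards [ae_integrableOn_shift hμθ hf (volume_box_lt_top d n),
    ae_integrableOn_shift hμθ hg (volume_box_lt_top d n)] with η h1 h2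
  simp only [boxAverage]
  rw [integral_add h1 (h2.const_mul c), integral_const_mul]
  ring

/-- The box and its translate both contain the smaller box; the integrals over it cancel, leaving
two boundary layers. -/
theorem enorm_boxAverage_shift_sub_le [NeZero d] {m : ℕ} {y : Space d} (hy : 2 * ‖y‖ ≤ m)
    (n : ℕ) (f : Config d → ℝ) {η : Config d}
    (h1 : IntegrableOn (fun x => f (η.shift x)) (box d n))
    (h2 : IntegrableOn (fun x => f (η.shift x)) ((fun x => x - y) ⁻¹' box d n)) :
    ‖boxAverage n f (η.shift y) - boxAverage n f η‖ₑ ≤ ‖(volume (box d n)).toReal⁻¹‖ₑ *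
      ((∫⁻ x in ((fun x => x - y) ⁻¹' box d n) \ box d (n - m), ‖f (η.shift x)‖ₑ) +
        ∫⁻ x in box d n \ box d (n - m), ‖f (η.shift x)‖ₑ) := by
  have hs1 : box d (n - m) ⊆ (fun x => x - y) ⁻¹' box d n := fun x hx => sub_mem_box hy hx
  have hs2 : box d (n - m) ⊆ box d n := box_mono d (Nat.sub_le n m)
  have e1 : ∫ x in box d n, f ((η.shift y).shift x) =
      ∫ x in (fun x => x - y) ⁻¹' box d n, f (η.shift x) := by
    have := (measurePreserving_add_right volume y).setIntegral_preimage_emb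
      (MeasurableEquiv.addRight y).measurableEmbedding (fun x => f (η.shift x))
      ((fun x => x - y) ⁻¹' box d n)
    rw [← this]
    simp only [Config.shift_shift, Set.preimage_preimage, add_sub_cancel_right, Set.preimage_id']
  have e2 := setIntegral_sdiff (measurableSet_box d (n - m)) h2 hs1
  have e3 := setIntegral_sdiff (measurableSet_box d (n - m)) h1 hs2
  rw [boxAverage, boxAverage, e1, ← mul_sub, enorm_mul]
  gcongr
  rw [← sub_sub_sub_cancel_right _ _ (∫ x in box d (n - m), f (η.shift x)), ← e2, ← e3]
  refine (enorm_sub_le).trans ?_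
  exact add_le_add (enorm_integral_le_lintegral_enorm _) (enorm_integral_le_lintegral_enorm _)

theorem volume_preimage_sub_sdiff_box [NeZero d] {m n : ℕ} {y : Space d} (hy : 2 * ‖y‖ ≤ m) :
    volume (((fun x => x - y) ⁻¹' box d n) \ box d (n - m)) = volume (box d n \ box d (n - m)) := by
  have hs1 : box d (n - m) ⊆ (fun x => x - y) ⁻¹' box d n := fun x hx => sub_mem_box hy hx
  have hs2 : box d (n - m) ⊆ box d n := box_mono d (Nat.sub_le n m)
  rw [measure_sdiff hs1 (measurableSet_box d _).nullMeasurableSet (volume_box_lt_top d _).ne,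
    measure_sdiff hs2 (measurableSet_box d _).nullMeasurableSet (volume_box_lt_top d _).ne,
    (measurePreserving_sub_right volume y).measure_preimage
      (measurableSet_box d n).nullMeasurableSet]

/-- The average of a coboundary lives on boundary layers, whose volume is negligible; stationarity
converts volume into L¹ norm. -/
theorem tendsto_eLpNorm_boxAverage_coboundary [NeZero d] [IsFiniteMeasure μ]
    (hμθ : IsShiftInvariant μ) {f : Config d → ℝ} (hfm : Measurable f) (hf : Integrable f μ)
    (y : Space d) :
    Tendsto (fun n => eLpNorm (boxAverage n fun η => f (η.shift y) - f η) 1 μ) atTop (𝓝 0) := by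
  obtain ⟨m, hm⟩ := exists_nat_ge (2 * ‖y‖)
  have hfy : Integrable (fun η => f (Config.shift y η)) μ :=
    (measurePreserving_shift hμθ y).integrable_comp_of_integrable hf
  have hbound : ∀ n, eLpNorm (boxAverage n fun η => f (η.shift y) - f η) 1 μ ≤
      (‖(volume (box d n)).toReal⁻¹‖ₑ * volume (box d (n + 0) \ box d (n - m))) *
        (2 * ∫⁻ η, ‖f η‖ₑ ∂μ) := by
    intro n
    rw [eLpNorm_one_eq_lintegral_enorm]
    calc ∫⁻ η, ‖boxAverage n (fun η => f (η.shift y) - f η) η‖ₑ ∂μ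
        ≤ ∫⁻ η, ‖(volume (box d n)).toReal⁻¹‖ₑ *
          ((∫⁻ x in ((fun x => x - y) ⁻¹' box d n) \ box d (n - m), ‖f (η.shift x)‖ₑ) +
            ∫⁻ x in box d n \ box d (n - m), ‖f (η.shift x)‖ₑ) ∂μ := by
          refine lintegral_mono_ae ?_
          have hv : volume ((fun x => x - y) ⁻¹' box d n) < ∞ := by
            rw [(measurePreserving_sub_right volume y).measure_preimage
              (measurableSet_box d n).nullMeasurableSet]
            exact volume_box_lt_top d n
          filter_upwards [boxAverage_add_mul hμθ n hfy hf (-1),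
            ae_integrableOn_shift hμθ hf (volume_box_lt_top d n),
            ae_integrableOn_shift hμθ hf hv] with η h1 h2 h3
          have h4 : boxAverage n (fun η => f (η.shift y) - f η) η =
              boxAverage n f (η.shift y) - boxAverage n f η := by
            have h5 : boxAverage n (fun η => f (Config.shift y η)) η =
                boxAverage n f (η.shift y) := by
              simp only [boxAverage, Config.shift_shift, add_comm]
            rw [← h5, sub_eq_add_neg, ← neg_one_mul, ← h1]
            simp only [neg_one_mul, ← sub_eq_add_neg]
          rw [h4]
          exact enorm_boxAverage_shift_sub_le hm n f h2 h3
      _ = _ := by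
          have hmeas : Measurable fun z : Config d × Space d => ‖f (z.1.shift z.2)‖ₑ :=
            (hfm.comp (Config.measurable_shift_prod.comp
              (measurable_snd.prodMk measurable_fst))).enorm
          rw [lintegral_const_mul' _ _ enorm_ne_top, lintegral_add_left hmeas.lintegral_prod_right',
            lintegral_setLIntegral_shift hμθ _ hfm.enorm,
            lintegral_setLIntegral_shift hμθ _ hfm.enorm, volume_preimage_sub_sdiff_box hm, add_zero]
          ring
  have hlim := ENNReal.Tendsto.mul_const (b := 2 * ∫⁻ η, ‖f η‖ₑ ∂μ)
    (tendsto_enorm_volume_box_boundary d 0 m)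
    (Or.inr (ENNReal.mul_ne_top (by simp) hf.2.ne))
  rw [zero_mul] at hlim
  exact tendsto_of_tendsto_of_tendsto_of_le_of_le tendsto_const_nhds hlim (fun _ => zero_le)
    hbound

/-- An invariant set contains η and its translate simultaneously, so the shift can be moved onto the
measure. -/
theorem condExp_shift [IsFiniteMeasure μ] (hμθ : IsShiftInvariant μ) {f : Config d → ℝ}
    (hf : Integrable f μ) (y : Space d) :
    μ[fun η => f (Config.shift y η) | invariantSets d] =ᵐ[μ] μ[f | invariantSets d] := by
  have hfy : Integrable (fun η => f (Config.shift y η)) μ :=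
    (measurePreserving_shift hμθ y).integrable_comp_of_integrable hf
  refine ae_eq_condExp_of_forall_setIntegral_eq invariantSets_le hf
    (fun s _ _ => integrable_condExp.integrableOn) (fun s hs _ => ?_)
    stronglyMeasurable_condExp.aestronglyMeasurable
  rw [setIntegral_condExp invariantSets_le hfy hs]
  obtain ⟨hsm, hsi⟩ := measurableSet_invariantSets_iff.1 hs
  rw [← integral_indicator hsm, ← integral_indicator hsm]
  have h1 : (s.indicator fun η => f (Config.shift y η)) =
      fun η => s.indicator f (Config.shift y η) := by
    funext η
    have : Config.shift y η ∈ s ↔ η ∈ s := by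
      conv_rhs => rw [← hsi y]
      rfl
    by_cases h : η ∈ s
    · rw [Set.indicator_of_mem h, Set.indicator_of_mem (this.2 h)]
    · rw [Set.indicator_of_notMem h, Set.indicator_of_notMem (fun h' => h (this.1 h'))]
  rw [h1]
  conv_rhs => rw [← hμθ y]
  rw [integral_map (Config.measurable_shift y).aemeasurable]
  rw [hμθ y]
  exact hf.aestronglyMeasurable.indicator hsm

end Ergodic

end

section

variable {d : ℕ}

/-! ### The mean ergodic theorem for stationary point processes -/

section MeanErgodic

variable {μ : Measure (Config d)}

theorem ae_ae_shift_of_ae [SFinite μ] (hμθ : IsShiftInvariant μ) (κ : Measure (Space d)) [SFinite κ]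
    {p : Config d → Prop} (h : ∀ᵐ η ∂μ, p η) : ∀ᵐ η ∂μ, ∀ᵐ x ∂κ, p (Config.shift x η) := by
  have h1 : ∀ᵐ z ∂(κ.prod μ), p z.2 := Measure.quasiMeasurePreserving_snd.ae h
  have h2 := ((measurePreserving_centerAt hμθ κ).comp
    (Measure.measurePreserving_swap (μ := μ) (ν := κ))).quasiMeasurePreserving.ae h1
  exact Measure.ae_ae_of_ae_prod h2

theorem boxAverage_congr_ae [SFinite μ] (hμθ : IsShiftInvariant μ) (n : ℕ) {f g : Config d → ℝ}
    (h : f =ᵐ[μ] g) : boxAverage n f =ᵐ[μ] boxAverage n g := by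
  filter_upwards [ae_ae_shift_of_ae hμθ (volume.restrict (box d n)) h] with η hη
  rw [boxAverage, boxAverage, integral_congr_ae hη]

/-- An almost surely invariant function has a version measurable for the invariant sets. -/
theorem exists_invariant_version [SFinite μ] {f : Config d → ℝ}
    (hf : Measurable f) (h : ∀ y, (fun η => f (Config.shift y η)) =ᵐ[μ] f) :
    ∃ g : Config d → ℝ, Measurable[invariantSets d] g ∧ f =ᵐ[μ] g := by
  have hms : Measurable fun z : Config d × Space d => f (z.1.shift z.2) :=
    hf.comp (Config.measurable_shift_prod.comp (measurable_snd.prodMk measurable_fst))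
  -- The box of side 1 has volume one, so this average recovers the value whenever f is a.e.
  -- constant along the orbit of η.
  set g₀ : Config d → ℝ := boxAverage 1 f with hg₀
  have hg₀m : Measurable g₀ := measurable_boxAverage 1 hf
  have hconst : ∀ (η : Config d) (c : ℝ), (∀ᵐ x : Space d, f (η.shift x) = c) → g₀ η = c := by
    intro η c hc
    have h1 : ∫ x in box d 1, f (η.shift x) = ∫ _ in box d 1, c :=
      integral_congr_ae (ae_restrict_of_ae hc)
    have h2 : (volume (box d 1)).toReal = 1 := by rw [toReal_volume_box]; simp
    rw [hg₀, boxAverage, h1, setIntegral_const, Measure.real, h2]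
    simp
  -- The configurations along whose orbit f is a.e. constant. This set and the constant are
  -- invariant under every translation without exceptional null sets.
  set G : Set (Config d) := {η | ∀ᵐ x : Space d, f (η.shift x) = g₀ η} with hG
  have hGm : MeasurableSet G := by
    have hs : MeasurableSet {z : Config d × Space d | f (z.1.shift z.2) = g₀ z.1}ᶜ :=
      (measurableSet_eq_fun hms (hg₀m.comp measurable_fst)).compl
    exact measurable_measure_prodMk_left (ν := (volume : Measure (Space d))) hs
      (measurableSet_singleton 0)
  have hshift : ∀ y η, η ∈ G → Config.shift y η ∈ G ∧ g₀ (Config.shift y η) = g₀ η := by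
    intro y η hη
    have h1 : ∀ᵐ x : Space d, f ((Config.shift y η).shift x) = g₀ η := by
      have := (measurePreserving_add_right volume y).quasiMeasurePreserving.ae hη
      filter_upwards [this] with x hx
      rw [Config.shift_shift]
      exact hx
    have h2 := hconst _ _ h1
    refine ⟨?_, h2⟩
    change ∀ᵐ x : Space d, f ((Config.shift y η).shift x) = g₀ (Config.shift y η)
    rw [h2]
    exact h1
  refine ⟨G.indicator g₀, measurable_invariantSets (hg₀m.indicator hGm) fun y η => ?_, ?_⟩
  · by_cases hη : η ∈ G
    · rw [Set.indicator_of_mem hη, Set.indicator_of_mem (hshift y η hη).1, (hshift y η hη).2]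
    · rw [Set.indicator_of_notMem hη, Set.indicator_of_notMem]
      intro h'
      have := (hshift (-y) _ h').1
      rw [Config.shift_neg_shift] at this
      exact hη this
  · have hs : MeasurableSet {z : Config d × Space d | f (z.1.shift z.2) = f z.1} :=
      measurableSet_eq_fun hms (hf.comp measurable_fst)
    -- The exceptional μ-null set depends on x; Fubini exchanges the quantifiers.
    have h1 : ∀ᵐ η ∂μ, ∀ᵐ x : Space d, f (η.shift x) = f η :=
      (Measure.ae_ae_comm (p := fun (η : Config d) (x : Space d) => f (η.shift x) = f η) hs).2
        (ae_of_all _ fun x => h x)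
    filter_upwards [h1] with η hη
    have h2 := hconst η _ hη
    have h3 : η ∈ G := by
      change ∀ᵐ x : Space d, f (η.shift x) = g₀ η
      rw [h2]; exact hη
    rw [Set.indicator_of_mem h3, h2]

/-- The `L¹` distance between the average over a box and the conditional expectation. -/
noncomputable def ergodicError (μ : Measure (Config d)) (n : ℕ) (f : Config d → ℝ) : ℝ≥0∞ :=
  eLpNorm (fun η => boxAverage n f η - (μ[f | invariantSets d]) η) 1 μ

variable [IsProbabilityMeasure μ]

theorem ergodicError_congr_ae (hμθ : IsShiftInvariant μ) (n : ℕ) {f g : Config d → ℝ}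
    (h : f =ᵐ[μ] g) : ergodicError μ n f = ergodicError μ n g := by
  refine eLpNorm_congr_ae ?_
  filter_upwards [boxAverage_congr_ae hμθ n h, condExp_congr_ae (m := invariantSets d) h]
    with η h1 h2
  rw [h1, h2]

theorem ergodicError_le (hμθ : IsShiftInvariant μ) (n : ℕ) {f : Config d → ℝ}
    (hf : Measurable f) : ergodicError μ n f ≤ 2 * eLpNorm f 1 μ := by
  refine (eLpNorm_sub_le (measurable_boxAverage n hf).aestronglyMeasurable
    (stronglyMeasurable_condExp.mono invariantSets_le).aestronglyMeasurable le_rfl).trans ?_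
  rw [two_mul]
  exact add_le_add (eLpNorm_boxAverage_le hμθ n hf) (eLpNorm_condExp_le_eLpNorm f le_rfl)

theorem ergodicError_add_mul_le (hμθ : IsShiftInvariant μ) (n : ℕ) {f g : Config d → ℝ}
    (hfm : Measurable f) (hgm : Measurable g) (hf : Integrable f μ) (hg : Integrable g μ) (c : ℝ) :
    ergodicError μ n (fun η => f η + c * g η) ≤
      ergodicError μ n f + ‖c‖ₑ * ergodicError μ n g := by
  have h1 : (fun η => boxAverage n (fun η => f η + c * g η) η -
      (μ[fun η => f η + c * g η | invariantSets d]) η) =ᵐ[μ]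
      (fun η => boxAverage n f η - (μ[f | invariantSets d]) η) +
        c • fun η => boxAverage n g η - (μ[g | invariantSets d]) η := by
    have h2 : μ[fun η => f η + c * g η | invariantSets d] =ᵐ[μ]
        μ[f | invariantSets d] + μ[c • g | invariantSets d] :=
      condExp_add hf (hg.smul c) (invariantSets d)
    filter_upwards [boxAverage_add_mul hμθ n hf hg c, h2, condExp_smul c g (invariantSets d)]
      with η h3 h4 h5
    rw [h3, h4]
    simp only [Pi.add_apply, Pi.smul_apply, smul_eq_mul] at h5 ⊢
    rw [h5]
    ring
  have hm : ∀ f : Config d → ℝ, Measurable f → AEStronglyMeasurable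
      (fun η => boxAverage n f η - (μ[f | invariantSets d]) η) μ := fun f hf =>
    (measurable_boxAverage n hf).aestronglyMeasurable.sub
      (stronglyMeasurable_condExp.mono invariantSets_le).aestronglyMeasurable
  rw [ergodicError, eLpNorm_congr_ae h1]
  refine (eLpNorm_add_le (hm f hfm) ((hm g hgm).const_smul c) le_rfl).trans ?_
  rw [eLpNorm_const_smul]
  rfl

/-- Averaging and conditional expectation are both L¹ contractions, so an L¹ approximation costs at
most twice its distance, uniformly in n. -/
theorem tendsto_ergodicError_of_approx (hμθ : IsShiftInvariant μ) {f : Config d → ℝ}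
    (hfm : Measurable f) (hf : Integrable f μ)
    (h : ∀ ε : ℝ≥0∞, 0 < ε → ∃ g : Config d → ℝ, Measurable g ∧ Integrable g μ ∧
      Tendsto (fun n => ergodicError μ n g) atTop (𝓝 0) ∧ eLpNorm (f - g) 1 μ ≤ ε) :
    Tendsto (fun n => ergodicError μ n f) atTop (𝓝 0) := by
  rw [ENNReal.tendsto_nhds_zero]
  intro ε hε
  have hε4 : 0 < ε / 4 := ENNReal.div_pos hε.ne' (by simp)
  obtain ⟨g, hgm, hg, hlim, hfg⟩ := h (ε / 4) hε4
  rw [ENNReal.tendsto_nhds_zero] at hlim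
  filter_upwards [hlim (ε / 2) (ENNReal.div_pos hε.ne' (by simp))] with n hn
  have h1 := ergodicError_add_mul_le hμθ n hgm (hfm.sub hgm) hg (hf.sub hg) 1
  simp only [Pi.sub_apply, one_mul, add_sub_cancel, enorm_one] at h1
  calc ergodicError μ n f ≤ ergodicError μ n g + ergodicError μ n (f - g) := h1
    _ ≤ ε / 2 + 2 * (ε / 4) := by
        gcongr
        exact (ergodicError_le hμθ n (hfm.sub hgm)).trans (by gcongr)
    _ = ε := by
        have : 2 * (ε / 4) = ε / 2 := by
          rw [ENNReal.div_eq_inv_mul, ENNReal.div_eq_inv_mul, ← mul_assoc]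
          congr 1
          rw [show (4 : ℝ≥0∞) = 2 * 2 by norm_num,
            ENNReal.mul_inv (by simp) (by simp), ← mul_assoc,
            ENNReal.mul_inv_cancel (by simp) (by simp), one_mul]
        rw [this, ENNReal.add_halves]

/-- A coboundary has conditional expectation zero, so its error is the norm of its average. -/
theorem tendsto_ergodicError_coboundary [NeZero d] (hμθ : IsShiftInvariant μ) {f : Config d → ℝ}
    (hfm : Measurable f) (hf : Integrable f μ) (y : Space d) :
    Tendsto (fun n => ergodicError μ n fun η => f (η.shift y) - f η) atTop (𝓝 0) := by
  refine (tendsto_eLpNorm_boxAverage_coboundary hμθ hfm hf y).congr fun n => ?_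
  refine eLpNorm_congr_ae ?_
  have hfy : Integrable (fun η => f (Config.shift y η)) μ :=
    (measurePreserving_shift hμθ y).integrable_comp_of_integrable hf
  have h1 : μ[fun η => f (η.shift y) - f η | invariantSets d] =ᵐ[μ]
    μ[fun η => f (η.shift y) | invariantSets d] - μ[f | invariantSets d] :=
    condExp_sub hfy hf (invariantSets d)
  filter_upwards [h1, condExp_shift hμθ hf y] with η h2 h3
  rw [h2, Pi.sub_apply, h3]
  simp

/-- For an invariant function both the average and the conditional expectation return the function.
This starts at n = 1, the box with n = 0 having no volume to average over. -/
theorem tendsto_ergodicError_invariant (hμθ : IsShiftInvariant μ) {f : Config d → ℝ}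
    (hfm : Measurable f) (hf : Integrable f μ)
    (h : ∀ y, (fun η => f (Config.shift y η)) =ᵐ[μ] f) :
    Tendsto (fun n => ergodicError μ n f) atTop (𝓝 0) := by
  obtain ⟨g, hgm, hfg⟩ := exists_invariant_version hfm h
  have hge : μ[f | invariantSets d] =ᵐ[μ] f :=
    condExp_of_aestronglyMeasurable' invariantSets_le ⟨g, hgm.stronglyMeasurable, hfg⟩ hf
  have hinv : ∀ x η, g (Config.shift x η) = g η := by
    intro x η
    have h1 := (measurableSet_invariantSets_iff.1 (hgm (measurableSet_singleton (g η)))).2 x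
    have h2 : η ∈ Config.shift x ⁻¹' (g ⁻¹' {g η}) := by rw [h1]; rfl
    exact h2
  refine tendsto_const_nhds.congr' ?_
  filter_upwards [eventually_ge_atTop 1] with n hn
  symm
  rw [ergodicError, eLpNorm_eq_zero_iff _ one_ne_zero]
  · filter_upwards [boxAverage_congr_ae hμθ n hfg, hge, hfg] with η h1 h2 h3
    have hn' : (n : ℝ) ≠ 0 := by positivity
    rw [h1, h2, h3, boxAverage]
    simp only [hinv]
    rw [setIntegral_const, Measure.real, toReal_volume_box, smul_eq_mul, ← mul_assoc,
      inv_mul_cancel₀ (pow_ne_zero _ hn')]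
    simp
  · exact (measurable_boxAverage n hfm).aestronglyMeasurable.sub
      (stronglyMeasurable_condExp.mono invariantSets_le).aestronglyMeasurable

/-- The square-integrable functions satisfying the mean ergodic theorem. -/
noncomputable def ergodicSubmodule (μ : Measure (Config d)) [IsProbabilityMeasure μ]
    (hμθ : IsShiftInvariant μ) : Submodule ℝ (Lp ℝ 2 μ) where
  carrier := {F | Tendsto (fun n => ergodicError μ n F) atTop (𝓝 0)}
  add_mem' {F G} hF hG := by
    have hlim := Tendsto.add hF hG
    rw [add_zero] at hlim
    refine tendsto_of_tendsto_of_tendsto_of_le_of_le tendsto_const_nhds hlim (fun _ => zero_le)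
      fun n => ?_
    have h1 := ergodicError_add_mul_le hμθ n (Lp.stronglyMeasurable F).measurable
      (Lp.stronglyMeasurable G).measurable ((Lp.memLp F).integrable (by norm_num))
      ((Lp.memLp G).integrable (by norm_num)) 1
    simp only [one_mul, enorm_one] at h1
    rw [ergodicError_congr_ae hμθ n (Lp.coeFn_add F G)]
    exact h1
  zero_mem' := by
    refine tendsto_const_nhds.congr fun n => ?_
    rw [ergodicError_congr_ae hμθ n (Lp.coeFn_zero ℝ 2 μ), ergodicError]
    symm
    have : (0 : Config d → ℝ) = fun _ => 0 := rfl
    simp [boxAverage, this]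
  smul_mem' c F hF := by
    have hlim := ENNReal.Tendsto.const_mul (a := ‖c‖ₑ) hF (Or.inr enorm_ne_top)
    rw [mul_zero] at hlim
    refine tendsto_of_tendsto_of_tendsto_of_le_of_le tendsto_const_nhds hlim (fun _ => zero_le)
      fun n => ?_
    have h1 := ergodicError_add_mul_le hμθ n measurable_const
      (Lp.stronglyMeasurable F).measurable (integrable_const (0 : ℝ))
      ((Lp.memLp F).integrable (by norm_num)) c
    rw [ergodicError_congr_ae hμθ n (Lp.coeFn_smul c F)]
    have h0 : ergodicError μ n (fun _ => 0) = 0 := by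
      rw [ergodicError]
      simp [boxAverage]
    rw [h0, zero_add] at h1
    simp only [zero_add] at h1
    exact h1

/-- Under a probability measure the L² norm dominates the L¹ norm, so L² limits are L¹
approximations. -/
theorem isClosed_ergodicSubmodule (hμθ : IsShiftInvariant μ) :
    IsClosed (ergodicSubmodule μ hμθ : Set (Lp ℝ 2 μ)) := by
  refine isClosed_of_closure_subset fun F hF => ?_
  refine tendsto_ergodicError_of_approx hμθ (Lp.stronglyMeasurable F).measurable
    ((Lp.memLp F).integrable (by norm_num)) fun ε hε => ?_
  obtain ⟨G, hG, hFG⟩ := EMetric.mem_closure_iff.1 hF ε hε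
  refine ⟨G, (Lp.stronglyMeasurable G).measurable, (Lp.memLp G).integrable (by norm_num), hG, ?_⟩
  rw [Lp.edist_def] at hFG
  exact (eLpNorm_le_eLpNorm_of_exponent_le (by norm_num)
    ((Lp.aestronglyMeasurable F).sub (Lp.aestronglyMeasurable G))).trans hFG.le

/-- Von Neumann's argument. If F is orthogonal to the submodule, it is orthogonal to its own
coboundary UF - F; together with ‖UF‖ = ‖F‖ this forces UF = F. Then F is invariant, hence lies in
the submodule and is orthogonal to itself. -/
theorem ergodicSubmodule_eq_top [NeZero d] (hμθ : IsShiftInvariant μ) :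
    ergodicSubmodule μ hμθ = ⊤ := by
  have : CompleteSpace (ergodicSubmodule μ hμθ) :=
    (isClosed_ergodicSubmodule hμθ).completeSpace_coe
  rw [← Submodule.orthogonal_eq_bot_iff, eq_bot_iff]
  intro F hF
  have hFi : Integrable F μ := (Lp.memLp F).integrable (by norm_num)
  have hFm : Measurable F := (Lp.stronglyMeasurable F).measurable
  have hinv : ∀ y, (fun η => F (Config.shift y η)) =ᵐ[μ] F := by
    intro y
    set U := Lp.compMeasurePreserving (E := ℝ) (p := 2) (Config.shift y)
      (measurePreserving_shift hμθ y) F with hU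
    have hUF : U =ᵐ[μ] fun η => F (Config.shift y η) :=
      Lp.coeFn_compMeasurePreserving F (measurePreserving_shift hμθ y)
    have hmem : U - F ∈ ergodicSubmodule μ hμθ := by
      refine (tendsto_ergodicError_coboundary hμθ hFm hFi y).congr fun n => ?_
      refine ergodicError_congr_ae hμθ n ?_
      filter_upwards [Lp.coeFn_sub U F, hUF] with η h1 h2
      rw [h1, Pi.sub_apply, h2]
    have h0 := Submodule.inner_right_of_mem_orthogonal hmem hF
    have hnorm : ‖U‖ = ‖F‖ := Lp.norm_compMeasurePreserving F _
    have h1 : ‖U - F‖ = 0 := by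
      rw [inner_sub_left, real_inner_self_eq_norm_sq] at h0
      have := norm_sub_sq_real U F
      rw [hnorm] at this
      have h2 : ‖U - F‖ ^ 2 = 0 := by linarith
      exact pow_eq_zero_iff two_ne_zero |>.1 h2
    have h2 : U = F := sub_eq_zero.1 (norm_eq_zero.1 h1)
    rw [h2] at hUF
    exact hUF.symm
  have hFmem : F ∈ ergodicSubmodule μ hμθ := tendsto_ergodicError_invariant hμθ hFm hFi hinv
  have h0 := Submodule.inner_right_of_mem_orthogonal hFmem hF
  rw [Submodule.mem_bot]
  exact inner_self_eq_zero.1 h0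

/-- The mean ergodic theorem for averages over boxes. -/
theorem tendsto_ergodicError [NeZero d] (hμθ : IsShiftInvariant μ) {f : Config d → ℝ}
    (hfm : Measurable f) (hf : Integrable f μ) :
    Tendsto (fun n => ergodicError μ n f) atTop (𝓝 0) := by
  refine tendsto_ergodicError_of_approx hμθ hfm hf fun ε hε => ?_
  -- Simple functions are dense in L¹ and belong to L², where the theorem is already known.
  obtain ⟨g, hg, hgm⟩ := (memLp_one_iff_integrable.2 hf).exists_simpleFunc_eLpNorm_sub_lt
    (by simp) hε.ne'
  have hg2 : MemLp g 2 μ := g.memLp_of_isFiniteMeasure 2 μ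
  refine ⟨g, g.measurable, memLp_one_iff_integrable.1 hgm, ?_, hg.le⟩
  have h1 : hg2.toLp g ∈ ergodicSubmodule μ hμθ := by
    rw [ergodicSubmodule_eq_top]; trivial
  refine Tendsto.congr (fun n => ?_) h1
  exact ergodicError_congr_ae hμθ n hg2.coeFn_toLp

end MeanErgodic

end

section

variable {d : ℕ}

/-! ### The mean ergodic theorem for sums over the points -/

section PalmErgodic

theorem Config.integrableOn_ptsMeasure (η : Config d) {B : Set (Space d)}
    (hB : Bornology.IsBounded B) (hBm : MeasurableSet B) {f : Space d → ℝ} (hf : Measurable f) :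
    IntegrableOn f B η.ptsMeasure := by
  refine ⟨hf.aestronglyMeasurable, ?_⟩
  rw [HasFiniteIntegral, ← lintegral_indicator hBm, lintegral_ptsMeasure_eq_tsum_indicator,
    Set.indicator_indicator, ← tsum_subtype]
  have : Finite (η.pts ∩ B : Set (Space d)) := η.locallyFinite B hB
  have := Fintype.ofFinite (η.pts ∩ B : Set (Space d))
  rw [tsum_fintype]
  exact ENNReal.sum_lt_top.2 fun x _ => enorm_lt_top

theorem Config.measurable_shift_right (η : Config d) :
    Measurable fun x : Space d => η.shift x :=
  Config.measurable_shift_prod.comp (measurable_id.prodMk measurable_const)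

theorem measurable_shift_swap :
    Measurable fun z : Config d × Space d => z.1.shift z.2 :=
  Config.measurable_shift_prod.comp (measurable_snd.prodMk measurable_fst)

variable {μ : Measure (Config d)}

theorem IsPalm.setLIntegral_shift {μ₀ : Measure (Config d)} (h : IsPalm μ μ₀)
    {B : Set (Space d)} (hB : MeasurableSet B) {f : Config d → ℝ≥0∞} (hf : Measurable f) :
    ∫⁻ η, (∫⁻ x in B, f (η.shift x) ∂η.ptsMeasure) ∂μ = volume B * ∫⁻ ζ, f ζ ∂μ₀ := by
  have hi : Measurable (B.indicator (1 : Space d → ℝ≥0∞)) := measurable_one.indicator hB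
  have h1 := h (fun z => B.indicator 1 z.1 * f z.2)
    ((hi.comp measurable_fst).mul (hf.comp measurable_snd))
  simp_rw [fun η : Config d => (Config.lintegral_ptsMeasure η
    fun x => B.indicator 1 x * f (η.shift x)).symm, fun x => lintegral_const_mul
      (μ := μ₀) (B.indicator (1 : Space d → ℝ≥0∞) x) hf] at h1
  rw [lintegral_mul_const _ hi, lintegral_indicator_one hB] at h1
  rw [← h1]
  refine lintegral_congr fun η => ?_
  rw [← lintegral_indicator hB]
  refine lintegral_congr fun x => ?_
  by_cases hx : x ∈ B <;> simp [hx]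

/-- The Campbell formula on the unit box, of volume one, determines the Palm measure; integrals
against it become iterated integrals over μ and the points. -/
theorem IsPalm.eq_map_compProd [SFinite μ] {μ₀ : Measure (Config d)} (h : IsPalm μ μ₀) :
    μ₀ = (μ ⊗ₘ (Config.ptsKernel d).restrict (measurableSet_box d 1)).map
      fun z => z.1.shift z.2 := by
  refine Measure.ext_of_lintegral _ fun f hf => ?_
  have hm : Measurable fun z : Config d × Space d => f (z.1.shift z.2) :=
    hf.comp measurable_shift_swap
  rw [lintegral_map hf measurable_shift_swap, Measure.lintegral_compProd hm]
  simp only [Kernel.restrict_apply, Config.ptsKernel_apply]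
  rw [h.setLIntegral_shift (measurableSet_box d 1) hf, volume_box]
  simp

/-- The sum of `ψ (θ_x η)` over the points `x` of `η` in the unit box. -/
noncomputable def unitBoxSum (ψ : Config d → ℝ) (η : Config d) : ℝ :=
  ∫ x in box d 1, ψ (η.shift x) ∂η.ptsMeasure

theorem measurable_setIntegral_ptsMeasure {f : Config d × Space d → ℝ} (hf : Measurable f)
    {B : Set (Space d)} (hB : MeasurableSet B) :
    Measurable fun η : Config d => ∫ x in B, f (η, x) ∂η.ptsMeasure := by
  have := hf.stronglyMeasurable.integral_kernel_prod_right' (κ := (Config.ptsKernel d).restrict hB)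
  simpa [Kernel.restrict_apply] using this.measurable

theorem measurable_unitBoxSum {ψ : Config d → ℝ} (hψ : Measurable ψ) :
    Measurable (unitBoxSum ψ) :=
  measurable_setIntegral_ptsMeasure (f := fun z => ψ (z.1.shift z.2))
    (hψ.comp measurable_shift_swap) (measurableSet_box d 1)

theorem IsPalm.integrable_shift [SFinite μ] {μ₀ : Measure (Config d)} (h : IsPalm μ μ₀)
    {ψ : Config d → ℝ} (hψi : Integrable ψ μ₀) :
    Integrable (fun z : Config d × Space d => ψ (z.1.shift z.2))
      (μ ⊗ₘ (Config.ptsKernel d).restrict (measurableSet_box d 1)) := by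
  rw [h.eq_map_compProd] at hψi
  exact hψi.comp_measurable measurable_shift_swap

theorem IsPalm.integrable_unitBoxSum [SFinite μ] {μ₀ : Measure (Config d)} (h : IsPalm μ μ₀)
    {ψ : Config d → ℝ} (hψi : Integrable ψ μ₀) : Integrable (unitBoxSum ψ) μ := by
  have h1 := h.integrable_shift hψi
  rw [Measure.compProd] at h1
  have h2 := h1.integral_compProd
  simp only [Kernel.prodMkLeft_apply, Kernel.restrict_apply, Config.ptsKernel_apply,
    Kernel.const_apply] at h2
  exact h2

/-- For an invariant set, membership of the configuration seen from x is membership of η, so the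
indicator leaves the sum over points. -/
theorem IsPalm.setIntegral_unitBoxSum [SFinite μ] {μ₀ : Measure (Config d)} (h : IsPalm μ μ₀)
    {ψ : Config d → ℝ} (hψi : Integrable ψ μ₀) {A : Set (Config d)}
    (hA : MeasurableSet[invariantSets d] A) :
    ∫ η in A, unitBoxSum ψ η ∂μ = ∫ ζ in A, ψ ζ ∂μ₀ := by
  obtain ⟨hAm, hAi⟩ := measurableSet_invariantSets_iff.1 hA
  have hψA : Integrable (A.indicator ψ) μ₀ := hψi.indicator hAm
  have h1 := Measure.integral_compProd (h.integrable_shift hψA)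
  rw [← integral_indicator hAm, ← integral_indicator hAm]
  conv_rhs => rw [h.eq_map_compProd]
  rw [integral_map measurable_shift_swap.aemeasurable
    (by rw [← h.eq_map_compProd]; exact hψA.aestronglyMeasurable), h1]
  refine integral_congr_ae (ae_of_all _ fun η => ?_)
  have hmem : ∀ x, Config.shift x η ∈ A ↔ η ∈ A := fun x => by
    conv_rhs => rw [← hAi x]
    rfl
  simp only [Kernel.restrict_apply, Config.ptsKernel_apply]
  by_cases hη : η ∈ A
  · rw [Set.indicator_of_mem hη, unitBoxSum]
    refine integral_congr_ae (ae_of_all _ fun x => ?_)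
    simp only
    rw [Set.indicator_of_mem ((hmem x).2 hη)]
  · rw [Set.indicator_of_notMem hη]
    symm
    refine integral_eq_zero_of_ae (ae_of_all _ fun x => ?_)
    simp only
    rw [Set.indicator_of_notMem fun h' => hη ((hmem x).1 h')]
    rfl

theorem sub_mem_box_of_mem_pred {n : ℕ} (hn : 1 ≤ n) {z u : Space d} (hz : z ∈ box d (n - 1))
    (hu : u ∈ box d 1) : z - u ∈ box d n := by
  intro i
  have h1 := hz i
  have h2 := hu i
  rw [Nat.cast_sub hn] at h1
  push_cast at h1 h2
  have h4 : (z - u) i = z i - u i := by simp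
  rw [h4]
  constructor
  · linarith [h1.1, h2.2]
  · linarith [h1.2, h2.1]

theorem mem_box_succ_of_sub_mem {n : ℕ} {z y : Space d} (hy : y ∈ box d n)
    (hz : z - y ∈ box d 1) : z ∈ box d (n + 1) := by
  intro i
  have h1 := hy i
  have h2 := hz i
  have h4 : (z - y) i = z i - y i := by simp
  rw [h4] at h2
  push_cast at h2 ⊢
  constructor
  · linarith [h1.1, h2.1]
  · linarith [h1.2, h2.2]

/-- The overlap of the unit box around `z` with a box. -/
noncomputable def overlap (n : ℕ) (z : Space d) : ℝ :=
  ∫ y in box d n, (box d 1).indicator (fun _ => (1 : ℝ)) (z - y)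

theorem integral_indicator_box_sub (z : Space d) :
    ∫ y, (box d 1).indicator (fun _ => (1 : ℝ)) (z - y) = 1 := by
  rw [integral_sub_left_eq_self (fun y => (box d 1).indicator (fun _ => (1 : ℝ)) y),
    integral_indicator_const _ (measurableSet_box d 1), Measure.real, toReal_volume_box]
  simp

theorem integrable_indicator_box_sub (z : Space d) :
    Integrable fun y => (box d 1).indicator (fun _ => (1 : ℝ)) (z - y) := by
  by_contra h
  have h1 := integral_indicator_box_sub z
  rw [integral_undef h] at h1
  exact zero_ne_one h1

theorem overlap_nonneg (n : ℕ) (z : Space d) : 0 ≤ overlap n z :=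
  integral_nonneg fun _ => Set.indicator_nonneg (fun _ _ => zero_le_one) _

theorem overlap_le_one (n : ℕ) (z : Space d) : overlap n z ≤ 1 := by
  rw [← integral_indicator_box_sub z]
  exact setIntegral_le_integral (integrable_indicator_box_sub z)
    (ae_of_all _ fun y => Set.indicator_nonneg (fun _ _ => zero_le_one) _)

/-- Half a unit from the faces suffices for the unit box around z to fit, that is, one unit of side
length. -/
theorem overlap_eq_one {n : ℕ} (hn : 1 ≤ n) {z : Space d} (hz : z ∈ box d (n - 1)) :
    overlap n z = 1 := by
  rw [overlap, setIntegral_eq_integral_of_forall_compl_eq_zero, integral_indicator_box_sub]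
  intro y hy
  refine Set.indicator_of_notMem (fun h => hy ?_) _
  have := sub_mem_box_of_mem_pred hn hz h
  rwa [sub_sub_cancel] at this

theorem measurable_indicator_box_sub :
    Measurable fun w : Space d × Space d => (box d 1).indicator (fun _ => (1 : ℝ)) (w.1 - w.2) :=
  (measurable_const.indicator (measurableSet_box d 1)).comp (measurable_fst.sub measurable_snd)

theorem measurable_overlap (n : ℕ) : Measurable (overlap (d := d) n) :=
  measurable_indicator_box_sub.stronglyMeasurable.integral_prod_right'.measurable

theorem abs_overlap_sub_indicator_le (n : ℕ) (z : Space d) :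
    |overlap n z - (box d n).indicator (fun _ => (1 : ℝ)) z| ≤ 1 := by
  have h1 := overlap_nonneg n z
  have h2 := overlap_le_one n z
  have h3 : 0 ≤ (box d n).indicator (fun _ => (1 : ℝ)) z :=
    Set.indicator_nonneg (fun _ _ => zero_le_one) _
  have h4 : (box d n).indicator (fun _ => (1 : ℝ)) z ≤ 1 :=
    Set.indicator_le_self' (f := fun _ => (1 : ℝ)) (fun _ _ => zero_le_one) z
  rw [abs_le]
  constructor <;> linarith

/-- Exchange the integral over box positions with the sum over points: a point z is counted for the
volume of positions whose unit box contains it. Enlarging the side by 1 captures every point that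
can occur. -/
theorem setIntegral_unitBoxSum_shift {ψ : Config d → ℝ} (hψ : Measurable ψ) (n : ℕ)
    (η : Config d) : ∫ y in box d n, unitBoxSum ψ (η.shift y) =
      ∫ z in box d (n + 1), overlap n z * ψ (η.shift z) ∂η.ptsMeasure := by
  have hψη : Measurable fun z : Space d => ψ (η.shift z) := hψ.comp η.measurable_shift_right
  have hfin : IsFiniteMeasure (η.ptsMeasure.restrict (box d (n + 1))) := by
    refine ⟨?_⟩
    rw [Measure.restrict_apply_univ, Config.ptsMeasure_apply_of_isBounded _ (isBounded_box d _)
      (measurableSet_box d _)]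
    exact ENNReal.natCast_lt_top _
  have h1 : ∀ y ∈ box d n, unitBoxSum ψ (η.shift y) = ∫ z in box d (n + 1),
      (box d 1).indicator (fun _ => (1 : ℝ)) (z - y) * ψ (η.shift z) ∂η.ptsMeasure := by
    intro y hy
    have hmap : (η.shift y).ptsMeasure = η.ptsMeasure.map fun z => z - y := by
      refine Measure.ext_of_lintegral _ fun f hf => ?_
      rw [Config.lintegral_ptsMeasure_shift, lintegral_map hf (by fun_prop)]
    rw [unitBoxSum, hmap, ← integral_indicator (measurableSet_box d 1), integral_map (by fun_prop),
      setIntegral_eq_integral_of_forall_compl_eq_zero]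
    · refine integral_congr_ae (ae_of_all _ fun z => ?_)
      by_cases hz : z - y ∈ box d 1
      · simp [hz, Config.shift_shift]
      · simp [hz]
    · intro z hz
      rw [Set.indicator_of_notMem fun h => hz (mem_box_succ_of_sub_mem hy h), zero_mul]
    · exact ((hψ.comp (Config.measurable_shift_right _)).indicator
        (measurableSet_box d 1)).aestronglyMeasurable
  rw [setIntegral_congr_fun (measurableSet_box d n) h1, integral_integral_swap]
  · refine integral_congr_ae (ae_of_all _ fun z => ?_)
    simp only
    rw [integral_mul_const]
    rfl
  · have hint : Integrable (fun w : Space d × Space d => ψ (η.shift w.2))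
        ((volume.restrict (box d n)).prod (η.ptsMeasure.restrict (box d (n + 1)))) :=
      (η.integrableOn_ptsMeasure (isBounded_box d _) (measurableSet_box d _) hψη).comp_snd
        (volume.restrict (box d n))
    refine Integrable.bdd_mul (c := 1) hint ?_ (ae_of_all _ fun w => ?_)
    · exact (measurable_indicator_box_sub.comp
        (measurable_snd.prodMk measurable_fst)).aestronglyMeasurable
    · simp only [Set.indicator]
      split_ifs <;> simp

/-- The sharp sum and the smoothed one weight points differently only in a boundary layer of fixed
width, and there the weights differ by at most one. -/
theorem enorm_boxAverage_unitBoxSum_sub_le {ψ : Config d → ℝ} (hψ : Measurable ψ) {n : ℕ}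
    (hn : 1 ≤ n) (η : Config d) :
    ‖(volume (box d n)).toReal⁻¹ * (∫ z in box d n, ψ (η.shift z) ∂η.ptsMeasure) -
        boxAverage n (unitBoxSum ψ) η‖ₑ ≤
      ‖(volume (box d n)).toReal⁻¹‖ₑ *
        ∫⁻ z in box d (n + 1) \ box d (n - 1), ‖ψ (η.shift z)‖ₑ ∂η.ptsMeasure := by
  have hψη : Measurable fun z : Space d => ψ (η.shift z) := hψ.comp η.measurable_shift_right
  have hi : Measurable ((box d n).indicator fun _ => (1 : ℝ)) :=
    measurable_const.indicator (measurableSet_box d n)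
  rw [boxAverage, setIntegral_unitBoxSum_shift hψ, ← mul_sub, enorm_mul]
  gcongr
  have h1 : ∫ z in box d n, ψ (η.shift z) ∂η.ptsMeasure = ∫ z in box d (n + 1),
      (box d n).indicator (fun _ => (1 : ℝ)) z * ψ (η.shift z) ∂η.ptsMeasure := by
    symm
    rw [setIntegral_eq_integral_of_forall_compl_eq_zero, ← integral_indicator (measurableSet_box d n)]
    · refine integral_congr_ae (ae_of_all _ fun z => ?_)
      by_cases hz : z ∈ box d n <;> simp [hz]
    · intro z hz
      rw [Set.indicator_of_notMem fun h => hz (box_mono d (Nat.le_succ n) h), zero_mul]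
  rw [h1, enorm_sub_rev, ← integral_sub]
  · refine (enorm_integral_le_lintegral_enorm _).trans ?_
    rw [← lintegral_indicator (measurableSet_box d (n + 1)), ← lintegral_indicator
      ((measurableSet_box d (n + 1)).diff (measurableSet_box d (n - 1)))]
    refine lintegral_mono fun z => ?_
    by_cases hz : z ∈ box d (n + 1)
    · rw [Set.indicator_of_mem hz]
      by_cases hz' : z ∈ box d (n - 1)
      · rw [overlap_eq_one hn hz', Set.indicator_of_mem (box_mono d (Nat.sub_le n 1) hz')]
        simp
      · rw [Set.indicator_of_mem (Set.mem_sdiff_of_mem hz hz'), ← sub_mul, enorm_mul]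
        refine mul_le_of_le_one_left zero_le ?_
        rw [Real.enorm_eq_ofReal_abs]
        exact ENNReal.ofReal_le_one.2 (abs_overlap_sub_indicator_le n z)
    · rw [Set.indicator_of_notMem hz]
      exact zero_le
  · exact η.integrableOn_ptsMeasure (isBounded_box d _) (measurableSet_box d _)
      ((measurable_overlap n).mul hψη)
  · exact η.integrableOn_ptsMeasure (isBounded_box d _) (measurableSet_box d _) (hi.mul hψη)

/-- The mean ergodic theorem for Palm averages. -/
theorem exists_isPalmCondExp [NeZero d] [IsProbabilityMeasure μ] (hμθ : IsShiftInvariant μ)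
    (hμ1 : ∫⁻ η, (Config.count (unitCube d) η : ℝ≥0∞) ∂μ < ⊤) {ψ : Config d → ℝ}
    (hψ : Measurable ψ) (hψi : Integrable ψ (palm μ)) :
    ∃ Y : Config d → ℝ, IsPalmCondExp μ ψ Y ∧
      Tendsto (fun n => eLpNorm (fun η => (volume (box d n)).toReal⁻¹ *
        (∫ z in box d n, ψ (η.shift z) ∂η.ptsMeasure) - Y η) 1 μ) atTop (𝓝 0) := by
  have hP := isPalm_palm hμθ hμ1
  have hΦ := hP.integrable_unitBoxSum hψi
  have hΦm := measurable_unitBoxSum hψ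
  -- The ordinary ergodic theorem is applied to the sum over the unit box, whose conditional
  -- expectation serves as the Palm conditional expectation.
  refine ⟨μ[unitBoxSum ψ | invariantSets d], ⟨hψi, integrable_condExp,
    stronglyMeasurable_condExp.measurable, fun A hA => ?_⟩, ?_⟩
  · rw [setIntegral_condExp invariantSets_le hΦ hA]
    exact hP.setIntegral_unitBoxSum hψi hA
  · have hlim1 := ENNReal.Tendsto.mul_const (b := ∫⁻ ζ, ‖ψ ζ‖ₑ ∂(palm μ))
      (tendsto_enorm_volume_box_boundary d 1 1) (Or.inr hψi.2.ne)
    have hlim := hlim1.add (tendsto_ergodicError hμθ hΦm hΦ)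
    rw [zero_mul, zero_add] at hlim
    refine tendsto_of_tendsto_of_tendsto_of_le_of_le' tendsto_const_nhds hlim
      (Eventually.of_forall fun _ => zero_le) ?_
    filter_upwards [eventually_ge_atTop 1] with n hn
    have hm1 : Measurable fun η : Config d => (volume (box d n)).toReal⁻¹ *
        (∫ z in box d n, ψ (η.shift z) ∂η.ptsMeasure) :=
      (measurable_setIntegral_ptsMeasure (f := fun z => ψ (z.1.shift z.2))
        (hψ.comp measurable_shift_swap) (measurableSet_box d n)).const_mul _
    have hm2 := measurable_boxAverage n hΦm
    have hm3 : AEStronglyMeasurable (μ[unitBoxSum ψ | invariantSets d]) μ :=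
      (stronglyMeasurable_condExp.mono invariantSets_le).aestronglyMeasurable
    calc eLpNorm (fun η => (volume (box d n)).toReal⁻¹ *
          (∫ z in box d n, ψ (η.shift z) ∂η.ptsMeasure) -
            (μ[unitBoxSum ψ | invariantSets d]) η) 1 μ
        = eLpNorm ((fun η => (volume (box d n)).toReal⁻¹ *
          (∫ z in box d n, ψ (η.shift z) ∂η.ptsMeasure) - boxAverage n (unitBoxSum ψ) η) +
            fun η => boxAverage n (unitBoxSum ψ) η - (μ[unitBoxSum ψ | invariantSets d]) η) 1 μ := by
          congr 1
          funext η
          simp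
      _ ≤ _ := eLpNorm_add_le (hm1.sub hm2).aestronglyMeasurable
          (hm2.aestronglyMeasurable.sub hm3) le_rfl
      _ ≤ _ := by
          refine add_le_add ?_ le_rfl
          rw [eLpNorm_one_eq_lintegral_enorm]
          refine (lintegral_mono fun η => enorm_boxAverage_unitBoxSum_sub_le hψ hn η).trans ?_
          rw [lintegral_const_mul' _ _ enorm_ne_top, hP.setLIntegral_shift
            ((measurableSet_box d (n + 1)).diff (measurableSet_box d (n - 1))) hψ.enorm, mul_assoc]

end PalmErgodic

end

section

variable {d : ℕ}

/-! ### Birth and death measures on pairs of a point and a configuration -/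

section BirthDeathParts

variable {H : FinConfig d → ℝ} {μ : Measure (Config d)} {Λ : Set (Space d)}

/-- The measure `b(x, η) dx μ(dη)` on `Λ × Config d`. -/
noncomputable def birthPart (H : FinConfig d → ℝ) (μ : Measure (Config d)) (Λ : Set (Space d)) :
    Measure (Space d × Config d) :=
  ((volume.restrict Λ).prod μ).withDensity fun z => ENNReal.ofReal (birthRate H z.1 z.2)

/-- The reduced Campbell measure of the points in `Λ`. -/
noncomputable def deathPart (μ : Measure (Config d)) (Λ : Set (Space d)) :
    Measure (Space d × Config d) :=
  (campbell μ).restrict (Λ ×ˢ Set.univ)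

theorem IsInteraction.measurable_birthRate_left (hH : IsInteraction H) (η : Config d) :
    Measurable fun x => birthRate H x η :=
  (show Measurable (Function.uncurry (birthRate H)) from hH.measurable_birthRate).of_uncurry_right

theorem IsInteraction.measurable_birthRate_right (hH : IsInteraction H) (x : Space d) :
    Measurable (birthRate H x) :=
  (show Measurable (Function.uncurry (birthRate H)) from hH.measurable_birthRate).of_uncurry_left

theorem IsInteraction.lintegral_birthPart [SFinite μ] (hH : IsInteraction H)
    {f : Space d × Config d → ℝ≥0∞} (hf : Measurable f) :
    ∫⁻ z, f z ∂birthPart H μ Λ =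
      ∫⁻ η, (∫⁻ x in Λ, ENNReal.ofReal (birthRate H x η) * f (x, η)) ∂μ := by
  have hb := hH.measurable_birthRate.ennreal_ofReal
  have hbf : Measurable fun z : Space d × Config d =>
    ENNReal.ofReal (birthRate H z.1 z.2) * f z := hb.mul hf
  rw [birthPart, lintegral_withDensity_eq_lintegral_mul _ hb hf]
  exact lintegral_prod_symm' _ hbf

theorem lintegral_deathPart [SFinite μ] (hΛ : MeasurableSet Λ)
    {f : Space d × Config d → ℝ≥0∞} (hf : Measurable f) :
    ∫⁻ z, f z ∂deathPart μ Λ = ∫⁻ η, (∫⁻ x in Λ, f (x, η.del x) ∂η.ptsMeasure) ∂μ := by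
  have hs : MeasurableSet (Λ ×ˢ (Set.univ : Set (Config d))) := hΛ.prod MeasurableSet.univ
  rw [deathPart, ← lintegral_indicator hs, lintegral_campbell (hf.indicator hs)]
  refine lintegral_congr fun η => ?_
  rw [← lintegral_indicator hΛ]
  refine lintegral_congr fun x => ?_
  by_cases hx : x ∈ Λ <;> simp [hx]

theorem deathPart_eq_map_compProd [SFinite μ] (hΛ : MeasurableSet Λ) :
    deathPart μ Λ = (μ ⊗ₘ (Config.ptsKernel d).restrict hΛ).map fun z => (z.2, z.1.del z.2) := by
  refine Measure.ext_of_lintegral _ fun f hf => ?_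
  have hm : Measurable fun z : Config d × Space d => f (z.2, z.1.del z.2) :=
    hf.comp measurable_snd_del
  rw [lintegral_deathPart hΛ hf, lintegral_map hf measurable_snd_del,
    Measure.lintegral_compProd hm]
  simp only [Kernel.restrict_apply, Config.ptsKernel_apply]

theorem IsInteraction.isFiniteMeasure_birthMeasure [IsFiniteMeasure μ] (hH : IsInteraction H) :
    IsFiniteMeasure (birthMeasure H μ) := by
  obtain ⟨C, -, hC⟩ := hH.exists_bound
  refine isFiniteMeasure_withDensity_ofReal ?_
  refine HasFiniteIntegral.of_bounded (C := Real.exp C) (ae_of_all _ fun η => ?_)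
  rw [Real.norm_of_nonneg (birthRate_pos 0 η).le]
  exact (hC 0 η).2

/-- Covariance of the birth rate moves the point x to the origin, and stationarity removes the
resulting translation of η. -/
theorem IsInteraction.birthPart_eq_map [IsFiniteMeasure μ] (hH : IsInteraction H)
    (hμθ : IsShiftInvariant μ) :
    birthPart H μ Λ = ((volume.restrict Λ).prod (birthMeasure H μ)).map moveOrigin := by
  have := hH.isFiniteMeasure_birthMeasure (μ := μ)
  refine Measure.ext_of_lintegral _ fun f hf => ?_
  have hb := hH.measurable_birthRate.ennreal_ofReal
  have hb0 : Measurable fun η : Config d => ENNReal.ofReal (birthRate H 0 η) :=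
    (hH.measurable_birthRate_right 0).ennreal_ofReal
  have hbf : Measurable fun z : Space d × Config d =>
    ENNReal.ofReal (birthRate H z.1 z.2) * f z := hb.mul hf
  have hfm : Measurable fun z => f (moveOrigin z) := hf.comp measurable_moveOrigin
  rw [birthPart, lintegral_withDensity_eq_lintegral_mul _ hb hf, lintegral_map hf
    measurable_moveOrigin, lintegral_prod _ hfm.aemeasurable]
  simp only [Pi.mul_apply]
  rw [lintegral_prod _ hbf.aemeasurable]
  refine lintegral_congr fun x => ?_
  have hx : Measurable fun y => f (moveOrigin (x, y)) := hfm.comp measurable_prodMk_left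
  have hx2 : Measurable fun η : Config d => ENNReal.ofReal (birthRate H 0 η) *
    f (moveOrigin (x, η)) := hb0.mul hx
  rw [birthMeasure, lintegral_withDensity_eq_lintegral_mul _ hb0 hx]
  simp only [Pi.mul_apply]
  conv_rhs => rw [← hμθ x]
  rw [lintegral_map hx2 (Config.measurable_shift x)]
  refine lintegral_congr fun η => ?_
  simp only [hH.birthRate_shift, moveOrigin, Config.shift_neg_shift]

theorem IsPalm.deathPart_eq_map [SFinite μ] {μ₀ : Measure (Config d)} [SFinite μ₀]
    (h : IsPalm μ μ₀) (hΛ : MeasurableSet Λ) :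
    deathPart μ Λ = ((volume.restrict Λ).prod (μ₀.map removeOrigin)).map moveOrigin := by
  rw [deathPart, h.campbell_eq, Measure.restrict_map measurable_moveOrigin
    (hΛ.prod MeasurableSet.univ)]
  have : moveOrigin ⁻¹' (Λ ×ˢ (Set.univ : Set (Config d))) = Λ ×ˢ Set.univ := by
    ext z; simp [moveOrigin]
  rw [this, ← Measure.prod_restrict, Measure.restrict_univ]

/-- The difference of the sum of `h (x, η - δ_x)` over the points of `η` in `Λ` and the integral of
`h (x, η)` against the birth rate in `Λ`. -/
noncomputable def netRate (H : FinConfig d → ℝ) (Λ : Set (Space d)) (h : Space d × Config d → ℝ)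
    (η : Config d) : ℝ :=
  (∫ x in Λ, h (x, η.del x) ∂η.ptsMeasure) - ∫ x in Λ, birthRate H x η * h (x, η)

variable {h : Space d × Config d → ℝ}

theorem IsInteraction.measurable_netRate (hH : IsInteraction H) (hΛ : MeasurableSet Λ)
    (hh : Measurable h) : Measurable (netRate H Λ h) := by
  refine Measurable.sub ?_ ?_
  · exact measurable_setIntegral_ptsMeasure (f := fun z => h (z.2, z.1.del z.2))
      (hh.comp measurable_snd_del) hΛ
  · have : StronglyMeasurable fun z : Space d × Config d => birthRate H z.1 z.2 * h z :=
      (hH.measurable_birthRate.mul hh).stronglyMeasurable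
    exact this.integral_prod_left'.measurable

theorem IsInteraction.integrable_birthPart_iff [SFinite μ] (hH : IsInteraction H) :
    Integrable h (birthPart H μ Λ) ↔
      Integrable (fun z => birthRate H z.1 z.2 * h z) ((volume.restrict Λ).prod μ) := by
  rw [birthPart, integrable_withDensity_iff_integrable_smul'
    hH.measurable_birthRate.ennreal_ofReal (ae_of_all _ fun z => ENNReal.ofReal_lt_top)]
  simp only [ENNReal.toReal_ofReal (birthRate_pos _ _).le, smul_eq_mul]

theorem IsInteraction.integral_birthPart [SFinite μ] (hH : IsInteraction H)
    (hi : Integrable h (birthPart H μ Λ)) :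
    ∫ z, h z ∂birthPart H μ Λ = ∫ η, (∫ x in Λ, birthRate H x η * h (x, η)) ∂μ := by
  rw [birthPart, integral_withDensity_eq_integral_toReal_smul
    hH.measurable_birthRate.ennreal_ofReal (ae_of_all _ fun z => ENNReal.ofReal_lt_top)]
  simp only [ENNReal.toReal_ofReal (birthRate_pos _ _).le, smul_eq_mul]
  exact integral_prod_symm _ (hH.integrable_birthPart_iff.1 hi)

theorem integral_deathPart [SFinite μ] (hΛ : MeasurableSet Λ) (hi : Integrable h (deathPart μ Λ)) :
    Integrable (fun η => ∫ x in Λ, h (x, η.del x) ∂η.ptsMeasure) μ ∧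
    ∫ z, h z ∂deathPart μ Λ = ∫ η, (∫ x in Λ, h (x, η.del x) ∂η.ptsMeasure) ∂μ := by
  rw [deathPart_eq_map_compProd hΛ] at hi ⊢
  have h1 : Integrable (fun z : Config d × Space d => h (z.2, z.1.del z.2))
    (μ ⊗ₘ (Config.ptsKernel d).restrict hΛ) := hi.comp_measurable measurable_snd_del
  rw [integral_map measurable_snd_del.aemeasurable hi.aestronglyMeasurable]
  refine ⟨?_, ?_⟩
  · rw [Measure.compProd] at h1
    have h2 := h1.integral_compProd
    simp only [Kernel.prodMkLeft_apply, Kernel.restrict_apply, Config.ptsKernel_apply,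
      Kernel.const_apply] at h2
    exact h2
  · rw [Measure.integral_compProd h1]
    simp only [Kernel.restrict_apply, Config.ptsKernel_apply]

theorem IsInteraction.integrable_netRate [SFinite μ] (hH : IsInteraction H) (hΛ : MeasurableSet Λ)
    (hB : Integrable h (birthPart H μ Λ)) (hC : Integrable h (deathPart μ Λ)) :
    Integrable (netRate H Λ h) μ :=
  (integral_deathPart hΛ hC).1.sub (hH.integrable_birthPart_iff.1 hB).integral_prod_right

theorem IsInteraction.integral_netRate [SFinite μ] (hH : IsInteraction H) (hΛ : MeasurableSet Λ)
    (hB : Integrable h (birthPart H μ Λ)) (hC : Integrable h (deathPart μ Λ)) :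
    ∫ η, netRate H Λ h η ∂μ = ∫ z, h z ∂deathPart μ Λ - ∫ z, h z ∂birthPart H μ Λ := by
  rw [hH.integral_birthPart hB, (integral_deathPart hΛ hC).2]
  exact integral_sub (integral_deathPart hΛ hC).1
    (hH.integrable_birthPart_iff.1 hB).integral_prod_right

theorem IsInteraction.ae_integrableOn_birthRate_mul [SFinite μ] (hH : IsInteraction H)
    (hB : Integrable h (birthPart H μ Λ)) :
    ∀ᵐ η ∂μ, IntegrableOn (fun x => birthRate H x η * h (x, η)) Λ :=
  (hH.integrable_birthPart_iff.1 hB).prod_left_ae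

theorem IsInteraction.lintegral_enorm_netRate_le [SFinite μ] (hH : IsInteraction H)
    (hΛ : MeasurableSet Λ) (hh : Measurable h) :
    ∫⁻ η, ‖netRate H Λ h η‖ₑ ∂μ ≤
      ∫⁻ z, ‖h z‖ₑ ∂deathPart μ Λ + ∫⁻ z, ‖h z‖ₑ ∂birthPart H μ Λ := by
  have hm : Measurable fun η : Config d => ∫⁻ x in Λ, ‖h (x, η.del x)‖ₑ ∂η.ptsMeasure := by
    have := (hh.comp measurable_snd_del).enorm.lintegral_kernel_prod_right'
      (κ := (Config.ptsKernel d).restrict hΛ)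
    simpa [Kernel.restrict_apply] using this
  rw [lintegral_deathPart hΛ hh.enorm, hH.lintegral_birthPart hh.enorm, ← lintegral_add_left hm]
  refine lintegral_mono fun η => ?_
  refine enorm_sub_le.trans ?_
  refine add_le_add (enorm_integral_le_lintegral_enorm _)
    ((enorm_integral_le_lintegral_enorm _).trans_eq ?_)
  refine lintegral_congr fun x => ?_
  rw [enorm_mul, Real.enorm_of_nonneg (birthRate_pos _ _).le]

theorem IsInteraction.netRate_sub [SFinite μ] (hH : IsInteraction H)
    (hΛb : Bornology.IsBounded Λ) (hΛ : MeasurableSet Λ) {k : Space d × Config d → ℝ}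
    (hh : Measurable h) (hk : Measurable k)
    (hB : Integrable h (birthPart H μ Λ)) (kB : Integrable k (birthPart H μ Λ)) :
    netRate H Λ (fun z => h z - k z) =ᵐ[μ] fun η => netRate H Λ h η - netRate H Λ k η := by
  filter_upwards [hH.ae_integrableOn_birthRate_mul hB, hH.ae_integrableOn_birthRate_mul kB]
    with η h1 h2
  have hd : Measurable fun x : Space d => (x, η.del x) :=
    measurable_id.prodMk (Config.measurable_del_prod.comp (measurable_id.prodMk measurable_const))
  have h3 : IntegrableOn (fun x => h (x, η.del x)) Λ η.ptsMeasure :=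
    η.integrableOn_ptsMeasure hΛb hΛ (hh.comp hd)
  have h4 : IntegrableOn (fun x => k (x, η.del x)) Λ η.ptsMeasure :=
    η.integrableOn_ptsMeasure hΛb hΛ (hk.comp hd)
  simp only [netRate, mul_sub]
  rw [integral_sub h1 h2, integral_sub h3 h4]
  ring

/-- If the net rate is integrable although only the positive part of the birth term and the
negative part of the death term are known to be, then both terms are integrable. -/
theorem IsInteraction.integrable_of_integrable_netRate [SFinite μ] (hH : IsInteraction H)
    (hΛb : Bornology.IsBounded Λ) (hΛ : MeasurableSet Λ) (hh : Measurable h)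
    (hdef : ∀ᵐ η ∂μ, IntegrableOn (fun x => birthRate H x η * h (x, η)) Λ)
    (hnet : Integrable (netRate H Λ h) μ)
    (hpos : Integrable (fun z => max (h z) 0) (birthPart H μ Λ))
    (hneg : Integrable (fun z => max (-h z) 0) (deathPart μ Λ)) :
    Integrable h (birthPart H μ Λ) ∧ Integrable h (deathPart μ Λ) := by
  have hpm : Measurable fun z => max (h z) 0 := hh.max measurable_const
  have hnm : Measurable fun z => max (-h z) 0 := hh.neg.max measurable_const
  have hsplit : ∀ z, h z = max (h z) 0 - max (-h z) 0 := fun z => by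
    rcases le_total (h z) 0 with h0 | h0
    · rw [max_eq_right h0, max_eq_left (by linarith)]; ring
    · rw [max_eq_left h0, max_eq_right (by linarith)]; ring
  have hd : ∀ η : Config d, Measurable fun x : Space d => (x, η.del x) := fun η =>
    measurable_id.prodMk (Config.measurable_del_prod.comp (measurable_id.prodMk measurable_const))
  -- Split both terms into positive and negative parts. The net rate is death⁺ - death⁻ - birth⁺ +
  -- birth⁻, so the two parts not yet controlled are bounded by its absolute value plus the two that
  -- are.
  have key : ∀ᵐ η ∂μ,
      (∫⁻ x in Λ, ‖max (h (x, η.del x)) 0‖ₑ ∂η.ptsMeasure) +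
        (∫⁻ x in Λ, ENNReal.ofReal (birthRate H x η) * ‖max (-h (x, η)) 0‖ₑ) ≤
      ‖netRate H Λ h η‖ₑ +
        ((∫⁻ x in Λ, ‖max (-h (x, η.del x)) 0‖ₑ ∂η.ptsMeasure) +
        (∫⁻ x in Λ, ENNReal.ofReal (birthRate H x η) * ‖max (h (x, η)) 0‖ₑ)) := by
    filter_upwards [hdef] with η h1
    have hbη := hH.measurable_birthRate_left η
    have hη : Measurable fun x : Space d => (x, η) := measurable_id.prodMk measurable_const
    have m1 : Measurable fun x : Space d => max (h (x, η)) 0 := hpm.comp hη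
    have m2 : Measurable fun x : Space d => max (-h (x, η)) 0 := hnm.comp hη
    have m3 : Measurable fun x : Space d => max (h (x, η.del x)) 0 := hpm.comp (hd η)
    have m4 : Measurable fun x : Space d => max (-h (x, η.del x)) 0 := hnm.comp (hd η)
    have h2 : IntegrableOn (fun x => birthRate H x η * max (h (x, η)) 0) Λ := by
      refine Integrable.mono h1 (hbη.mul m1).aestronglyMeasurable
        (ae_of_all _ fun x => ?_)
      rw [norm_mul, norm_mul]
      gcongr
      rw [Real.norm_eq_abs, abs_of_nonneg (le_max_right _ _)]
      exact max_le (le_abs_self _) (abs_nonneg _)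
    have h3 : IntegrableOn (fun x => birthRate H x η * max (-h (x, η)) 0) Λ := by
      refine Integrable.mono h1 (hbη.mul m2).aestronglyMeasurable
        (ae_of_all _ fun x => ?_)
      rw [norm_mul, norm_mul]
      gcongr
      rw [Real.norm_eq_abs, abs_of_nonneg (le_max_right _ _)]
      exact max_le (neg_le_abs _) (abs_nonneg _)
    have h4 := η.integrableOn_ptsMeasure hΛb hΛ m3
    have h5 := η.integrableOn_ptsMeasure hΛb hΛ m4
    have hnet_eq : netRate H Λ h η =
        ((∫ x in Λ, max (h (x, η.del x)) 0 ∂η.ptsMeasure) -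
          ∫ x in Λ, max (-h (x, η.del x)) 0 ∂η.ptsMeasure) -
        ((∫ x in Λ, birthRate H x η * max (h (x, η)) 0) -
          ∫ x in Λ, birthRate H x η * max (-h (x, η)) 0) := by
      rw [netRate, ← integral_sub h2 h3]
      congr 1
      · exact (integral_congr_ae (ae_of_all _ fun x => hsplit (x, η.del x))).trans
          (integral_sub h4 h5)
      · refine integral_congr_ae (ae_of_all _ fun x => ?_)
        simp only
        rw [← mul_sub, ← hsplit]
    have e : ∀ {κ : Measure (Space d)} {f : Space d → ℝ}, (∀ x, 0 ≤ f x) → Integrable f κ →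
        ∫⁻ x, ‖f x‖ₑ ∂κ = ENNReal.ofReal (∫ x, f x ∂κ) := fun hf hi => by
      rw [ofReal_integral_eq_lintegral_ofReal hi (ae_of_all _ hf)]
      exact lintegral_congr fun x => Real.enorm_of_nonneg (hf x)
    have e1 := e (f := fun x => max (h (x, η.del x)) 0) (fun x => le_max_right _ _) h4
    have e2 := e (f := fun x => max (-h (x, η.del x)) 0) (fun x => le_max_right _ _) h5
    have e3 := e (f := fun x => birthRate H x η * max (h (x, η)) 0)
      (fun x => mul_nonneg (birthRate_pos _ _).le (le_max_right _ _)) h2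
    have e4 := e (f := fun x => birthRate H x η * max (-h (x, η)) 0)
      (fun x => mul_nonneg (birthRate_pos _ _).le (le_max_right _ _)) h3
    simp only [enorm_mul, Real.enorm_of_nonneg (birthRate_pos _ _).le] at e3 e4
    rw [e1, e2, e3, e4, Real.enorm_eq_ofReal_abs]
    have p : ∀ {κ : Measure (Space d)} {f : Space d → ℝ}, (∀ x, 0 ≤ f x) → 0 ≤ ∫ x, f x ∂κ :=
      fun hf => integral_nonneg hf
    have p1 : 0 ≤ ∫ x in Λ, max (h (x, η.del x)) 0 ∂η.ptsMeasure := p fun x => le_max_right _ _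
    have p2 : 0 ≤ ∫ x in Λ, max (-h (x, η.del x)) 0 ∂η.ptsMeasure := p fun x => le_max_right _ _
    have p3 : 0 ≤ ∫ x in Λ, birthRate H x η * max (h (x, η)) 0 :=
      p fun x => mul_nonneg (birthRate_pos _ _).le (le_max_right _ _)
    have p4 : 0 ≤ ∫ x in Λ, birthRate H x η * max (-h (x, η)) 0 :=
      p fun x => mul_nonneg (birthRate_pos _ _).le (le_max_right _ _)
    rw [← ENNReal.ofReal_add p1 p4, ← ENNReal.ofReal_add p2 p3,
      ← ENNReal.ofReal_add (abs_nonneg _) (add_nonneg p2 p3)]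
    refine ENNReal.ofReal_le_ofReal ?_
    have := le_abs_self (netRate H Λ h η)
    linarith
  have hm : Measurable fun η : Config d =>
      ∫⁻ x in Λ, ‖max (h (x, η.del x)) 0‖ₑ ∂η.ptsMeasure := by
    have := (hpm.comp measurable_snd_del).enorm.lintegral_kernel_prod_right'
      (κ := (Config.ptsKernel d).restrict hΛ)
    simpa [Kernel.restrict_apply] using this
  have hm' : Measurable fun η : Config d =>
      ∫⁻ x in Λ, ‖max (-h (x, η.del x)) 0‖ₑ ∂η.ptsMeasure := by
    have := (hnm.comp measurable_snd_del).enorm.lintegral_kernel_prod_right'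
      (κ := (Config.ptsKernel d).restrict hΛ)
    simpa [Kernel.restrict_apply] using this
  have hfin : ∫⁻ z, ‖max (h z) 0‖ₑ ∂deathPart μ Λ +
      ∫⁻ z, ‖max (-h z) 0‖ₑ ∂birthPart H μ Λ < ∞ := by
    rw [lintegral_deathPart hΛ hpm.enorm, hH.lintegral_birthPart hnm.enorm,
      ← lintegral_add_left hm]
    refine (lintegral_mono_ae key).trans_lt ?_
    rw [lintegral_add_left (hH.measurable_netRate hΛ hh).enorm, lintegral_add_left hm',
      ← lintegral_deathPart hΛ hnm.enorm, ← hH.lintegral_birthPart hpm.enorm]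
    exact ENNReal.add_lt_top.2 ⟨hnet.2, ENNReal.add_lt_top.2 ⟨hneg.2, hpos.2⟩⟩
  obtain ⟨f1, f2⟩ := ENNReal.add_lt_top.1 hfin
  constructor
  · exact (hpos.sub ⟨hnm.aestronglyMeasurable, f2⟩).congr (ae_of_all _ fun z => (hsplit z).symm)
  · exact (Integrable.sub ⟨hpm.aestronglyMeasurable, f1⟩ hneg).congr
      (ae_of_all _ fun z => (hsplit z).symm)

end BirthDeathParts

end

section

variable {d : ℕ}

/-! ### Densities of image measures and log-likelihood ratios -/

section Density

variable {X Y : Type*} [MeasurableSpace X] [MeasurableSpace Y]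

/-- A density squeezed between two functions of `T` induces a density of the image measures squeezed
between the same two functions. -/
theorem exists_density_map {M : Measure X} [IsFiniteMeasure M] {T : X → Y} (hT : Measurable T)
    {g : X → ℝ≥0∞} {l u : Y → ℝ≥0∞} (hl : Measurable l) (hu : Measurable u)
    {K : ℝ≥0∞} (hK : K ≠ ∞) (huK : ∀ y, u y ≤ K) (hlg : ∀ x, l (T x) ≤ g x)
    (hgu : ∀ x, g x ≤ u (T x)) :
    ∃ β : Y → ℝ≥0∞, Measurable β ∧ (M.withDensity g).map T = (M.map T).withDensity β ∧
      ∀ᵐ y ∂(M.map T), l y ≤ β y ∧ β y ≤ u y := by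
  have hmap : ∀ s, MeasurableSet s → ((M.withDensity g).map T) s = ∫⁻ x in T ⁻¹' s, g x ∂M :=
    fun s hs => by rw [Measure.map_apply hT hs, withDensity_apply _ (hT hs)]
  have hfin : IsFiniteMeasure (M.withDensity g) := by
    refine isFiniteMeasure_withDensity (ne_of_lt ?_)
    calc ∫⁻ x, g x ∂M ≤ ∫⁻ _, K ∂M := lintegral_mono fun x => (hgu x).trans (huK _)
      _ < ∞ := by rw [lintegral_const]; exact ENNReal.mul_lt_top hK.lt_top (measure_lt_top M _)
  have hac : (M.withDensity g).map T ≪ M.map T :=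
    (withDensity_absolutelyContinuous M g).map hT
  have hβ := Measure.withDensity_rnDeriv_eq _ _ hac
  have hβm := Measure.measurable_rnDeriv ((M.withDensity g).map T) (M.map T)
  have hset : ∀ s, MeasurableSet s →
      ∫⁻ y in s, ((M.withDensity g).map T).rnDeriv (M.map T) y ∂(M.map T) =
        ∫⁻ x in T ⁻¹' s, g x ∂M := fun s hs => by
    rw [← hmap s hs, ← withDensity_apply _ hs, hβ]
  refine ⟨_, hβm, hβ.symm, ?_⟩
  -- Both bounds are functions of `T`, so they can be compared with the image density set by set.
  have h1 := ae_le_of_forall_setLIntegral_le_of_sigmaFinite (μ := M.map T) hl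
    (g := ((M.withDensity g).map T).rnDeriv (M.map T)) fun s hs _ => by
      rw [hset s hs, setLIntegral_map hs hl hT]
      exact lintegral_mono fun x => hlg x
  have h2 := ae_le_of_forall_setLIntegral_le_of_sigmaFinite (μ := M.map T) hβm
    (g := u) fun s hs _ => by
      rw [hset s hs, setLIntegral_map hs hu hT]
      exact lintegral_mono fun x => hgu x
  filter_upwards [h1, h2] with y h3 h4 using ⟨h3, h4⟩

theorem llr_withDensity_withDensity {N : Measure X} [SigmaFinite N] {p q : X → ℝ≥0∞}
    (hp : Measurable p) (hq : Measurable q) (hp0 : ∀ᵐ x ∂N, p x ≠ 0 ∧ p x ≠ ∞)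
    (hq0 : ∀ᵐ x ∂N, q x ≠ 0 ∧ q x ≠ ∞) :
    llr (N.withDensity p) (N.withDensity q) =ᵐ[N]
      fun x => Real.log (p x).toReal - Real.log (q x).toReal := by
  have hs : SigmaFinite (N.withDensity q) :=
    SigmaFinite.withDensity_of_ne_top (hq0.mono fun _ h => h.2)
  have h1 : N.withDensity p = (N.withDensity q).withDensity (p / q) := by
    rw [← withDensity_mul N hq (hp.div hq)]
    refine withDensity_congr_ae ?_
    filter_upwards [hq0] with x hx
    rw [Pi.mul_apply, Pi.div_apply, ENNReal.mul_div_cancel hx.1 hx.2]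
  have h2 : (N.withDensity p).rnDeriv (N.withDensity q) =ᵐ[N.withDensity q] p / q := by
    conv_lhs => rw [h1]
    exact Measure.rnDeriv_withDensity _ (hp.div hq)
  have h3 : N ≪ N.withDensity q :=
    withDensity_absolutelyContinuous' hq.aemeasurable (hq0.mono fun _ h => h.1)
  filter_upwards [h3.ae_le h2, hp0, hq0] with x e hpx hqx
  rw [llr, e, Pi.div_apply, ENNReal.toReal_div, Real.log_div]
  · exact ENNReal.toReal_ne_zero.2 hpx
  · exact ENNReal.toReal_ne_zero.2 hqx

end Density

/-! ### Localization and the increment of the log-density -/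

section LocalDensity

variable {H : FinConfig d → ℝ} {μ ν : Measure (Config d)} {Λ : Set (Space d)}

/-- The map `(x, η) ↦ (x, η_Λ)`. -/
def localize (Λ : Set (Space d)) (z : Space d × Config d) : Space d × Config d :=
  (z.1, z.2.restrict Λ)

theorem measurable_localize (hΛ : MeasurableSet Λ) : Measurable (localize Λ) :=
  measurable_fst.prodMk ((Config.measurable_restrict hΛ).comp measurable_snd)

theorem Config.ptsMeasure_restrict (η : Config d) (hΛ : MeasurableSet Λ) :
    (η.restrict Λ).ptsMeasure = η.ptsMeasure.restrict Λ := by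
  refine Measure.ext_of_lintegral _ fun f _ => ?_
  rw [← lintegral_indicator hΛ, lintegral_ptsMeasure_eq_tsum_indicator,
    lintegral_ptsMeasure_eq_tsum_indicator, Set.indicator_indicator]
  rfl

theorem map_localize_prod [SFinite μ] (hΛ : MeasurableSet Λ) :
    ((volume.restrict Λ).prod μ).map (localize Λ) = (volume.restrict Λ).prod (marginal Λ μ) := by
  have h := Measure.map_prod_map (volume.restrict Λ : Measure (Space d)) μ measurable_id
    (Config.measurable_restrict hΛ)
  rw [Measure.map_id] at h
  exact h.symm

/-- Only points in Λ are removed, and removal commutes with restriction, so the Campbell measure of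
the marginal appears. -/
theorem map_localize_deathPart [SFinite μ] (hΛ : MeasurableSet Λ) :
    (deathPart μ Λ).map (localize Λ) = campbell (marginal Λ μ) := by
  have : SFinite (marginal Λ μ) := by unfold marginal; infer_instance
  refine Measure.ext_of_lintegral _ fun f hf => ?_
  have hm : Measurable fun z => f (localize Λ z) := hf.comp (measurable_localize hΛ)
  have hm2 : Measurable fun η : Config d => ∫⁻ x, f (x, η.del x) ∂η.ptsMeasure :=
    Config.measurable_lintegral_ptsMeasure (f := fun w : Config d × Space d => f (w.2, w.1.del w.2))
      (hf.comp measurable_snd_del) measurable_id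
  rw [lintegral_map hf (measurable_localize hΛ), lintegral_deathPart hΛ hm, lintegral_campbell hf,
    marginal, lintegral_map hm2 (Config.measurable_restrict hΛ)]
  refine lintegral_congr fun η => ?_
  rw [η.ptsMeasure_restrict hΛ]
  simp only [localize, Config.restrict_del]

theorem measurable_add_point : Measurable fun z : Space d × Config d => z.2.add z.1 :=
  Config.measurable_add_prod

/-- Putting the removed point back restores η, so the factor does not depend on which point was
chosen. -/
theorem lintegral_campbell_add [SFinite μ] {F : Config d → ℝ≥0∞} (hF : Measurable F)
    {f : Space d × Config d → ℝ≥0∞} (hf : Measurable f) :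
    ∫⁻ z, F (z.2.add z.1) * f z ∂campbell μ =
      ∫⁻ η, F η * (∫⁻ x, f (x, η.del x) ∂η.ptsMeasure) ∂μ := by
  have hm : Measurable fun z : Space d × Config d => F (z.2.add z.1) * f z :=
    (hF.comp measurable_add_point).mul hf
  rw [lintegral_campbell hm]
  refine lintegral_congr fun η => ?_
  rw [Config.lintegral_ptsMeasure, Config.lintegral_ptsMeasure, ← ENNReal.tsum_mul_left]
  refine tsum_congr fun x => ?_
  rw [Config.add_del_of_mem x.2]

theorem campbell_withDensity [SFinite μ] {F : Config d → ℝ≥0∞} (hF : Measurable F) :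
    campbell (μ.withDensity F) = (campbell μ).withDensity fun z => F (z.2.add z.1) := by
  refine Measure.ext_of_lintegral _ fun f hf => ?_
  have hFa : Measurable fun z : Space d × Config d => F (z.2.add z.1) := hF.comp measurable_add_point
  have hm2 : Measurable fun η : Config d => ∫⁻ x, f (x, η.del x) ∂η.ptsMeasure :=
    Config.measurable_lintegral_ptsMeasure (f := fun w : Config d × Space d => f (w.2, w.1.del w.2))
      (hf.comp measurable_snd_del) measurable_id
  rw [lintegral_campbell hf, lintegral_withDensity_eq_lintegral_mul _ hF hm2,
    lintegral_withDensity_eq_lintegral_mul _ hFa hf]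
  exact (lintegral_campbell_add hF hf).symm

/-- Almost sure properties of η pass to η + δ_x under the Campbell measure: the complementary event
has Campbell integral zero. -/
theorem ae_campbell_add [SFinite μ] {p : Config d → Prop} (hp : MeasurableSet {η | p η})
    (h : ∀ᵐ η ∂μ, p η) : ∀ᵐ z ∂campbell μ, p (z.2.add z.1) := by
  have hi : Measurable ({η | p η}ᶜ.indicator (1 : Config d → ℝ≥0∞)) :=
    measurable_one.indicator hp.compl
  have h1 := lintegral_campbell_add (μ := μ) hi (f := 1) measurable_one
  have h2 : ∫⁻ η, {η | p η}ᶜ.indicator (1 : Config d → ℝ≥0∞) η *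
      (∫⁻ x, (1 : Space d × Config d → ℝ≥0∞) (x, η.del x) ∂η.ptsMeasure) ∂μ = 0 := by
    refine lintegral_eq_zero_of_ae_eq_zero ?_
    filter_upwards [h] with η hη
    simp [hη]
  rw [h2] at h1
  have hm : Measurable fun z : Space d × Config d =>
      {η | p η}ᶜ.indicator (1 : Config d → ℝ≥0∞) (z.2.add z.1) *
        (1 : Space d × Config d → ℝ≥0∞) z := (hi.comp measurable_add_point).mul measurable_one
  rw [lintegral_eq_zero_iff hm] at h1
  filter_upwards [h1] with z hz
  by_contra hc
  simp [hc] at hz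

/-- The increment of the log-density of the marginals when adding a point. -/
noncomputable def increment (μ ν : Measure (Config d)) (Λ : Set (Space d))
    (z : Space d × Config d) : ℝ :=
  llr (marginal Λ μ) (marginal Λ ν) (z.2.add z.1) - llr (marginal Λ μ) (marginal Λ ν) z.2

theorem measurable_increment : Measurable (increment μ ν Λ) :=
  ((measurable_llr _ _).comp measurable_add_point).sub ((measurable_llr _ _).comp measurable_snd)

/-- Near the boundary the birth rate depends on points outside Λ and is replaced by its average
given the localized data. Nothing explicit is known about that average, but it keeps the bounds
e^{±C}; for inner points nothing is averaged. -/
theorem IsInteraction.exists_localDensity [IsFiniteMeasure μ] (hH : IsInteraction H)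
    (hb : Bornology.IsBounded Λ) (hΛ : MeasurableSet Λ) {C : ℝ}
    (hC : ∀ (x : Space d) (η : Config d),
      Real.exp (-C) ≤ birthRate H x η ∧ birthRate H x η ≤ Real.exp C)
    {I : Set (Space d)} (hIm : MeasurableSet I)
    (hI : ∀ x ∈ I, ∀ η : Config d, birthRate H x (η.restrict Λ) = birthRate H x η) :
    ∃ β : Space d × Config d → ℝ≥0∞, Measurable β ∧
      (birthPart H μ Λ).map (localize Λ) =
        ((volume.restrict Λ).prod (marginal Λ μ)).withDensity β ∧
      ∀ᵐ z ∂((volume.restrict Λ).prod (marginal Λ μ)),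
        ENNReal.ofReal (Real.exp (-C)) ≤ β z ∧ β z ≤ ENNReal.ofReal (Real.exp C) ∧
          (z.1 ∈ I → β z = ENNReal.ofReal (birthRate H z.1 z.2)) := by
  classical
  have hfin : IsFiniteMeasure (volume.restrict Λ : Measure (Space d)) :=
    ⟨by rw [Measure.restrict_apply_univ]; exact hb.measure_lt_top⟩
  have hbm := hH.measurable_birthRate.ennreal_ofReal
  have hIp : MeasurableSet {z : Space d × Config d | z.1 ∈ I} := measurable_fst hIm
  -- With c = -C and c = C these are the lower and upper envelopes: equal on the inner points, the
  -- uniform bounds elsewhere.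
  let e : ℝ → Space d × Config d → ℝ≥0∞ := fun c z =>
    if z.1 ∈ I then ENNReal.ofReal (birthRate H z.1 z.2) else ENNReal.ofReal (Real.exp c)
  have he : ∀ c, Measurable (e c) := fun c => Measurable.ite hIp hbm measurable_const
  obtain ⟨β, hβm, hβ, hβe⟩ := exists_density_map (M := (volume.restrict Λ).prod μ)
    (measurable_localize hΛ) (g := fun z => ENNReal.ofReal (birthRate H z.1 z.2))
    (he (-C)) (he C) (K := ENNReal.ofReal (Real.exp C)) ENNReal.ofReal_ne_top
    (fun z => by
      simp only [e]
      split_ifs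
      · exact ENNReal.ofReal_le_ofReal (hC _ _).2
      · exact le_rfl)
    (fun z => by
      simp only [e, localize]
      split_ifs with h
      · rw [hI _ h]
      · exact ENNReal.ofReal_le_ofReal (hC _ _).1)
    (fun z => by
      simp only [e, localize]
      split_ifs with h
      · rw [hI _ h]
      · exact ENNReal.ofReal_le_ofReal (hC _ _).2)
  rw [map_localize_prod hΛ] at hβ hβe
  refine ⟨β, hβm, hβ, ?_⟩
  filter_upwards [hβe] with z hz
  by_cases h : z.1 ∈ I
  · simp only [e, if_pos h] at hz
    exact ⟨(ENNReal.ofReal_le_ofReal (hC _ _).1).trans hz.1,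
      hz.2.trans (ENNReal.ofReal_le_ofReal (hC _ _).2), fun _ => le_antisymm hz.2 hz.1⟩
  · simp only [e, if_neg h] at hz
    exact ⟨hz.1, hz.2, fun h' => absurd h' h⟩

theorem log_toReal_mem_of_ofReal_exp_le {C : ℝ} {a : ℝ≥0∞}
    (h1 : ENNReal.ofReal (Real.exp (-C)) ≤ a) (h2 : a ≤ ENNReal.ofReal (Real.exp C)) :
    -C ≤ Real.log a.toReal ∧ Real.log a.toReal ≤ C := by
  have ha : a ≠ ∞ := (h2.trans_lt ENNReal.ofReal_lt_top).ne
  have h3 : Real.exp (-C) ≤ a.toReal := (ENNReal.ofReal_le_iff_le_toReal ha).1 h1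
  have h4 : a.toReal ≤ Real.exp C := ENNReal.toReal_le_of_le_ofReal (Real.exp_pos _).le h2
  have h0 : 0 < a.toReal := (Real.exp_pos _).trans_le h3
  exact ⟨(Real.le_log_iff_exp_le h0).2 h3, (Real.log_le_iff_le_exp h0).2 h4⟩

/-- The increment of the log-density is the log-density of the localized death part relative to the
localized birth part, up to a boundary effect. -/
theorem IsInteraction.increment_sub_llr [NeZero d] [IsFiniteMeasure μ] (hH : IsInteraction H)
    (hν : IsGibbs H ν) (hb : Bornology.IsBounded Λ) (hΛ : MeasurableSet Λ)
    (hμν : marginal Λ μ ≪ marginal Λ ν) (hνμ : marginal Λ ν ≪ marginal Λ μ) {C : ℝ}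
    (hC : ∀ (x : Space d) (η : Config d),
      Real.exp (-C) ≤ birthRate H x η ∧ birthRate H x η ≤ Real.exp C)
    {I : Set (Space d)} (hIm : MeasurableSet I)
    (hI : ∀ x ∈ I, ∀ η : Config d, birthRate H x (η.restrict Λ) = birthRate H x η) :
    (deathPart μ Λ).map (localize Λ) ≪ (birthPart H μ Λ).map (localize Λ) ∧
    (birthPart H μ Λ).map (localize Λ) ≪ (deathPart μ Λ).map (localize Λ) ∧
    ∀ᵐ z ∂(birthPart H μ Λ).map (localize Λ),
      |increment μ ν Λ z - llr ((deathPart μ Λ).map (localize Λ))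
        ((birthPart H μ Λ).map (localize Λ)) z| ≤ Iᶜ.indicator (fun _ => 2 * C) z.1 := by
  have := hν.isProbabilityMeasure
  have hfin : IsFiniteMeasure (volume.restrict Λ : Measure (Space d)) :=
    ⟨by rw [Measure.restrict_apply_univ]; exact hb.measure_lt_top⟩
  have hfμ : IsFiniteMeasure (marginal Λ μ) := by unfold marginal; infer_instance
  have hfν : IsFiniteMeasure (marginal Λ ν) := by unfold marginal; infer_instance
  set F := (marginal Λ μ).rnDeriv (marginal Λ ν) with hF
  have hFm : Measurable F := Measure.measurable_rnDeriv _ _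
  have hMμ : (marginal Λ ν).withDensity F = marginal Λ μ := Measure.withDensity_rnDeriv_eq _ _ hμν
  have hF0 : ∀ᵐ η ∂marginal Λ ν, F η ≠ 0 ∧ F η ≠ ∞ := by
    filter_upwards [Measure.rnDeriv_pos' hνμ, Measure.rnDeriv_ne_top (marginal Λ μ) (marginal Λ ν)]
      with η h1 h2 using ⟨h1.ne', h2⟩
  set N := (volume.restrict Λ : Measure (Space d)).prod (marginal Λ ν) with hN
  obtain ⟨β, hβm, hβ, hβe⟩ := hH.exists_localDensity (μ := μ) hb hΛ hC hIm hI
  obtain ⟨β', hβm', hβ', hβe'⟩ := hH.exists_localDensity (μ := ν) hb hΛ hC hIm hI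
  have hNac : N ≪ (volume.restrict Λ : Measure (Space d)).prod (marginal Λ μ) :=
    Measure.AbsolutelyContinuous.rfl.prod hνμ
  replace hβe := hNac.ae_le hβe
  -- The Georgii-Nguyen-Zessin equation enters here: localized births and deaths of ν coincide, so
  -- one density relative to dx ⊗ ν_Λ describes both.
  have hcν : campbell (marginal Λ ν) = N.withDensity β' := by
    rw [← map_localize_deathPart hΛ, ← hβ', deathPart, hH.campbell_restrict hν hb hΛ]
    rfl
  have hFa : Measurable fun z : Space d × Config d => F (z.2.add z.1) := hFm.comp measurable_add_point
  have hF2 : Measurable fun z : Space d × Config d => F z.2 := hFm.comp measurable_snd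
  have hpm : Measurable (β' * fun z : Space d × Config d => F (z.2.add z.1)) := hβm'.mul hFa
  have hqm : Measurable ((fun z : Space d × Config d => F z.2) * β) := hF2.mul hβm
  -- Relative to the common reference `N`, the death part has density β'·F(η + δ_x) and, below, the
  -- birth part has density F(η)·β, with F = dμ_Λ/dν_Λ.
  have hCd : (deathPart μ Λ).map (localize Λ) = N.withDensity (β' * fun z => F (z.2.add z.1)) := by
    rw [map_localize_deathPart hΛ, ← hMμ, campbell_withDensity hFm, hcν,
      withDensity_mul N hβm' hFa]
  have hBd : (birthPart H μ Λ).map (localize Λ) = N.withDensity ((fun z => F z.2) * β) := by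
    rw [hβ, withDensity_mul N hF2 hβm, ← hMμ, prod_withDensity_right hFm]
  -- A ν_Λ-null set could be charged after adding x; this is excluded because `N` and the Campbell
  -- measure of ν_Λ have the same null sets, β' being bounded below.
  have hFa0 : ∀ᵐ z ∂N, F (z.2.add z.1) ≠ 0 ∧ F (z.2.add z.1) ≠ ∞ := by
    have hs : MeasurableSet {η | F η ≠ 0 ∧ F η ≠ ∞} :=
      (hFm (measurableSet_singleton 0).compl).inter (hFm (measurableSet_singleton ∞).compl)
    have h1 := ae_campbell_add (μ := marginal Λ ν) hs hF0
    rw [hcν, ae_withDensity_iff hβm'] at h1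
    filter_upwards [h1, hβe'] with z h2 h3
    refine h2 (ne_of_gt (lt_of_lt_of_le ?_ h3.1))
    exact ENNReal.ofReal_pos.2 (Real.exp_pos _)
  have hF20 : ∀ᵐ z ∂N, F z.2 ≠ 0 ∧ F z.2 ≠ ∞ := Measure.quasiMeasurePreserving_snd.ae hF0
  have hb0 : ∀ {a : ℝ≥0∞}, ENNReal.ofReal (Real.exp (-C)) ≤ a → a ≤ ENNReal.ofReal (Real.exp C) →
      a ≠ 0 ∧ a ≠ ∞ := fun h1 h2 =>
    ⟨(lt_of_lt_of_le (ENNReal.ofReal_pos.2 (Real.exp_pos _)) h1).ne',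
      (h2.trans_lt ENNReal.ofReal_lt_top).ne⟩
  have hp0 : ∀ᵐ z ∂N, (β' * fun z : Space d × Config d => F (z.2.add z.1)) z ≠ 0 ∧
      (β' * fun z : Space d × Config d => F (z.2.add z.1)) z ≠ ∞ := by
    filter_upwards [hFa0, hβe'] with z h1 h2
    have h3 := hb0 h2.1 h2.2.1
    exact ⟨mul_ne_zero h3.1 h1.1, ENNReal.mul_ne_top h3.2 h1.2⟩
  have hq0 : ∀ᵐ z ∂N, ((fun z : Space d × Config d => F z.2) * β) z ≠ 0 ∧
      ((fun z : Space d × Config d => F z.2) * β) z ≠ ∞ := by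
    filter_upwards [hF20, hβe] with z h1 h2
    have h3 := hb0 h2.1 h2.2.1
    exact ⟨mul_ne_zero h1.1 h3.1, ENNReal.mul_ne_top h1.2 h3.2⟩
  have hllr := llr_withDensity_withDensity hpm hqm hp0 hq0
  have hN1 := withDensity_absolutelyContinuous' hpm.aemeasurable (hp0.mono fun _ h => h.1)
  have hN2 := withDensity_absolutelyContinuous' hqm.aemeasurable (hq0.mono fun _ h => h.1)
  rw [hCd, hBd]
  refine ⟨(withDensity_absolutelyContinuous N _).trans hN2,
    (withDensity_absolutelyContinuous N _).trans hN1,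
    (withDensity_absolutelyContinuous N _).ae_le ?_⟩
  filter_upwards [hllr, hFa0, hF20, hβe, hβe'] with z h1 h2 h3 h4 h5
  have b1 := hb0 h4.1 h4.2.1
  have b2 := hb0 h5.1 h5.2.1
  have l1 := log_toReal_mem_of_ofReal_exp_le h4.1 h4.2.1
  have l2 := log_toReal_mem_of_ofReal_exp_le h5.1 h5.2.1
  rw [h1]
  simp only [Pi.mul_apply, ENNReal.toReal_mul, increment, llr, ← hF]
  rw [Real.log_mul (ENNReal.toReal_ne_zero.2 b2) (ENNReal.toReal_ne_zero.2 h2),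
    Real.log_mul (ENNReal.toReal_ne_zero.2 h3) (ENNReal.toReal_ne_zero.2 b1)]
  -- The increment of log F cancels and log β - log β' remains. It vanishes on inner points, where
  -- both equal the birth rate, and is at most 2C elsewhere.
  have e : ∀ a b c e : ℝ, a - b - (c + a - (b + e)) = e - c := fun a b c e => by ring
  rw [e]
  by_cases hz : z.1 ∈ I
  · rw [h4.2.2 hz, h5.2.2 hz, Set.indicator_of_notMem (by simpa using hz)]
    simp
  · rw [Set.indicator_of_mem (by simpa using hz), abs_le]
    constructor <;> linarith [l1.1, l1.2, l2.1, l2.2]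

end LocalDensity

end

section

variable {d : ℕ}

/-! ### Dissipation as a net rate, and when it is integrable -/

section Dissipation

variable {H : FinConfig d → ℝ} {μ ν : Measure (Config d)} {Λ : Set (Space d)}

theorem Config.hasSum_integral_ptsMeasure (η : Config d) (hb : Bornology.IsBounded Λ)
    (hΛ : MeasurableSet Λ) {f : Space d → ℝ} (hf : Measurable f) :
    HasSum (fun x : η.pts => Λ.indicator f x) (∫ x in Λ, f x ∂η.ptsMeasure) := by
  have h1 : Integrable (Λ.indicator f) η.ptsMeasure :=
    (integrable_indicator_iff hΛ).2 (η.integrableOn_ptsMeasure hb hΛ hf)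
  have h2 := hasSum_integral_measure h1
  simp only [integral_dirac] at h2
  rw [← integral_indicator hΛ]
  exact h2

theorem logDensity_add_sub (x : Space d) (η : Config d) :
    logDensity μ ν Λ (η.add x) - logDensity μ ν Λ η =
      Λ.indicator (fun x => increment μ ν Λ (localize Λ (x, η))) x := by
  by_cases hx : x ∈ Λ
  · rw [Set.indicator_of_mem hx]
    simp only [logDensity, increment, localize, Config.restrict_add_of_mem hx]
  · rw [Set.indicator_of_notMem hx]
    simp only [logDensity, Config.restrict_add_of_notMem hx, sub_self]

theorem logDensity_del_sub {x : Space d} {η : Config d} (hx : x ∈ η.pts) :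
    logDensity μ ν Λ (η.del x) - logDensity μ ν Λ η =
      -Λ.indicator (fun x => increment μ ν Λ (localize Λ (x, η.del x))) x := by
  have h := logDensity_add_sub (μ := μ) (ν := ν) (Λ := Λ) x (η.del x)
  rw [Config.add_del_of_mem hx] at h
  by_cases hΛ : x ∈ Λ
  · rw [Set.indicator_of_mem hΛ] at h ⊢
    rw [← h, neg_sub]
  · rw [Set.indicator_of_notMem hΛ] at h ⊢
    linarith

theorem measurable_increment_localize (hΛ : MeasurableSet Λ) :
    Measurable fun z => increment μ ν Λ (localize Λ z) :=
  measurable_increment.comp (measurable_localize hΛ)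

theorem Config.measurable_pair_del (η : Config d) :
    Measurable fun x : Space d => (x, η.del x) :=
  measurable_id.prodMk (Config.measurable_del_prod.comp (measurable_id.prodMk measurable_const))

theorem hasSum_logDensity_del (hb : Bornology.IsBounded Λ) (hΛ : MeasurableSet Λ) (η : Config d) :
    HasSum (fun x : η.pts => logDensity μ ν Λ (η.del x) - logDensity μ ν Λ η)
      (-∫ x in Λ, increment μ ν Λ (localize Λ (x, η.del x)) ∂η.ptsMeasure) := by
  simp_rw [fun x : η.pts => logDensity_del_sub (μ := μ) (ν := ν) (Λ := Λ) x.2]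
  have hm : Measurable fun x => increment μ ν Λ (localize Λ (x, η.del x)) :=
    (measurable_increment_localize hΛ).comp η.measurable_pair_del
  exact (η.hasSum_integral_ptsMeasure hb hΛ hm).neg

theorem birthRate_mul_logDensity (η : Config d) :
    (fun x => birthRate H x η * (logDensity μ ν Λ (η.add x) - logDensity μ ν Λ η)) =
      Λ.indicator fun x => birthRate H x η * increment μ ν Λ (localize Λ (x, η)) := by
  funext x
  rw [logDensity_add_sub]
  by_cases hx : x ∈ Λ <;> simp [hx]

/-- Only the finitely many points in Λ contribute to the death sum, so the birth integral alone
decides. -/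
theorem generatorDefinedAt_iff (hb : Bornology.IsBounded Λ) (hΛ : MeasurableSet Λ) (η : Config d) :
    GeneratorDefinedAt H (logDensity μ ν Λ) η ↔
      IntegrableOn (fun x => birthRate H x η * increment μ ν Λ (localize Λ (x, η))) Λ := by
  rw [GeneratorDefinedAt, birthRate_mul_logDensity, integrable_indicator_iff hΛ]
  exact and_iff_left (hasSum_logDensity_del hb hΛ η).summable

theorem dissipation_eq_netRate (hb : Bornology.IsBounded Λ) (hΛ : MeasurableSet Λ) :
    dissipation H μ ν Λ = netRate H Λ fun z => increment μ ν Λ (localize Λ z) := by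
  funext η
  rw [dissipation, generator, (hasSum_logDensity_del hb hΛ η).tsum_eq, birthRate_mul_logDensity,
    integral_indicator hΛ, netRate]
  ring

theorem isFiniteMeasure_reducedPalm [SFinite μ] (hμθ : IsShiftInvariant μ)
    (hμ1 : ∫⁻ η, (Config.count (unitCube d) η : ℝ≥0∞) ∂μ < ⊤) :
    IsFiniteMeasure (reducedPalm μ) := by
  have := isFiniteMeasure_palm hμθ hμ1
  unfold reducedPalm
  infer_instance

theorem deathPart_eq_map_reducedPalm [SFinite μ] (hμθ : IsShiftInvariant μ)
    (hμ1 : ∫⁻ η, (Config.count (unitCube d) η : ℝ≥0∞) ∂μ < ⊤) (hΛ : MeasurableSet Λ) :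
    deathPart μ Λ = ((volume.restrict Λ).prod (reducedPalm μ)).map moveOrigin := by
  have := isFiniteMeasure_palm hμθ hμ1
  exact (isPalm_palm hμθ hμ1).deathPart_eq_map hΛ

theorem map_moveOrigin_prod_apply {P : Measure (Config d)} [SFinite P] {A : Set (Space d)}
    (hA : MeasurableSet A) :
    (((volume.restrict Λ).prod P).map moveOrigin) {z | z.1 ∈ A} = volume (A ∩ Λ) * P Set.univ := by
  have hs : MeasurableSet {z : Space d × Config d | z.1 ∈ A} := measurable_fst hA
  rw [Measure.map_apply measurable_moveOrigin hs]
  have : moveOrigin ⁻¹' {z : Space d × Config d | z.1 ∈ A} = A ×ˢ (Set.univ : Set (Config d)) := by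
    ext z; simp [moveOrigin]
  rw [this, Measure.prod_prod, Measure.restrict_apply hA]

theorem isFiniteMeasure_deathPart [SFinite μ] (hμθ : IsShiftInvariant μ)
    (hμ1 : ∫⁻ η, (Config.count (unitCube d) η : ℝ≥0∞) ∂μ < ⊤) (hb : Bornology.IsBounded Λ)
    (hΛ : MeasurableSet Λ) : IsFiniteMeasure (deathPart μ Λ) := by
  have := isFiniteMeasure_reducedPalm hμθ hμ1
  have hfin : IsFiniteMeasure (volume.restrict Λ : Measure (Space d)) :=
    ⟨by rw [Measure.restrict_apply_univ]; exact hb.measure_lt_top⟩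
  rw [deathPart_eq_map_reducedPalm hμθ hμ1 hΛ]
  infer_instance

theorem IsInteraction.isFiniteMeasure_birthPart [IsFiniteMeasure μ] (hH : IsInteraction H)
    (hμθ : IsShiftInvariant μ) (hb : Bornology.IsBounded Λ) :
    IsFiniteMeasure (birthPart H μ Λ) := by
  have := hH.isFiniteMeasure_birthMeasure (μ := μ)
  have hfin : IsFiniteMeasure (volume.restrict Λ : Measure (Space d)) :=
    ⟨by rw [Measure.restrict_apply_univ]; exact hb.measure_lt_top⟩
  rw [hH.birthPart_eq_map hμθ]
  infer_instance

variable {X : Type*} [MeasurableSpace X] {P Q : Measure X}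

/-- log t ≤ t, and dP/dQ is Q-integrable; a bounded error does no harm. -/
theorem integrable_max_of_abs_sub_llr_le [IsFiniteMeasure P] [IsFiniteMeasure Q] {f : X → ℝ}
    (hf : Measurable f) {c : ℝ} (h : ∀ᵐ x ∂Q, |f x - llr P Q x| ≤ c) :
    Integrable (fun x => max (f x) 0) Q := by
  have h1 : Integrable (fun x => (P.rnDeriv Q x).toReal + c) Q :=
    Measure.integrable_toReal_rnDeriv.add (integrable_const c)
  refine h1.mono' (hf.max measurable_const).aestronglyMeasurable ?_
  filter_upwards [h] with x hx
  rw [Real.norm_of_nonneg (le_max_right _ _)]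
  have h2 : llr P Q x ≤ (P.rnDeriv Q x).toReal := Real.log_le_self ENNReal.toReal_nonneg
  have h3 : 0 ≤ (P.rnDeriv Q x).toReal := ENNReal.toReal_nonneg
  have h4 := (abs_nonneg _).trans hx
  have h5 := (abs_le.1 hx).2
  exact max_le (by linarith) (by linarith)

/-- The previous bound with the roles of P and Q exchanged, which flips the sign of the
log-likelihood ratio. -/
theorem integrable_max_neg_of_abs_sub_llr_le [IsFiniteMeasure P] [IsFiniteMeasure Q] {f : X → ℝ}
    (hf : Measurable f) (hPQ : P ≪ Q) {c : ℝ} (h : ∀ᵐ x ∂P, |f x - llr P Q x| ≤ c) :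
    Integrable (fun x => max (-f x) 0) P := by
  refine integrable_max_of_abs_sub_llr_le (P := Q) (Q := P) hf.neg (c := c) ?_
  filter_upwards [h, neg_llr hPQ] with x h1 h2
  rw [← h2, Pi.neg_apply, ← abs_neg]
  convert h1 using 2
  ring

theorem integrable_iff_of_abs_sub_le [IsFiniteMeasure Q] {f g : X → ℝ} (hf : Measurable f)
    (hg : Measurable g) {c : ℝ} (h : ∀ᵐ x ∂Q, |f x - g x| ≤ c) :
    Integrable f Q ↔ Integrable g Q := by
  have h1 : Integrable (fun x => f x - g x) Q :=
    (integrable_const c).mono' (hf.sub hg).aestronglyMeasurable h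
  constructor
  · intro h2
    refine (h2.sub h1).congr (ae_of_all _ fun x => ?_)
    simp
  · intro h2
    refine (h2.add h1).congr (ae_of_all _ fun x => ?_)
    simp

/-- The reference divergence of a window: the symmetrized divergence of the localized death and
birth parts. -/
noncomputable def localDiv (H : FinConfig d → ℝ) (μ : Measure (Config d)) (Λ : Set (Space d)) :
    ℝ≥0∞ :=
  symDiv ((deathPart μ Λ).map (localize Λ)) ((birthPart H μ Λ).map (localize Λ))

/-- The increment and the log-likelihood ratio differ by a bounded function, so they are integrable
together. One-sided integrability holds automatically and rules out cancellation between an infinite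
birth term and an infinite death term. -/
theorem IsInteraction.hasDissipation_iff [NeZero d] [IsProbabilityMeasure μ]
    (hH : IsInteraction H) (hν : IsGibbs H ν) (hμθ : IsShiftInvariant μ)
    (hμ1 : ∫⁻ η, (Config.count (unitCube d) η : ℝ≥0∞) ∂μ < ⊤)
    (hb : Bornology.IsBounded Λ) (hΛ : MeasurableSet Λ)
    (hμν : marginal Λ μ ≪ marginal Λ ν) (hνμ : marginal Λ ν ≪ marginal Λ μ) :
    (HasDissipation H μ ν Λ ↔ localDiv H μ Λ ≠ ∞) ∧
    (localDiv H μ Λ ≠ ∞ → Integrable (fun z => increment μ ν Λ (localize Λ z)) (birthPart H μ Λ) ∧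
      Integrable (fun z => increment μ ν Λ (localize Λ z)) (deathPart μ Λ)) := by
  have fC := isFiniteMeasure_deathPart hμθ hμ1 hb hΛ
  have fB := hH.isFiniteMeasure_birthPart hμθ hb
  obtain ⟨C, hC0, hC⟩ := hH.exists_bound
  -- No inner points are needed here: the uniform bound 2C is enough for integrability.
  obtain ⟨hCB, hBC, hB⟩ := hH.increment_sub_llr hν hb hΛ hμν hνμ hC (I := ∅) MeasurableSet.empty
    (by simp)
  have hT := measurable_localize hΛ
  set C' := (deathPart μ Λ).map (localize Λ) with hC'
  set B' := (birthPart H μ Λ).map (localize Λ) with hB'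
  have fC' : IsFiniteMeasure C' := by rw [hC']; infer_instance
  have fB' : IsFiniteMeasure B' := by rw [hB']; infer_instance
  have hB1 : ∀ᵐ z ∂B', |increment μ ν Λ z - llr C' B' z| ≤ 2 * C := by
    filter_upwards [hB] with z hz
    simpa using hz
  have hC1 := hCB.ae_le hB1
  have hm := measurable_increment (μ := μ) (ν := ν) (Λ := Λ)
  have iB : Integrable (fun z => increment μ ν Λ (localize Λ z)) (birthPart H μ Λ) ↔
      Integrable (llr C' B') B' := by
    rw [← integrable_iff_of_abs_sub_le hm (measurable_llr _ _) hB1, hB',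
      integrable_map_measure hm.aestronglyMeasurable hT.aemeasurable]
    rfl
  have iC : Integrable (fun z => increment μ ν Λ (localize Λ z)) (deathPart μ Λ) ↔
      Integrable (llr C' B') C' := by
    rw [← integrable_iff_of_abs_sub_le hm (measurable_llr _ _) hC1, hC',
      integrable_map_measure hm.aestronglyMeasurable hT.aemeasurable]
    rfl
  have hiff : localDiv H μ Λ ≠ ∞ ↔
      Integrable (fun z => increment μ ν Λ (localize Λ z)) (birthPart H μ Λ) ∧
      Integrable (fun z => increment μ ν Λ (localize Λ z)) (deathPart μ Λ) := by
    rw [localDiv, symDiv_ne_top_iff, iB, iC]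
    tauto
  refine ⟨?_, hiff.1⟩
  rw [hiff]
  constructor
  · rintro ⟨h1, h2⟩
    simp only [generatorDefinedAt_iff hb hΛ] at h1
    rw [dissipation_eq_netRate hb hΛ] at h2
    refine hH.integrable_of_integrable_netRate (h := fun z => increment μ ν Λ (localize Λ z))
      hb hΛ (measurable_increment_localize hΛ) h1 h2 ?_ ?_
    · have h3 := integrable_max_of_abs_sub_llr_le hm hB1
      rw [hB'] at h3
      exact h3.comp_measurable hT
    · have h3 := integrable_max_neg_of_abs_sub_llr_le hm hCB hC1
      rw [hC'] at h3
      exact h3.comp_measurable hT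
  · rintro ⟨h1, h2⟩
    refine ⟨?_, ?_⟩
    · simp only [generatorDefinedAt_iff hb hΛ]
      exact hH.ae_integrableOn_birthRate_mul (h := fun z => increment μ ν Λ (localize Λ z)) h1
    · rw [dissipation_eq_netRate hb hΛ]
      exact hH.integrable_netRate hΛ h1 h2

/-- In centred coordinates both measures are products with Lebesgue measure, so the boundary layer
enters through its volume only. -/
theorem IsInteraction.lintegral_indicator_boundary [IsProbabilityMeasure μ]
    (hH : IsInteraction H) (hμθ : IsShiftInvariant μ)
    (hμ1 : ∫⁻ η, (Config.count (unitCube d) η : ℝ≥0∞) ∂μ < ⊤) (hΛ : MeasurableSet Λ)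
    {I : Set (Space d)} (hI : MeasurableSet I) (c : ℝ≥0∞) :
    ∫⁻ z, Iᶜ.indicator (fun _ => c) z.1 ∂deathPart μ Λ +
      ∫⁻ z, Iᶜ.indicator (fun _ => c) z.1 ∂birthPart H μ Λ =
      c * volume (Λ \ I) * (reducedPalm μ Set.univ + birthMeasure H μ Set.univ) := by
  have := isFiniteMeasure_reducedPalm hμθ hμ1
  have := hH.isFiniteMeasure_birthMeasure (μ := μ)
  have h1 : ∀ κ : Measure (Space d × Config d), ∫⁻ z, Iᶜ.indicator (fun _ => c) z.1 ∂κ =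
      c * κ {z | z.1 ∈ Iᶜ} := fun κ => by
    have hs : MeasurableSet {z : Space d × Config d | z.1 ∈ Iᶜ} := measurable_fst hI.compl
    rw [← lintegral_indicator_const hs]
    rfl
  have h2 : Iᶜ ∩ Λ = Λ \ I := by rw [Set.inter_comm]; rfl
  rw [h1, h1, deathPart_eq_map_reducedPalm hμθ hμ1 hΛ, hH.birthPart_eq_map hμθ,
    map_moveOrigin_prod_apply hI.compl, map_moveOrigin_prod_apply hI.compl, h2]
  ring

end Dissipation

end

section

variable {d : ℕ}

/-! ### Divergence per unit volume of the localized birth and death measures -/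

section LocalDivergence

variable {H : FinConfig d → ℝ} {μ ν : Measure (Config d)} {Λ : Set (Space d)}

theorem map_withDensity_comp {X Y : Type*} [MeasurableSpace X] [MeasurableSpace Y] {M : Measure X}
    {f : X → Y} (hf : Measurable f) {r : Y → ℝ≥0∞} (hr : Measurable r) :
    (M.withDensity fun x => r (f x)).map f = (M.map f).withDensity r := by
  have hrf : Measurable fun x => r (f x) := hr.comp hf
  refine Measure.ext_of_lintegral _ fun g hg => ?_
  have hgf : Measurable fun x => g (f x) := hg.comp hf
  have hrg : Measurable fun y => r y * g y := hr.mul hg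
  rw [lintegral_map hg hf, lintegral_withDensity_eq_lintegral_mul _ hrf hgf,
    lintegral_withDensity_eq_lintegral_mul _ hr hg]
  exact (lintegral_map hrg hf).symm

/-- In centred coordinates the density does not involve the position, so it is a function of the
configuration seen from the point. -/
theorem llr_map_moveOrigin {P Q : Measure (Config d)} [IsFiniteMeasure P] [IsFiniteMeasure Q]
    {κ : Measure (Space d)} [IsFiniteMeasure κ] (h : P ≪ Q) :
    llr ((κ.prod P).map moveOrigin) ((κ.prod Q).map moveOrigin) =ᵐ[(κ.prod Q).map moveOrigin]
      fun z => llr P Q (z.2.shift z.1) := by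
  have hr : Measurable fun z : Space d × Config d => P.rnDeriv Q (z.2.shift z.1) :=
    (Measure.measurable_rnDeriv P Q).comp Config.measurable_shift_prod
  have h1 : (κ.prod P).map moveOrigin = ((κ.prod Q).map moveOrigin).withDensity
      fun z => P.rnDeriv Q (z.2.shift z.1) := by
    rw [← map_withDensity_comp measurable_moveOrigin hr]
    simp only [moveOrigin, Config.shift_shift_neg]
    rw [← prod_withDensity_right (Measure.measurable_rnDeriv P Q),
      Measure.withDensity_rnDeriv_eq _ _ h]
  have h2 := Measure.rnDeriv_withDensity ((κ.prod Q).map moveOrigin) hr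
  rw [← h1] at h2
  filter_upwards [h2] with z hz
  rw [llr, hz, llr]

/-- The symmetrized divergence of the reduced Palm measure and the birth measure. -/
noncomputable def palmDiv (H : FinConfig d → ℝ) (μ : Measure (Config d)) : ℝ≥0∞ :=
  symDiv (reducedPalm μ) (birthMeasure H μ)

/-- Centring is reversible and both measures become products with the same Lebesgue factor, which
contributes its mass. -/
theorem IsInteraction.symDiv_deathPart_birthPart [IsFiniteMeasure μ] (hH : IsInteraction H)
    (hμθ : IsShiftInvariant μ) (hμ1 : ∫⁻ η, (Config.count (unitCube d) η : ℝ≥0∞) ∂μ < ⊤)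
    (hb : Bornology.IsBounded Λ) (hΛ : MeasurableSet Λ) :
    symDiv (deathPart μ Λ) (birthPart H μ Λ) = volume Λ * palmDiv H μ := by
  have := isFiniteMeasure_reducedPalm hμθ hμ1
  have := hH.isFiniteMeasure_birthMeasure (μ := μ)
  have hfin : IsFiniteMeasure (volume.restrict Λ : Measure (Space d)) :=
    ⟨by rw [Measure.restrict_apply_univ]; exact hb.measure_lt_top⟩
  rw [deathPart_eq_map_reducedPalm hμθ hμ1 hΛ, hH.birthPart_eq_map hμθ,
    symDiv_map_of_leftInverse measurable_moveOrigin measurable_centerAt centerAt_moveOrigin,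
    symDiv_prod_left, Measure.restrict_apply_univ, palmDiv]

theorem IsInteraction.localDiv_le [IsFiniteMeasure μ] (hH : IsInteraction H)
    (hμθ : IsShiftInvariant μ) (hμ1 : ∫⁻ η, (Config.count (unitCube d) η : ℝ≥0∞) ∂μ < ⊤)
    (hb : Bornology.IsBounded Λ) (hΛ : MeasurableSet Λ) :
    localDiv H μ Λ ≤ volume Λ * palmDiv H μ := by
  have fC := isFiniteMeasure_deathPart hμθ hμ1 hb hΛ
  have fB := hH.isFiniteMeasure_birthPart hμθ hb
  rw [← hH.symDiv_deathPart_birthPart hμθ hμ1 hb hΛ]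
  exact symDiv_map_le (measurable_localize hΛ)

/-- The map `(x, η) ↦ (x, (θ_x η)_Δ)`. -/
def viewFrom (Δ : Set (Space d)) (z : Space d × Config d) : Space d × Config d :=
  (z.1, (z.2.shift z.1).restrict Δ)

theorem measurable_viewFrom {Δ : Set (Space d)} (hΔ : MeasurableSet Δ) : Measurable (viewFrom Δ) :=
  measurable_fst.prodMk ((Config.measurable_restrict hΔ).comp Config.measurable_shift_prod)

/-- For inner points the window around x lies in Λ, so what is seen through it is unaffected by
localization and the product structure survives. -/
theorem map_viewFrom_restrict {P : Measure (Config d)} [IsFiniteMeasure P] {I Δ : Set (Space d)}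
    (hΛ : MeasurableSet Λ) (hI : MeasurableSet I) (hΔ : MeasurableSet Δ)
    (hIΛ : I ⊆ Λ) (h : ∀ x ∈ I, ∀ y ∈ Δ, y + x ∈ Λ) :
    (((((volume.restrict Λ).prod P).map moveOrigin).map (localize Λ)).restrict
      {z | z.1 ∈ I}).map (viewFrom Δ) =
      (volume.restrict I).prod (P.map (Config.restrict Δ)) := by
  have hs : MeasurableSet {z : Space d × Config d | z.1 ∈ I} := measurable_fst hI
  have hTm : Measurable fun z : Space d × Config d => localize Λ (moveOrigin z) :=
    (measurable_localize hΛ).comp measurable_moveOrigin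
  have e1 : (((volume.restrict Λ).prod P).map moveOrigin).map (localize Λ) =
      ((volume.restrict Λ).prod P).map fun z => localize Λ (moveOrigin z) :=
    Measure.map_map (measurable_localize hΛ) measurable_moveOrigin
  have e2 : (fun z : Space d × Config d => localize Λ (moveOrigin z)) ⁻¹' {z | z.1 ∈ I} =
      I ×ˢ Set.univ := by
    ext z; simp [localize, moveOrigin]
  rw [e1, Measure.restrict_map hTm hs, e2, ← Measure.prod_restrict, Measure.restrict_univ,
    Measure.restrict_restrict hI, Set.inter_eq_left.2 hIΛ, Measure.map_map (measurable_viewFrom hΔ)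
    hTm]
  have e3 := Measure.map_prod_map (volume.restrict I : Measure (Space d)) P measurable_id
    (Config.measurable_restrict hΔ)
  rw [Measure.map_id] at e3
  rw [e3]
  refine Measure.map_congr ?_
  have e4 : ∀ᵐ z ∂((volume.restrict I : Measure (Space d)).prod P), z.1 ∈ I :=
    Measure.quasiMeasurePreserving_fst.ae (ae_restrict_mem hI)
  filter_upwards [e4] with z hz
  simp only [Function.comp, viewFrom, localize, moveOrigin, Prod.map, id]
  rw [Config.shift_restrict, Config.shift_shift_neg, Config.restrict_restrict_of_subset]
  exact fun y hy => h _ hz y hy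

/-- Two reductions that can only lower the divergence, discarding outer points and looking through
Δ, lead to a product whose divergence is explicit. -/
theorem IsInteraction.le_localDiv [IsFiniteMeasure μ] (hH : IsInteraction H)
    (hμθ : IsShiftInvariant μ) (hμ1 : ∫⁻ η, (Config.count (unitCube d) η : ℝ≥0∞) ∂μ < ⊤)
    (hb : Bornology.IsBounded Λ) (hΛ : MeasurableSet Λ) {I Δ : Set (Space d)}
    (hI : MeasurableSet I) (hΔ : MeasurableSet Δ)
    (hIΛ : I ⊆ Λ) (h : ∀ x ∈ I, ∀ y ∈ Δ, y + x ∈ Λ) :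
    volume I * symDiv ((reducedPalm μ).map (Config.restrict Δ))
      ((birthMeasure H μ).map (Config.restrict Δ)) ≤ localDiv H μ Λ := by
  have := isFiniteMeasure_reducedPalm hμθ hμ1
  have := hH.isFiniteMeasure_birthMeasure (μ := μ)
  have fC := isFiniteMeasure_deathPart hμθ hμ1 hb hΛ
  have fB := hH.isFiniteMeasure_birthPart hμθ hb
  have hfin : IsFiniteMeasure (volume.restrict I : Measure (Space d)) :=
    ⟨by rw [Measure.restrict_apply_univ]; exact (hb.subset hIΛ).measure_lt_top⟩
  have hs : MeasurableSet {z : Space d × Config d | z.1 ∈ I} := measurable_fst hI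
  have h1 := symDiv_map_le (P := ((deathPart μ Λ).map (localize Λ)).restrict {z | z.1 ∈ I})
    (Q := ((birthPart H μ Λ).map (localize Λ)).restrict {z | z.1 ∈ I}) (measurable_viewFrom hΔ)
  have h2 := symDiv_restrict_le (P := (deathPart μ Λ).map (localize Λ))
    (Q := (birthPart H μ Λ).map (localize Λ)) hs
  refine le_trans (le_of_eq ?_) (h1.trans h2)
  rw [deathPart_eq_map_reducedPalm hμθ hμ1 hΛ, hH.birthPart_eq_map hμθ,
    map_viewFrom_restrict hΛ hI hΔ hIΛ h, map_viewFrom_restrict hΛ hI hΔ hIΛ h, symDiv_prod_left,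
    Measure.restrict_apply_univ]

theorem add_mem_box_of_mem {m n : ℕ} (hmn : m ≤ n) {x y : Space d} (hx : x ∈ box d (n - m))
    (hy : y ∈ box d m) : y + x ∈ box d n := by
  intro i
  have h1 := hx i
  have h2 := hy i
  rw [Nat.cast_sub hmn] at h1
  have h4 : (y + x) i = y i + x i := by simp
  rw [h4]
  constructor
  · linarith [h1.1, h2.1]
  · linarith [h1.2, h2.2]

theorem comap_restrict_box_mono :
    Monotone fun m => MeasurableSpace.comap (Config.restrict (box d m))
      Config.instMeasurableSpace := by
  intro m n hmn
  rintro _ ⟨s, hs, rfl⟩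
  refine ⟨Config.restrict (box d m) ⁻¹' s, Config.measurable_restrict (measurableSet_box d m) hs, ?_⟩
  ext η
  simp only [Set.mem_preimage, Config.restrict_restrict_of_subset (box_mono d hmn)]

theorem le_iSup_comap_restrict_box :
    Config.instMeasurableSpace ≤ ⨆ m, MeasurableSpace.comap (Config.restrict (box d m))
      Config.instMeasurableSpace := by
  refine iSup_le fun Λ => iSup_le fun hb => iSup_le fun hm => ?_
  obtain ⟨m, hm'⟩ := exists_subset_box hb
  refine le_trans ?_ (le_iSup _ m)
  rintro _ ⟨s, hs, rfl⟩
  refine ⟨Config.count Λ ⁻¹' s, Config.measurable_count hb hm hs, ?_⟩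
  ext η
  have : Config.count Λ (η.restrict (box d m)) = Config.count Λ η := by
    simp only [Config.count, Config.restrict, Set.inter_assoc, Set.inter_eq_right.2 (hm' m le_rfl)]
  simp only [Set.mem_preimage, this]

/-- The upper bound holds for every n by data processing. For the lower bound the window is fixed
before n grows, and the inner points then fill the box asymptotically. -/
theorem IsInteraction.tendsto_localDiv [NeZero d] [IsFiniteMeasure μ] (hH : IsInteraction H)
    (hμθ : IsShiftInvariant μ) (hμ1 : ∫⁻ η, (Config.count (unitCube d) η : ℝ≥0∞) ∂μ < ⊤) :
    Tendsto (fun n => (volume (box d n))⁻¹ * localDiv H μ (box d n)) atTop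
      (𝓝 (palmDiv H μ)) := by
  have := isFiniteMeasure_reducedPalm hμθ hμ1
  have := hH.isFiniteMeasure_birthMeasure (μ := μ)
  have hJ := tendsto_symDiv_map (P := reducedPalm μ) (Q := birthMeasure H μ)
    (fun m => Config.measurable_restrict (measurableSet_box d m)) comap_restrict_box_mono
    le_iSup_comap_restrict_box
  rw [tendsto_order]
  constructor
  · intro a ha
    -- A window size whose divergence already exceeds the given lower level.
    obtain ⟨m, hm⟩ := (hJ.eventually (lt_mem_nhds ha)).exists
    have hlim : Tendsto (fun n => ((volume (box d n))⁻¹ * volume (box d (n - m))) *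
        symDiv ((reducedPalm μ).map (Config.restrict (box d m)))
          ((birthMeasure H μ).map (Config.restrict (box d m)))) atTop
        (𝓝 (1 * symDiv ((reducedPalm μ).map (Config.restrict (box d m)))
          ((birthMeasure H μ).map (Config.restrict (box d m))))) := by
      refine ENNReal.Tendsto.mul_const ?_ (Or.inl one_ne_zero)
      have h1 := (tendsto_volume_box_boundary d 0 m).const_sub 1
      rw [sub_zero] at h1
      have h2 := ENNReal.tendsto_ofReal h1
      rw [ENNReal.ofReal_one] at h2
      refine h2.congr' ?_
      filter_upwards [eventually_ge_atTop 1] with n hn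
      have hn' : (n : ℝ) ≠ 0 := by positivity
      have hpos : 0 < (volume (box d n)).toReal := by rw [toReal_volume_box]; positivity
      rw [add_zero, toReal_volume_box_sdiff (Nat.sub_le n m), ← toReal_volume_box,
        ← toReal_volume_box, mul_sub, inv_mul_cancel₀ hpos.ne', sub_sub_cancel,
        ENNReal.ofReal_mul (by positivity), ENNReal.ofReal_inv_of_pos hpos,
        ENNReal.ofReal_toReal (volume_box_lt_top d n).ne,
        ENNReal.ofReal_toReal (volume_box_lt_top d _).ne]
    rw [one_mul] at hlim
    filter_upwards [hlim.eventually (lt_mem_nhds hm), eventually_ge_atTop m] with n h1 h2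
    refine h1.trans_le ?_
    rw [mul_assoc]
    gcongr
    exact hH.le_localDiv hμθ hμ1 (isBounded_box d n) (measurableSet_box d n)
      (measurableSet_box d _) (measurableSet_box d m) (box_mono d (Nat.sub_le n m))
      fun x hx y hy => add_mem_box_of_mem h2 hx hy
  · intro a ha
    refine Eventually.of_forall fun n => lt_of_le_of_lt ?_ ha
    calc (volume (box d n))⁻¹ * localDiv H μ (box d n)
        ≤ (volume (box d n))⁻¹ * (volume (box d n) * palmDiv H μ) := by
          gcongr
          exact hH.localDiv_le hμθ hμ1 (isBounded_box d n) (measurableSet_box d n)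
      _ ≤ 1 * palmDiv H μ := by
          rw [← mul_assoc]
          gcongr
          exact ENNReal.inv_mul_le_one _
      _ = _ := one_mul _

end LocalDivergence

end

section

variable {d : ℕ}

/-! ### Comparison of the dissipation with the local divergence and with Palm averages -/

section Production

variable {H : FinConfig d → ℝ} {μ ν : Measure (Config d)} {Λ : Set (Space d)}

theorem IsInteraction.exists_boundary_width [NeZero d] (hH : IsInteraction H) :
    ∃ m : ℕ, ∀ n : ℕ, ∀ x ∈ box d (n - m), ∀ η : Config d,
      birthRate H x (η.restrict (box d n)) = birthRate H x η := by
  obtain ⟨R, -, h⟩ := hH.exists_range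
  -- A side length smaller by 2R keeps the ball of radius R around each inner point inside the box.
  obtain ⟨m, hm⟩ := exists_nat_ge (2 * R)
  refine ⟨m, fun n x hx η => ?_⟩
  rw [birthRate, birthRate, ← h x (box d n)]
  intro z hz
  have h1 : ‖x - z‖ ≤ R := by rw [← dist_eq_norm, dist_comm]; exact hz
  have h2 := sub_mem_box (y := x - z) (m := m) (by linarith) hx
  rwa [sub_sub_cancel] at h2

/-- The bound on boundary effects in the comparison with the local divergence. -/
noncomputable def boundaryBound (H : FinConfig d → ℝ) (μ : Measure (Config d)) (C : ℝ)
    (A : Set (Space d)) : ℝ≥0∞ :=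
  ENNReal.ofReal (2 * C) * volume A * (reducedPalm μ Set.univ + birthMeasure H μ Set.univ)

/-- A window `Λ` in which the marginals of `μ` and `ν` are equivalent, with a subset `I` of points
whose birth rates depend only on the configuration in `Λ`. -/
structure IsWindow (H : FinConfig d → ℝ) (μ ν : Measure (Config d)) (Λ I : Set (Space d)) (C : ℝ) :
    Prop where
  isBounded : Bornology.IsBounded Λ
  measurableSet : MeasurableSet Λ
  marginal_ac : marginal Λ μ ≪ marginal Λ ν
  ac_marginal : marginal Λ ν ≪ marginal Λ μ
  birthRate_mem : ∀ (x : Space d) (η : Config d),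
    Real.exp (-C) ≤ birthRate H x η ∧ birthRate H x η ≤ Real.exp C
  measurableSet_inner : MeasurableSet I
  birthRate_restrict : ∀ x ∈ I, ∀ η : Config d,
    birthRate H x (η.restrict Λ) = birthRate H x η

variable {I : Set (Space d)} {C : ℝ}

/-- The difference between the increment of the log-density and the log-density of the localized
death and birth parts. -/
noncomputable def boundaryDefect (H : FinConfig d → ℝ) (μ ν : Measure (Config d))
    (Λ : Set (Space d)) (z : Space d × Config d) : ℝ :=
  increment μ ν Λ (localize Λ z) - llr ((deathPart μ Λ).map (localize Λ))
    ((birthPart H μ Λ).map (localize Λ)) (localize Λ z)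

theorem IsWindow.lintegral_boundaryDefect_le [NeZero d] [IsProbabilityMeasure μ]
    (hw : IsWindow H μ ν Λ I C) (hH : IsInteraction H) (hν : IsGibbs H ν)
    (hμθ : IsShiftInvariant μ) (hμ1 : ∫⁻ η, (Config.count (unitCube d) η : ℝ≥0∞) ∂μ < ⊤) :
    ∫⁻ z, ‖boundaryDefect H μ ν Λ z‖ₑ ∂deathPart μ Λ +
      ∫⁻ z, ‖boundaryDefect H μ ν Λ z‖ₑ ∂birthPart H μ Λ ≤ boundaryBound H μ C (Λ \ I) := by
  obtain ⟨hCB, -, hB⟩ := hH.increment_sub_llr hν hw.isBounded hw.measurableSet hw.marginal_ac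
    hw.ac_marginal hw.birthRate_mem hw.measurableSet_inner hw.birthRate_restrict
  have hT := measurable_localize hw.measurableSet
  have h1 := ae_of_ae_map hT.aemeasurable hB
  have h2 := ae_of_ae_map hT.aemeasurable (hCB.ae_le hB)
  have hle : ∀ z : Space d × Config d, |boundaryDefect H μ ν Λ z| ≤
      Iᶜ.indicator (fun _ => 2 * C) z.1 →
      ‖boundaryDefect H μ ν Λ z‖ₑ ≤ Iᶜ.indicator (fun _ => ENNReal.ofReal (2 * C)) z.1 := by
    intro z hz
    rw [Real.enorm_eq_ofReal_abs]
    refine (ENNReal.ofReal_le_ofReal hz).trans_eq ?_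
    by_cases hI : z.1 ∈ I <;> simp [hI]
  rw [boundaryBound, ← hH.lintegral_indicator_boundary hμθ hμ1 hw.measurableSet
    hw.measurableSet_inner]
  refine add_le_add (lintegral_mono_ae ?_) (lintegral_mono_ae ?_)
  · filter_upwards [h2] with z hz using hle z hz
  · filter_upwards [h1] with z hz using hle z hz

theorem IsInteraction.boundaryBound_ne_top [IsProbabilityMeasure μ] (hH : IsInteraction H)
    (hμθ : IsShiftInvariant μ) (hμ1 : ∫⁻ η, (Config.count (unitCube d) η : ℝ≥0∞) ∂μ < ⊤)
    {A : Set (Space d)} (hA : Bornology.IsBounded A) : boundaryBound H μ C A ≠ ∞ := by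
  have := isFiniteMeasure_reducedPalm hμθ hμ1
  have := hH.isFiniteMeasure_birthMeasure (μ := μ)
  exact ENNReal.mul_ne_top (ENNReal.mul_ne_top ENNReal.ofReal_ne_top hA.measure_lt_top.ne)
    (ENNReal.add_ne_top.2 ⟨measure_ne_top _ _, measure_ne_top _ _⟩)

/-- The mean dissipation equals the local divergence up to boundary effects. -/
theorem IsWindow.abs_integral_dissipation_sub_le [NeZero d] [IsProbabilityMeasure μ]
    (hw : IsWindow H μ ν Λ I C) (hH : IsInteraction H) (hν : IsGibbs H ν)
    (hμθ : IsShiftInvariant μ) (hμ1 : ∫⁻ η, (Config.count (unitCube d) η : ℝ≥0∞) ∂μ < ⊤)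
    (hfin : localDiv H μ Λ ≠ ∞) :
    |∫ η, dissipation H μ ν Λ η ∂μ - (localDiv H μ Λ).toReal| ≤
      (boundaryBound H μ C (Λ \ I)).toReal := by
  have hΛ := hw.measurableSet
  have fC := isFiniteMeasure_deathPart hμθ hμ1 hw.isBounded hΛ
  have fB := hH.isFiniteMeasure_birthPart hμθ hw.isBounded
  obtain ⟨iB, iC⟩ := (hH.hasDissipation_iff hν hμθ hμ1 hw.isBounded hΛ hw.marginal_ac
    hw.ac_marginal).2 hfin
  have hT := measurable_localize hΛ
  obtain ⟨-, -, lC, lB⟩ := symDiv_ne_top_iff.1 hfin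
  have lC' := lC.comp_measurable hT
  have lB' := lB.comp_measurable hT
  have dC : Integrable (boundaryDefect H μ ν Λ) (deathPart μ Λ) := iC.sub lC'
  have dB : Integrable (boundaryDefect H μ ν Λ) (birthPart H μ Λ) := iB.sub lB'
  -- The mean dissipation and the local divergence are both death integrals minus birth integrals,
  -- so their difference is that of the defect.
  have e1 : ∫ z, boundaryDefect H μ ν Λ z ∂deathPart μ Λ - ∫ z, boundaryDefect H μ ν Λ z
      ∂birthPart H μ Λ = ∫ η, dissipation H μ ν Λ η ∂μ - (localDiv H μ Λ).toReal := by
    rw [dissipation_eq_netRate hw.isBounded hΛ, hH.integral_netRate hΛ iB iC, localDiv,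
      toReal_symDiv hfin, integral_map hT.aemeasurable (measurable_llr _ _).aestronglyMeasurable,
      integral_map hT.aemeasurable (measurable_llr _ _).aestronglyMeasurable]
    have a1 : ∫ z, boundaryDefect H μ ν Λ z ∂deathPart μ Λ = _ := integral_sub iC lC'
    have a2 : ∫ z, boundaryDefect H μ ν Λ z ∂birthPart H μ Λ = _ := integral_sub iB lB'
    rw [a1, a2]
    ring
  rw [← e1]
  have e2 : ∀ {κ : Measure (Space d × Config d)}, Integrable (boundaryDefect H μ ν Λ) κ →
      |∫ z, boundaryDefect H μ ν Λ z ∂κ| ≤ (∫⁻ z, ‖boundaryDefect H μ ν Λ z‖ₑ ∂κ).toReal := by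
    intro κ hκ
    have h1 := enorm_integral_le_lintegral_enorm (μ := κ) (boundaryDefect H μ ν Λ)
    have h2 := ENNReal.toReal_mono hκ.2.ne h1
    rwa [toReal_enorm] at h2
  refine (abs_sub _ _).trans ((add_le_add (e2 dC) (e2 dB)).trans ?_)
  rw [← ENNReal.toReal_add dC.2.ne dB.2.ne]
  exact ENNReal.toReal_mono (hH.boundaryBound_ne_top hμθ hμ1
    (hw.isBounded.subset Set.sdiff_subset)) (hw.lintegral_boundaryDefect_le hH hν hμθ hμ1)

/-- The dissipation is close in `L¹` to the net rate of the log-density of the Palm measure. -/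
theorem IsWindow.lintegral_dissipation_sub_le [NeZero d] [IsProbabilityMeasure μ]
    (hw : IsWindow H μ ν Λ I C) (hH : IsInteraction H) (hν : IsGibbs H ν)
    (hμθ : IsShiftInvariant μ) (hμ1 : ∫⁻ η, (Config.count (unitCube d) η : ℝ≥0∞) ∂μ < ⊤)
    (hfin : palmDiv H μ ≠ ∞) {ε : ℝ} (hε : 0 < ε) :
    ∫⁻ η, ‖dissipation H μ ν Λ η - netRate H Λ
        (fun z => llr (reducedPalm μ) (birthMeasure H μ) (z.2.shift z.1)) η‖ₑ ∂μ ≤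
      ENNReal.ofReal (ε * ((volume Λ).toReal * ((reducedPalm μ).real Set.univ +
        (birthMeasure H μ).real Set.univ)) + (1 / ε + 2) *
          ((volume Λ).toReal * (palmDiv H μ).toReal - (localDiv H μ Λ).toReal)) +
        boundaryBound H μ C (Λ \ I) := by
  have hΛ := hw.measurableSet
  have fP := isFiniteMeasure_reducedPalm hμθ hμ1
  have fQ := hH.isFiniteMeasure_birthMeasure (μ := μ)
  have fC := isFiniteMeasure_deathPart hμθ hμ1 hw.isBounded hΛ
  have fB := hH.isFiniteMeasure_birthPart hμθ hw.isBounded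
  have fΛ : IsFiniteMeasure (volume.restrict Λ : Measure (Space d)) :=
    ⟨by rw [Measure.restrict_apply_univ]; exact hw.isBounded.measure_lt_top⟩
  have hT := measurable_localize hΛ
  set g : Space d × Config d → ℝ :=
    fun z => llr (reducedPalm μ) (birthMeasure H μ) (z.2.shift z.1) with hg
  have hgm : Measurable g := (measurable_llr _ _).comp Config.measurable_shift_prod
  have hCB : symDiv (deathPart μ Λ) (birthPart H μ Λ) = volume Λ * palmDiv H μ :=
    hH.symDiv_deathPart_birthPart hμθ hμ1 hw.isBounded hΛ
  have hCBfin : symDiv (deathPart μ Λ) (birthPart H μ Λ) ≠ ∞ := by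
    rw [hCB]; exact ENNReal.mul_ne_top hw.isBounded.measure_lt_top.ne hfin
  have hloc : localDiv H μ Λ ≠ ∞ :=
    ne_top_of_le_ne_top hCBfin (symDiv_map_le hT)
  obtain ⟨acCB, acBC, lC, lB⟩ := symDiv_ne_top_iff.1 hCBfin
  obtain ⟨acPQ, -, -, -⟩ := symDiv_ne_top_iff.1 hfin
  -- Before localization the log-density is the Palm log-density seen from the point.
  have gB : llr (deathPart μ Λ) (birthPart H μ Λ) =ᵐ[birthPart H μ Λ] g := by
    rw [deathPart_eq_map_reducedPalm hμθ hμ1 hΛ, hH.birthPart_eq_map hμθ]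
    exact llr_map_moveOrigin acPQ
  have gC := acCB.ae_eq gB
  have giB : Integrable g (birthPart H μ Λ) := lB.congr gB
  have iB := ((hH.hasDissipation_iff hν hμθ hμ1 hw.isBounded hΛ hw.marginal_ac
    hw.ac_marginal).2 hloc).1
  have hGm := measurable_increment_localize (μ := μ) (ν := ν) hΛ
  obtain ⟨uC, uB, hu⟩ := integral_abs_llr_sub_le hCBfin hT hε
  set u : Space d × Config d → ℝ := fun z => llr (deathPart μ Λ) (birthPart H μ Λ) z -
    llr ((deathPart μ Λ).map (localize Λ)) ((birthPart H μ Λ).map (localize Λ)) (localize Λ z)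
    with hu_def
  have hum : Measurable u := (measurable_llr _ _).sub ((measurable_llr _ _).comp hT)
  -- Two sources of error: the boundary defect, and the change `u` of the log-density caused by
  -- localization.
  have hpt : ∀ z, llr (deathPart μ Λ) (birthPart H μ Λ) z = g z →
      ‖increment μ ν Λ (localize Λ z) - g z‖ₑ ≤ ‖u z‖ₑ + ‖boundaryDefect H μ ν Λ z‖ₑ := by
    intro z hz
    have h1 : increment μ ν Λ (localize Λ z) - g z = boundaryDefect H μ ν Λ z - u z := by
      rw [← hz, boundaryDefect, hu_def]; ring
    rw [h1, add_comm]
    exact enorm_sub_le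
  have e2 : ∀ {κ : Measure (Space d × Config d)}, Integrable u κ →
      ∫⁻ z, ‖u z‖ₑ ∂κ = ENNReal.ofReal (∫ z, |u z| ∂κ) := by
    intro κ hκ
    rw [ofReal_integral_eq_lintegral_ofReal hκ.abs (ae_of_all _ fun _ => abs_nonneg _)]
    exact lintegral_congr fun z => Real.enorm_eq_ofReal_abs _
  have hmass : (deathPart μ Λ).real Set.univ + (birthPart H μ Λ).real Set.univ =
      (volume Λ).toReal * ((reducedPalm μ).real Set.univ + (birthMeasure H μ).real Set.univ) := by
    have m : ∀ (P : Measure (Config d)) [IsFiniteMeasure P],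
        (((volume.restrict Λ).prod P).map moveOrigin).real Set.univ =
          (volume Λ).toReal * P.real Set.univ := by
      intro P _
      rw [Measure.real, Measure.map_apply measurable_moveOrigin MeasurableSet.univ,
        Set.preimage_univ, ← Set.univ_prod_univ, Measure.prod_prod, Measure.restrict_apply_univ,
        ENNReal.toReal_mul, Measure.real]
    rw [deathPart_eq_map_reducedPalm hμθ hμ1 hΛ, hH.birthPart_eq_map hμθ, m, m, mul_add]
  calc ∫⁻ η, ‖dissipation H μ ν Λ η - netRate H Λ g η‖ₑ ∂μ
      = ∫⁻ η, ‖netRate H Λ (fun z => increment μ ν Λ (localize Λ z) - g z) η‖ₑ ∂μ := by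
        rw [dissipation_eq_netRate hw.isBounded hΛ]
        refine lintegral_congr_ae ?_
        filter_upwards [hH.netRate_sub hw.isBounded hΛ hGm hgm iB giB] with η hη
        rw [hη]
    _ ≤ ∫⁻ z, ‖increment μ ν Λ (localize Λ z) - g z‖ₑ ∂deathPart μ Λ +
        ∫⁻ z, ‖increment μ ν Λ (localize Λ z) - g z‖ₑ ∂birthPart H μ Λ :=
        hH.lintegral_enorm_netRate_le hΛ (hGm.sub hgm)
    _ ≤ ∫⁻ z, (‖u z‖ₑ + ‖boundaryDefect H μ ν Λ z‖ₑ) ∂deathPart μ Λ +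
        ∫⁻ z, (‖u z‖ₑ + ‖boundaryDefect H μ ν Λ z‖ₑ) ∂birthPart H μ Λ := by
        refine add_le_add (lintegral_mono_ae ?_) (lintegral_mono_ae ?_)
        · filter_upwards [gC] with z hz using hpt z hz
        · filter_upwards [gB] with z hz using hpt z hz
    _ = (∫⁻ z, ‖u z‖ₑ ∂deathPart μ Λ + ∫⁻ z, ‖u z‖ₑ ∂birthPart H μ Λ) +
        (∫⁻ z, ‖boundaryDefect H μ ν Λ z‖ₑ ∂deathPart μ Λ +
          ∫⁻ z, ‖boundaryDefect H μ ν Λ z‖ₑ ∂birthPart H μ Λ) := by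
        rw [lintegral_add_left hum.enorm, lintegral_add_left hum.enorm]
        abel
    _ ≤ _ := by
        refine add_le_add ?_ (hw.lintegral_boundaryDefect_le hH hν hμθ hμ1)
        rw [e2 uC, e2 uB, ← ENNReal.ofReal_add (integral_nonneg fun _ => abs_nonneg _)
          (integral_nonneg fun _ => abs_nonneg _)]
        -- The stability estimate for data processing, with masses and divergences rewritten through
        -- the Palm quantities.
        refine ENNReal.ofReal_le_ofReal ?_
        rw [← hmass, ← ENNReal.toReal_mul, ← hCB]
        exact hu

end Production

end

section

variable {d : ℕ}

/-! ### Limits per unit volume -/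

section Limits

variable {H : FinConfig d → ℝ} {μ ν : Measure (Config d)} {C : ℝ} {m : ℕ}

theorem tendsto_boundaryBound (H : FinConfig d → ℝ) (μ : Measure (Config d)) (C : ℝ) (m : ℕ)
    (hfin : reducedPalm μ Set.univ + birthMeasure H μ Set.univ ≠ ∞) :
    Tendsto (fun n => ‖(volume (box d n)).toReal⁻¹‖ₑ *
      boundaryBound H μ C (box d n \ box d (n - m))) atTop (𝓝 0) := by
  have h := ENNReal.Tendsto.mul_const (b := ENNReal.ofReal (2 * C) *
    (reducedPalm μ Set.univ + birthMeasure H μ Set.univ))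
    (tendsto_enorm_volume_box_boundary d 0 m)
    (Or.inr (ENNReal.mul_ne_top ENNReal.ofReal_ne_top hfin))
  rw [zero_mul] at h
  refine h.congr fun n => ?_
  rw [boundaryBound, add_zero]
  ring

theorem IsInteraction.mass_ne_top [IsProbabilityMeasure μ] (hH : IsInteraction H)
    (hμθ : IsShiftInvariant μ) (hμ1 : ∫⁻ η, (Config.count (unitCube d) η : ℝ≥0∞) ∂μ < ⊤) :
    reducedPalm μ Set.univ + birthMeasure H μ Set.univ ≠ ∞ := by
  have := isFiniteMeasure_reducedPalm hμθ hμ1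
  have := hH.isFiniteMeasure_birthMeasure (μ := μ)
  exact ENNReal.add_ne_top.2 ⟨measure_ne_top _ _, measure_ne_top _ _⟩

theorem toReal_volume_box_pos {n : ℕ} (hn : 1 ≤ n) : 0 < (volume (box d n)).toReal := by
  rw [toReal_volume_box]; positivity

/-- The normalized entropy production is the normalized local divergence plus a real null sequence,
and both are infinite for the same windows. -/
theorem IsInteraction.tendsto_entropyProduction [NeZero d] [IsProbabilityMeasure μ]
    (hH : IsInteraction H) (hν : IsGibbs H ν)
    (hμθ : IsShiftInvariant μ) (hμ1 : ∫⁻ η, (Config.count (unitCube d) η : ℝ≥0∞) ∂μ < ⊤)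
    (hw : ∀ n, IsWindow H μ ν (box d n) (box d (n - m)) C) :
    Tendsto (fun n : ℕ => (((volume (box d n)).toReal⁻¹ : ℝ) : EReal) *
      entropyProduction H μ ν (box d n)) atTop (𝓝 (palmDiv H μ : EReal)) := by
  classical
  -- When the divergence is infinite the value 0 is harmless: adding a real number to ⊤ changes
  -- nothing.
  set δ : ℕ → ℝ := fun n => if localDiv H μ (box d n) = ∞ then 0 else
    (volume (box d n)).toReal⁻¹ * (∫ η, dissipation H μ ν (box d n) η ∂μ -
      (localDiv H μ (box d n)).toReal) with hδ
  have hδ0 : Tendsto δ atTop (𝓝 0) := by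
    have h1 := (ENNReal.tendsto_toReal ENNReal.zero_ne_top).comp
      (tendsto_boundaryBound H μ C m (hH.mass_ne_top hμθ hμ1))
    rw [ENNReal.toReal_zero] at h1
    refine squeeze_zero_norm (fun n => ?_) h1
    rw [Function.comp_apply, ENNReal.toReal_mul, toReal_enorm, Real.norm_eq_abs]
    simp only [hδ]
    split_ifs with h
    · rw [abs_zero]; positivity
    · rw [abs_mul, Real.norm_eq_abs]
      gcongr
      exact (hw n).abs_integral_dissipation_sub_le hH hν hμθ hμ1 h
  have h1 : Tendsto (fun n => (((volume (box d n))⁻¹ * localDiv H μ (box d n) : ℝ≥0∞) : EReal))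
      atTop (𝓝 (palmDiv H μ : EReal)) :=
    (continuous_coe_ennreal_ereal.tendsto _).comp (hH.tendsto_localDiv hμθ hμ1)
  have h2 : Tendsto (fun n => (δ n : EReal)) atTop (𝓝 ((0 : ℝ) : EReal)) :=
    (continuous_coe_real_ereal.tendsto _).comp hδ0
  have h3 : Tendsto (fun n => (((volume (box d n))⁻¹ * localDiv H μ (box d n) : ℝ≥0∞) : EReal) +
      (δ n : EReal)) atTop (𝓝 ((palmDiv H μ : EReal) + ((0 : ℝ) : EReal))) := by
    have h4 := (EReal.continuousAt_add (p := ((palmDiv H μ : EReal), ((0 : ℝ) : EReal)))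
      (Or.inr (EReal.coe_ne_bot 0)) (Or.inr (EReal.coe_ne_top 0))).tendsto
    exact h4.comp (h1.prodMk_nhds h2)
  rw [EReal.coe_zero, add_zero] at h3
  refine h3.congr' ?_
  filter_upwards [eventually_ge_atTop 1] with n hn
  have hpos := toReal_volume_box_pos (d := d) hn
  have hiff := (hH.hasDissipation_iff hν hμθ hμ1 (hw n).isBounded (hw n).measurableSet
    (hw n).marginal_ac (hw n).ac_marginal).1
  by_cases h : localDiv H μ (box d n) = ∞
  · have hnd : ¬ HasDissipation H μ ν (box d n) := fun h' => hiff.1 h' h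
    rw [entropyProduction, if_neg hnd, EReal.coe_mul_top_of_pos (inv_pos.2 hpos), h,
      ENNReal.mul_top (ENNReal.inv_ne_zero.2 (volume_box_lt_top d n).ne), EReal.coe_ennreal_top]
    simp [hδ, h]
  · have hd := hiff.2 h
    rw [entropyProduction, if_pos hd, ← EReal.coe_mul]
    have hne : (volume (box d n))⁻¹ * localDiv H μ (box d n) ≠ ∞ := by
      refine ENNReal.mul_ne_top (ENNReal.inv_ne_top.2 ?_) h
      intro h0
      rw [h0, ENNReal.toReal_zero] at hpos
      exact lt_irrefl _ hpos
    rw [← EReal.coe_ennreal_toReal hne, ← EReal.coe_add, ENNReal.toReal_mul, ENNReal.toReal_inv]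
    simp only [hδ, if_neg h]
    congr 1
    ring

/-- Per unit volume the error is ε times a fixed mass, plus 1/ε + 2 times the lost divergence, plus
a boundary term. Choose ε first; for this fixed ε the last two vanish as n grows. -/
theorem IsInteraction.tendsto_lintegral_dissipation_sub [NeZero d] [IsProbabilityMeasure μ]
    (hH : IsInteraction H) (hν : IsGibbs H ν)
    (hμθ : IsShiftInvariant μ) (hμ1 : ∫⁻ η, (Config.count (unitCube d) η : ℝ≥0∞) ∂μ < ⊤)
    (hw : ∀ n, IsWindow H μ ν (box d n) (box d (n - m)) C) (hfin : palmDiv H μ ≠ ∞) :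
    Tendsto (fun n => ‖(volume (box d n)).toReal⁻¹‖ₑ *
      ∫⁻ η, ‖dissipation H μ ν (box d n) η - netRate H (box d n)
        (fun z => llr (reducedPalm μ) (birthMeasure H μ) (z.2.shift z.1)) η‖ₑ ∂μ)
      atTop (𝓝 0) := by
  set S : ℝ := (reducedPalm μ).real Set.univ + (birthMeasure H μ).real Set.univ with hS
  have hloc : Tendsto (fun n => (volume (box d n)).toReal⁻¹ * (localDiv H μ (box d n)).toReal)
      atTop (𝓝 (palmDiv H μ).toReal) := by
    refine ((ENNReal.tendsto_toReal hfin).comp (hH.tendsto_localDiv hμθ hμ1)).congr fun n => ?_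
    rw [Function.comp_apply, ENNReal.toReal_mul, ENNReal.toReal_inv]
  rw [ENNReal.tendsto_nhds_zero]
  intro δ hδ
  have hε : Tendsto (fun ε : ℝ => ENNReal.ofReal (ε * S)) (𝓝[>] 0) (𝓝 0) := by
    have : Tendsto (fun ε : ℝ => ENNReal.ofReal (ε * S)) (𝓝 0) (𝓝 (ENNReal.ofReal (0 * S))) :=
      ENNReal.tendsto_ofReal (tendsto_id.mul_const S)
    rw [zero_mul, ENNReal.ofReal_zero] at this
    exact this.mono_left nhdsWithin_le_nhds
  obtain ⟨ε, hεδ, hε0⟩ := ((hε.eventually (gt_mem_nhds hδ)).and self_mem_nhdsWithin).exists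
  have hε0' : 0 < ε := hε0
  have hlim : Tendsto (fun n => ENNReal.ofReal (ε * S + (1 / ε + 2) *
      ((palmDiv H μ).toReal - (volume (box d n)).toReal⁻¹ * (localDiv H μ (box d n)).toReal)) +
      ‖(volume (box d n)).toReal⁻¹‖ₑ * boundaryBound H μ C (box d n \ box d (n - m))) atTop
      (𝓝 (ENNReal.ofReal (ε * S + (1 / ε + 2) * ((palmDiv H μ).toReal - (palmDiv H μ).toReal)) +
        0)) :=
    (ENNReal.tendsto_ofReal (((hloc.const_sub _).const_mul _).const_add _)).add
      (tendsto_boundaryBound H μ C m (hH.mass_ne_top hμθ hμ1))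
  rw [sub_self, mul_zero, add_zero, add_zero] at hlim
  filter_upwards [hlim.eventually (gt_mem_nhds hεδ), eventually_ge_atTop 1] with n h1 hn
  refine le_trans ?_ h1.le
  have hpos := toReal_volume_box_pos (d := d) hn
  refine (mul_le_mul_right ((hw n).lintegral_dissipation_sub_le hH hν hμθ hμ1 hfin hε0')
    _).trans_eq ?_
  rw [mul_add]
  congr 1
  rw [Real.enorm_of_nonneg (by positivity), ← ENNReal.ofReal_mul (by positivity)]
  congr 1
  have hV := inv_mul_cancel₀ hpos.ne'
  simp only [hS]
  linear_combination (ε * ((reducedPalm μ).real Set.univ + (birthMeasure H μ).real Set.univ) +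
    (1 / ε + 2) * (palmDiv H μ).toReal) * hV

end Limits

/-! ### Ergodic limit of the Palm log-density -/

section PalmLimit

variable {H : FinConfig d → ℝ} {μ : Measure (Config d)}

theorem IsInteraction.birthMeasure_ac (hH : IsInteraction H) : μ ≪ birthMeasure H μ :=
  withDensity_absolutelyContinuous' (hH.measurable_birthRate_right 0).ennreal_ofReal.aemeasurable
    (ae_of_all _ fun η => (ENNReal.ofReal_pos.2 (birthRate_pos 0 η)).ne')

theorem IsInteraction.integrable_birthRate_mul [IsProbabilityMeasure μ] (hH : IsInteraction H)
    {f : Config d → ℝ} (hf : Integrable f (birthMeasure H μ)) :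
    Integrable (fun η => birthRate H 0 η * f η) μ := by
  rw [birthMeasure, integrable_withDensity_iff_integrable_smul'
    (hH.measurable_birthRate_right 0).ennreal_ofReal
    (ae_of_all _ fun z => ENNReal.ofReal_lt_top)] at hf
  simpa only [ENNReal.toReal_ofReal (birthRate_pos _ _).le, smul_eq_mul] using hf

/-- Spatial averages of the log-density of the reduced Palm measure converge in `L¹`. -/
theorem IsInteraction.exists_tendsto_netRate [NeZero d] [IsProbabilityMeasure μ]
    (hH : IsInteraction H)
    (hμθ : IsShiftInvariant μ) (hμ1 : ∫⁻ η, (Config.count (unitCube d) η : ℝ≥0∞) ∂μ < ⊤)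
    (hfin : palmDiv H μ ≠ ∞) :
    Integrable (fun η => birthRate H 0 η * llr (birthMeasure H μ) (reducedPalm μ) η) μ ∧
    ∃ Y : Config d → ℝ,
      IsPalmCondExp μ (fun η => llr (reducedPalm μ) (birthMeasure H μ) (removeOrigin η)) Y ∧
      Tendsto (fun n : ℕ => eLpNorm (fun η => (volume (box d n)).toReal⁻¹ * netRate H (box d n)
          (fun z => llr (reducedPalm μ) (birthMeasure H μ) (z.2.shift z.1)) η -
        ((μ[fun ζ => birthRate H 0 ζ * llr (birthMeasure H μ) (reducedPalm μ) ζ |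
          invariantSets d]) η + Y η)) 1 μ) atTop (𝓝 0) := by
  have fP := isFiniteMeasure_reducedPalm hμθ hμ1
  have fQ := hH.isFiniteMeasure_birthMeasure (μ := μ)
  obtain ⟨acPQ, acQP, iP, iQ⟩ := symDiv_ne_top_iff.1 hfin
  have hneg := neg_llr acQP
  have hlm : Measurable (llr (birthMeasure H μ) (reducedPalm μ)) := measurable_llr _ _
  have hfm : Measurable fun ζ => birthRate H 0 ζ * llr (birthMeasure H μ) (reducedPalm μ) ζ :=
    (hH.measurable_birthRate_right 0).mul hlm
  have iQ' : Integrable (llr (birthMeasure H μ) (reducedPalm μ)) (birthMeasure H μ) := by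
    have := (integrable_congr hneg).2 iQ
    simpa using this.neg
  have hfi := hH.integrable_birthRate_mul iQ'
  refine ⟨hfi, ?_⟩
  have hψm : Measurable fun η : Config d =>
      llr (reducedPalm μ) (birthMeasure H μ) (removeOrigin η) :=
    (measurable_llr _ _).comp measurable_removeOrigin
  have hψi : Integrable (fun η : Config d =>
      llr (reducedPalm μ) (birthMeasure H μ) (removeOrigin η)) (palm μ) := by
    have h : Integrable (llr (reducedPalm μ) (birthMeasure H μ))
      ((palm μ).map removeOrigin) := iP
    exact h.comp_measurable measurable_removeOrigin
  obtain ⟨Y, hY, hlim⟩ := exists_isPalmCondExp hμθ hμ1 hψm hψi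
  refine ⟨Y, hY, ?_⟩
  have hlim2 := (tendsto_ergodicError hμθ hfm hfi).add hlim
  rw [add_zero] at hlim2
  refine tendsto_of_tendsto_of_tendsto_of_le_of_le tendsto_const_nhds hlim2 (fun _ => zero_le)
    fun n => ?_
  -- The net rate subtracts the birth term; inverting the density absorbs the sign and produces the
  -- first conditional expectation. The identity, known almost everywhere for the birth measure,
  -- transfers to μ because birth rates are positive.
  have hae : (fun ζ => -(birthRate H 0 ζ * llr (reducedPalm μ) (birthMeasure H μ) ζ)) =ᵐ[μ]
      fun ζ => birthRate H 0 ζ * llr (birthMeasure H μ) (reducedPalm μ) ζ := by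
    filter_upwards [hH.birthMeasure_ac.ae_le hneg] with ζ hζ
    have : llr (reducedPalm μ) (birthMeasure H μ) ζ =
        -llr (birthMeasure H μ) (reducedPalm μ) ζ := hζ.symm
    rw [this]
    ring
  have hsplit : (fun η => (volume (box d n)).toReal⁻¹ * netRate H (box d n)
          (fun z => llr (reducedPalm μ) (birthMeasure H μ) (z.2.shift z.1)) η -
        ((μ[fun ζ => birthRate H 0 ζ * llr (birthMeasure H μ) (reducedPalm μ) ζ |
          invariantSets d]) η + Y η)) =ᵐ[μ]
      (fun η => boxAverage n (fun ζ => birthRate H 0 ζ *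
          llr (birthMeasure H μ) (reducedPalm μ) ζ) η -
        (μ[fun ζ => birthRate H 0 ζ * llr (birthMeasure H μ) (reducedPalm μ) ζ |
          invariantSets d]) η) +
      fun η => (volume (box d n)).toReal⁻¹ * (∫ z in box d n, llr (reducedPalm μ)
        (birthMeasure H μ) (removeOrigin (η.shift z)) ∂η.ptsMeasure) - Y η := by
    filter_upwards [boxAverage_congr_ae hμθ n hae] with η hη
    rw [Pi.add_apply, ← hη, boxAverage, netRate, integral_neg]
    -- Deleting z and then centring at z is the same as centring and removing the origin.
    simp only [removeOrigin, hH.birthRate_shift, Config.shift_del, sub_self]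
    ring
  rw [eLpNorm_congr_ae hsplit]
  refine eLpNorm_add_le ?_ ?_ le_rfl
  · exact (measurable_boxAverage n hfm).aestronglyMeasurable.sub
      (stronglyMeasurable_condExp.mono invariantSets_le).aestronglyMeasurable
  · refine AEStronglyMeasurable.sub ?_ hY.integrable.aestronglyMeasurable
    exact ((measurable_setIntegral_ptsMeasure
      (f := fun z => llr (reducedPalm μ) (birthMeasure H μ) (removeOrigin (z.1.shift z.2)))
      (hψm.comp measurable_shift_swap) (measurableSet_box d n)).const_mul _).aestronglyMeasurable

end PalmLimit

end

end BirthDeath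

/-! ### Entropy production per unit volume: the main theorem -/

theorem mainTheorem2 {d : ℕ} (hd : 0 < d)
    (H : FinConfig d → ℝ) (hH : IsInteraction H)
    (ν : Measure (Config d)) (hν : IsGibbs H ν) (hνθ : IsShiftInvariant ν)
    (μ : Measure (Config d)) [IsProbabilityMeasure μ] (hμθ : IsShiftInvariant μ)
    (hμ1 : ∫⁻ η, (Config.count (unitCube d) η : ENNReal) ∂μ < ⊤)
    (hμπ : ∀ Λ : Set (Space d), Bornology.IsBounded Λ → MeasurableSet Λ →
      marginal Λ μ ≪ poissonOn Λ ∧ poissonOn Λ ≪ marginal Λ μ) :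
    ∃ σ : EReal,
      Tendsto (fun n : ℕ => (((volume (box d n)).toReal⁻¹ : ℝ) : EReal) *
        entropyProduction H μ ν (box d n)) atTop (𝓝 σ) ∧
      σ = relEntropy (birthMeasure H μ) (reducedPalm μ) +
        relEntropy (reducedPalm μ) (birthMeasure H μ) ∧
      (σ < ⊤ →
        (∀ n : ℕ, 1 ≤ n → HasDissipation H μ ν (box d n)) ∧
        Integrable (fun η => birthRate H 0 η * llr (birthMeasure H μ) (reducedPalm μ) η) μ ∧
        ∃ Y : Config d → ℝ,
          IsPalmCondExp μ
            (fun η => llr (reducedPalm μ) (birthMeasure H μ) (removeOrigin η)) Y ∧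
          Tendsto (fun n : ℕ => eLpNorm
            (fun η => (volume (box d n)).toReal⁻¹ * dissipation H μ ν (box d n) η -
              ((μ[fun ζ => birthRate H 0 ζ * llr (birthMeasure H μ) (reducedPalm μ) ζ |
                invariantSets d]) η + Y η)) 1 μ) atTop (𝓝 0)) := by
  have : NeZero d := ⟨hd.ne'⟩
  have hνp := hν.isProbabilityMeasure
  have fP := isFiniteMeasure_reducedPalm hμθ hμ1
  have fQ := hH.isFiniteMeasure_birthMeasure (μ := μ)
  obtain ⟨C, -, hC⟩ := hH.exists_bound
  obtain ⟨m, hm⟩ := hH.exists_boundary_width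
  -- The marginals of μ and ν are equivalent because each is equivalent to the Poisson law.
  have hw : ∀ n, IsWindow H μ ν (box d n) (box d (n - m)) C := fun n => by
    have hb := isBounded_box d n
    have hΛ := measurableSet_box d n
    exact ⟨hb, hΛ, (hμπ _ hb hΛ).1.trans (hH.ac_marginal hν hb hΛ),
      (hH.marginal_ac hν hb hΛ).trans (hμπ _ hb hΛ).2, hC, measurableSet_box d _, hm n⟩
  refine ⟨palmDiv H μ, hH.tendsto_entropyProduction hν hμθ hμ1 hw, ?_, fun hσ => ?_⟩
  · rw [add_comm, relEntropy_add_relEntropy, palmDiv]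
  have hfin : palmDiv H μ ≠ ⊤ := by
    rintro h
    rw [h, EReal.coe_ennreal_top] at hσ
    exact lt_irrefl _ hσ
  have hD : ∀ n, HasDissipation H μ ν (box d n) := fun n => by
    refine (hH.hasDissipation_iff hν hμθ hμ1 (hw n).isBounded (hw n).measurableSet
      (hw n).marginal_ac (hw n).ac_marginal).1.2 (ne_top_of_le_ne_top ?_
        (hH.localDiv_le hμθ hμ1 (hw n).isBounded (hw n).measurableSet))
    exact ENNReal.mul_ne_top (volume_box_lt_top d n).ne hfin
  obtain ⟨hi, Y, hY, hlim⟩ := hH.exists_tendsto_netRate hμθ hμ1 hfin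
  refine ⟨fun n _ => hD n, hi, Y, hY, ?_⟩
  have hsum := (hH.tendsto_lintegral_dissipation_sub hν hμθ hμ1 hw hfin).add hlim
  rw [add_zero] at hsum
  refine tendsto_of_tendsto_of_tendsto_of_le_of_le tendsto_const_nhds hsum (fun _ => zero_le)
    fun n => ?_
  set g : Space d × Config d → ℝ :=
    fun z => llr (reducedPalm μ) (birthMeasure H μ) (z.2.shift z.1)
  have hgm : Measurable g := (measurable_llr _ _).comp Config.measurable_shift_prod
  have hnm : Measurable (netRate H (box d n) g) := hH.measurable_netRate (measurableSet_box d n) hgm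
  have hEm : MeasureTheory.AEStronglyMeasurable (fun η =>
      (μ[fun ζ => birthRate H 0 ζ * llr (birthMeasure H μ) (reducedPalm μ) ζ |
        invariantSets d]) η + Y η) μ :=
    (stronglyMeasurable_condExp.mono invariantSets_le).aestronglyMeasurable.add
      hY.integrable.aestronglyMeasurable
  -- The first summand is the cost of replacing the dissipation by the Palm net rate, the second the
  -- ergodic error.
  have hsplit : (fun η => (volume (box d n)).toReal⁻¹ * dissipation H μ ν (box d n) η -
      ((μ[fun ζ => birthRate H 0 ζ * llr (birthMeasure H μ) (reducedPalm μ) ζ |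
        invariantSets d]) η + Y η)) =
      ((volume (box d n)).toReal⁻¹ • fun η =>
        dissipation H μ ν (box d n) η - netRate H (box d n) g η) +
      fun η => (volume (box d n)).toReal⁻¹ * netRate H (box d n) g η -
        ((μ[fun ζ => birthRate H 0 ζ * llr (birthMeasure H μ) (reducedPalm μ) ζ |
          invariantSets d]) η + Y η) := by
    funext η
    simp only [Pi.add_apply, Pi.smul_apply, smul_eq_mul]
    ring
  rw [hsplit]
  refine (eLpNorm_add_le (((hD n).2.aestronglyMeasurable.sub
    hnm.aestronglyMeasurable).const_smul _)
    ((hnm.const_mul _).aestronglyMeasurable.sub hEm) le_rfl).trans ?_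
  rw [eLpNorm_const_smul, eLpNorm_one_eq_lintegral_enorm]
  rfl
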